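/- Let $k$ be a field and $E$ a finite-dimensional $\mathbb Z$-graded associative (unital) $k$-algebra. Fix a (possibly empty) family $(e_v)$ of orthogonal idempotents of degree $0$ in $E$. For a commutative $k$-algebra $R$ put $E_R=R\otimes_k E$. Let $CH^{s+t}(E_R/R)_t$ be the space of $R$-multilinear maps $c:E_R^{\otimes_R s}\to E_R$ of degree $t$ that are linear over and normalized with respect to the $e_v$, i.e. $c(\ldots,xe_v,y,\ldots)=c(\ldots,x,e_vy,\ldots)$, $c(e_vx,\ldots)=e_vc(x,\ldots)$, $c(\ldots,xe_v)=c(\ldots,x)e_v$ and $c(\ldots,e_v,\ldots)=0$. (The empty family gives all Hochschild cochains, the family $\{1\}$ gives reduced cochains and strictly unital structures, and the idempotents of the vertices of a quiver give the reduced cochains of $E$ viewed as a category.) Let $HH^{i}(E)_j$ be the cohomology of these cochains for $R=k$ with respect to $\delta(c)=[m_2,c]$, where $m_2$ is the product of $E$. For a cochain $c$ let $D_c$ be the corresponding coderivation of $\mathrm{Bar}(E_R)=\bigoplus_{i\ge1}T^i_R(E_R[1])$. For $3\le n\le\infty$ let $\mathcal A_n(R)$ be the set of minimal $R$-linear $A_n$-structures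 on $E_R$ extending the product: collections $m=(m_2,m_3,\ldots,m_n)$ with $m_2$ the given product and $m_p\in CH^2(E_R/R)_{2-p}$ for $p\ge3$, such that $D_m^2=0$ on $\mathrm{Bar}_{\le n}(E_R)$. Let $\mathfrak G[2,n-1](R)$ be the set of collections $f=(f_1=\mathrm{id},f_2,\ldots,f_{n-1})$ with $f_p\in CH^1(E_R/R)_{1-p}$ for $p\ge 2$ (truncated gauge transformations; the full gauge group if $n=\infty$), and let $\alpha_f$ be the corresponding coalgebra automorphism. Then $\mathcal A_n$ and $\mathfrak G[2,n-1]$ are affine $k$-schemes, $\mathfrak G[2,n-1]$ is a group scheme under composition of coalgebra automorphisms, and it acts on $\mathcal A_n$ by $D_{f*m}=\alpha_fD_m\alpha_f^{-1}$. Let $\mathcal M_n$ be the functor $R\mapsto\mathcal A_n(R)/\mathfrak G[2,n-1](R)$ of gauge equivalence classes on commutative $k$-algebras. A closed subscheme $S\subset X$ of a scheme with an action of a group scheme $G$ is called a nice section if there is a morphism $(\rho,\pi):X\to G\times S$ such that $\pi$ is $G$-invariant, $\rho|_S=1$ and $\rho(x)\pi(x)=x$. (1) Let $3\le n<\infty$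 and assume that $HH^1(E)_{-i}=0$ for $1\le i\le n-3$. Then the action of $\mathfrak G[2,n-1]$ on $\mathcal A_n$ admits a nice section $S_n\subset\mathcal A_n$ such that the affine scheme $S_n$ represents the functor $\mathcal M_n$ via $S_n\hookrightarrow\mathcal A_n\to\mathcal M_n$. (2) Assume that $HH^1(E)_{-i}=0$ for all $i\ge1$. Then the functor $\mathcal M_\infty$ of gauge equivalence classes of minimal $A_\infty$-structures is represented by an affine scheme, namely by the inverse limit of the affine schemes representing the functors $\mathcal M_n$, $n\ge 3$, with transition morphisms given by forgetting the higher products; the representing isomorphism is compatible with the projections $\mathcal M_\infty\to\mathcal M_n$. This holds for any choice of the affine schemes representing the functors $\mathcal M_n$. -/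

import Mathlib

open CategoryTheory TensorProduct Opposite

set_option linter.unusedSectionVars false

universe u

namespace AInf

/-! ### Families of multilinear operations and their compositions

A cochain `c` of arity `s` on a graded algebra `A` is recorded by the component
`A[1]^{⊗ s} → A[1]` of the coderivation `D_c` of the bar construction `Bar(A) = ⊕ T^i(A[1])`
(as a map on `A` it differs from `c` by the usual sign `∏ (-1)^{(s-i)|a_i|}`).  All signs below
are the Koszul signs of `Bar(A)`; multilinear maps are evaluated on words `w : List A`. -/

section Words

variable {R A : Type*} [CommRing R] [Ring A] [Algebra R A]

/-- A family of multilinear operations on `A`, one in each arity. -/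
abbrev Ops (R A : Type*) [CommRing R] [Ring A] [Algebra R A] : Type _ :=
  ∀ p : ℕ, MultilinearMap R (fun _ : Fin p => A) A

/-- The value of a family of operations on a word. -/
def Ops.ev (c : Ops R A) (w : List A) : A := c w.length w.get

/-- `insertSum θ b c (a₁ … aₚ) = ∑ b (θ a₁, …, θ aᵣ, c (aᵣ₊₁, …, aᵣ₊ₛ), aᵣ₊ₛ₊₁, …, aₚ)`, over all
nonempty consecutive subwords.  This is the component `Bar(A) → A[1]` of the composite of the map
with component `b` with the coderivation `D_c`, evaluated on the word `a₁ ⊗ … ⊗ aₚ`.  Here `θ` is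
the Koszul sign of moving `c` past one letter: the identity if `D_c` has even degree, and
`a ↦ (-1)^{|a|-1} a` if `D_c` has odd degree. -/
def insertSum (θ : A → A) (b c : List A → A) (w : List A) : A :=
  ∑ r ∈ Finset.range w.length, ∑ s ∈ Finset.Icc 1 (w.length - r),
    b ((w.take r).map θ ++ c ((w.drop r).take s) :: w.drop (r + s))

/-- `blockSum b f (a₁ … aₚ) = ∑ b (f (block₁), …, f (block_q))`, over all ways of cutting the word
into nonempty consecutive blocks.  This is the component `Bar(A) → A[1]` of the composite of the
map with component `b` with the coalgebra map `α_f` whose component is `f` (of degree `0`). -/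
def blockSum (b f : List A → A) (w : List A) : A :=
  ∑ κ : Composition w.length, b ((w.splitWrtComposition κ).map f)

/-- Multilinearity of a function of words. -/
structure IsMultilin {B : Type*} [AddCommGroup B] [Module R B] (F : List A → B) : Prop where
  add : ∀ u x y v, F (u ++ (x + y) :: v) = F (u ++ x :: v) + F (u ++ y :: v)
  smul : ∀ u (r : R) x v, F (u ++ (r • x) :: v) = r • F (u ++ x :: v)

theorem Ops.ev_eq (c : Ops R A) {p : ℕ} (w : List A) (h : w.length = p) :
    c.ev w = c p (fun i => w.get (i.cast h.symm)) := by
  subst h; rfl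

theorem Ops.ev_ofFn (c : Ops R A) {p : ℕ} (a : Fin p → A) : c.ev (List.ofFn a) = c p a := by
  rw [Ops.ev_eq c _ (List.length_ofFn)]
  congr 1; ext i; simp

theorem get_append_cons (u v : List A) (z x : A) {p : ℕ} (h : (u ++ z :: v).length = p)
    (h' : (u ++ x :: v).length = p) (hu : u.length < p) :
    (fun i : Fin p => (u ++ z :: v).get (i.cast h.symm)) =
      Function.update (fun i : Fin p => (u ++ x :: v).get (i.cast h'.symm)) ⟨u.length, hu⟩ z := by
  ext i
  by_cases hi : i = ⟨u.length, hu⟩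
  · subst hi; simp
  · rw [Function.update_of_ne hi]
    have : (i : ℕ) ≠ u.length := fun hh => hi (Fin.ext hh)
    simp only [List.get_eq_getElem, Fin.val_cast, List.getElem_append, List.getElem_cons]
    split_ifs <;> first | rfl | omega

theorem Ops.isMultilin (c : Ops R A) : IsMultilin (R := R) c.ev where
  add u x y v := by
    have hu : u.length < (u ++ x :: v).length := by simp
    rw [Ops.ev_eq c (p := (u ++ x :: v).length) (u ++ (x + y) :: v) (by simp),
      Ops.ev_eq c (p := (u ++ x :: v).length) (u ++ x :: v) rfl,
      Ops.ev_eq c (p := (u ++ x :: v).length) (u ++ y :: v) (by simp),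
      get_append_cons u v (x + y) x (by simp) rfl hu, get_append_cons u v y x (by simp) rfl hu,
      MultilinearMap.map_update_add]
    congr 2
    rw [← get_append_cons u v x x rfl rfl hu]
  smul u r x v := by
    have hu : u.length < (u ++ x :: v).length := by simp
    rw [Ops.ev_eq c (p := (u ++ x :: v).length) (u ++ (r • x) :: v) (by simp),
      Ops.ev_eq c (p := (u ++ x :: v).length) (u ++ x :: v) rfl,
      get_append_cons u v (r • x) x (by simp) rfl hu,
      MultilinearMap.map_update_smul]
    congr 2
    rw [← get_append_cons u v x x rfl rfl hu]

variable {B : Type*} [AddCommGroup B] [Module R B]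

theorem IsMultilin.sub {F G : List A → B} (hF : IsMultilin (R := R) F)
    (hG : IsMultilin (R := R) G) : IsMultilin (R := R) (fun w => F w - G w) where
  add u x y v := by rw [hF.add, hG.add]; abel
  smul u r x v := by rw [hF.smul, hG.smul, smul_sub]

theorem insertSum_isMultilin {θ : A →ₗ[R] A} {b c : List A → A} (hb : IsMultilin (R := R) b)
    (hc : IsMultilin (R := R) c) : IsMultilin (R := R) (insertSum θ b c) := by
  have key : ∀ (u v : List A) (r s : ℕ), 1 ≤ s → ∃ L : A →ₗ[R] A, ∀ x,
      b (((u ++ x :: v).take r).map θ ++ c (((u ++ x :: v).drop r).take s) ::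
        (u ++ x :: v).drop (r + s)) = L x := by
    intro u v r s hs
    rcases lt_or_ge u.length r with h1 | h1
    · obtain ⟨t, rfl⟩ : ∃ t, r = u.length + (t + 1) := ⟨r - u.length - 1, by omega⟩
      have e2 : u.length + (t + 1) + s = u.length + ((t + s) + 1) := by omega
      refine ⟨⟨⟨fun x => b (u.map θ ++ θ x :: ((v.take t).map θ ++ c ((v.drop t).take s) ::
        v.drop (t + s))), ?_⟩, ?_⟩, ?_⟩
      · intro x y; rw [map_add, hb.add]
      · intro r x; simp only [map_smul, hb.smul, RingHom.id_apply]
      · intro x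
        simp only [e2, List.take_length_add_append, List.drop_length_add_append, List.take_succ_cons,
          List.drop_succ_cons, List.map_append, List.map_cons, List.append_assoc, List.cons_append]
        rfl
    · rcases lt_or_ge u.length (r + s) with h2 | h2
      · obtain ⟨t, ht⟩ : ∃ t, r + s = u.length + (t + 1) := ⟨r + s - u.length - 1, by omega⟩
        have e3 : s = (u.drop r).length + (t + 1) := by simp; omega
        refine ⟨⟨⟨fun x => b ((u.take r).map θ ++ c (u.drop r ++ x :: v.take t) ::
          v.drop t), ?_⟩, ?_⟩, ?_⟩
        · intro x y; rw [hc.add, hb.add]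
        · intro r x; simp only [hc.smul, hb.smul, RingHom.id_apply]
        · intro x
          rw [List.take_append_of_le_length h1, List.drop_append_of_le_length h1, ht,
            List.drop_length_add_append]
          nth_rewrite 1 [e3]
          rw [List.take_length_add_append]
          rfl
      · refine ⟨⟨⟨fun x => b (((u.take r).map θ ++ c ((u.drop r).take s) :: u.drop (r + s)) ++
          x :: v), ?_⟩, ?_⟩, ?_⟩
        · intro x y; rw [hb.add]
        · intro r x; simp only [hb.smul, RingHom.id_apply]
        · intro x
          rw [List.take_append_of_le_length h1, List.drop_append_of_le_length h1,
            List.drop_append_of_le_length h2, List.take_append_of_le_length (by simp; omega)]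
          simp
  constructor
  · intro u x y v
    simp only [insertSum, List.length_append, List.length_cons, ← Finset.sum_add_distrib]
    refine Finset.sum_congr rfl fun r _ => Finset.sum_congr rfl fun s hs => ?_
    obtain ⟨L, hL⟩ := key u v r s (Finset.mem_Icc.1 hs).1
    rw [hL, hL, hL, map_add]
  · intro u a x v
    simp only [insertSum, List.length_append, List.length_cons, Finset.smul_sum]
    refine Finset.sum_congr rfl fun r _ => Finset.sum_congr rfl fun s hs => ?_
    obtain ⟨L, hL⟩ := key u v r s (Finset.mem_Icc.1 hs).1
    rw [hL, hL, map_smul]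

theorem blockSum_isMultilin {b c : List A → A} (hb : IsMultilin (R := R) b)
    (hc : IsMultilin (R := R) c) : IsMultilin (R := R) (blockSum b c) := by
  have key : ∀ (ns : List ℕ) (pre u v : List A), u.length < ns.sum → ∃ L : A →ₗ[R] A, ∀ x,
      b (pre ++ ((u ++ x :: v).splitWrtCompositionAux ns).map c) = L x := by
    intro ns
    induction ns with
    | nil => intro pre u v h; simp at h
    | cons n ns ih =>
      intro pre u v h
      simp only [List.splitWrtCompositionAux_cons, List.map_cons]
      rcases lt_or_ge u.length n with h1 | h1
      · obtain ⟨t, rfl⟩ : ∃ t, n = u.length + (t + 1) := ⟨n - u.length - 1, by omega⟩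
        refine ⟨⟨⟨fun x => b (pre ++ c (u ++ x :: v.take t) ::
          ((v.drop t).splitWrtCompositionAux ns).map c), ?_⟩, ?_⟩, ?_⟩
        · intro x y; rw [hc.add, hb.add]
        · intro r x; simp only [hc.smul, hb.smul, RingHom.id_apply]
        · intro x
          rw [List.take_length_add_append, List.drop_length_add_append]
          rfl
      · obtain ⟨L, hL⟩ := ih (pre ++ [c (u.take n)]) (u.drop n) v (by simp at h ⊢; omega)
        refine ⟨L, fun x => ?_⟩
        rw [← hL, List.take_append_of_le_length h1, List.drop_append_of_le_length h1]
        simp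
  have len : ∀ (w : List A) (n : ℕ), w.length = n → blockSum b c w =
      ∑ κ : Composition n, b ((w.splitWrtCompositionAux κ.blocks).map c) := by
    rintro w _ rfl; rfl
  constructor
  · intro u x y v
    rw [len _ (u.length + (v.length + 1)) (by simp), len _ (u.length + (v.length + 1)) (by simp),
      len _ (u.length + (v.length + 1)) (by simp), ← Finset.sum_add_distrib]
    refine Finset.sum_congr rfl fun κ _ => ?_
    obtain ⟨L, hL⟩ := key κ.blocks [] u v (by rw [κ.blocks_sum]; omega)
    simp only [List.nil_append] at hL
    rw [hL, hL, hL, map_add]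
  · intro u a x v
    rw [len _ (u.length + (v.length + 1)) (by simp), len _ (u.length + (v.length + 1)) (by simp),
      Finset.smul_sum]
    refine Finset.sum_congr rfl fun κ _ => ?_
    obtain ⟨L, hL⟩ := key κ.blocks [] u v (by rw [κ.blocks_sum]; omega)
    simp only [List.nil_append] at hL
    rw [hL, hL, map_smul]

/-- slotwise extension from generators -/
theorem IsMultilin.mem_of_span {F : List A → B} (hF : IsMultilin (R := R) F) (N : Submodule R B)
    (Gs : List (Set A)) (h : ∀ w, List.Forall₂ (fun a G => a ∈ G) w Gs → F w ∈ N) :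
    ∀ w, List.Forall₂ (fun a G => a ∈ Submodule.span R G) w Gs → F w ∈ N := by
  have key : ∀ (Gs₂ Gs₁ : List (Set A)), (∀ w, List.Forall₂ (fun a G => a ∈ G) w (Gs₁ ++ Gs₂) →
      F w ∈ N) → ∀ u v, List.Forall₂ (fun a G => a ∈ G) u Gs₁ →
      List.Forall₂ (fun a G => a ∈ Submodule.span R G) v Gs₂ → F (u ++ v) ∈ N := by
    intro Gs₂
    induction Gs₂ with
    | nil =>
      intro Gs₁ h u v hu hv
      cases hv
      exact h _ (by simpa using hu)
    | cons G Gs₂ ih =>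
      intro Gs₁ h u v hu hv
      cases hv with
      | @cons a _ v _ ha hv =>
        induction ha using Submodule.span_induction with
        | mem a ha =>
          have := ih (Gs₁ ++ [G]) (by simpa using h) (u ++ [a]) v
            (List.rel_append hu (by simpa using ha)) hv
          simpa using this
        | zero =>
          have := hF.smul u (0 : R) 0 v
          simp only [smul_zero, zero_smul] at this
          rw [this]; exact N.zero_mem
        | add x y _ _ hx hy => rw [hF.add]; exact N.add_mem hx hy
        | smul r x _ hx => rw [hF.smul]; exact N.smul_mem r hx
  intro w hw
  simpa using key Gs [] (by simpa using h) [] w .nil hw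

theorem IsMultilin.eq_zero {F : List A → B} (hF : IsMultilin (R := R) F) {G : Set A}
    (hG : Submodule.span R G = ⊤) (n : ℕ) 
    (h : ∀ w : List A, w.length = n → (∀ a ∈ w, a ∈ G) → F w = 0)
    (w : List A) (hw : w.length = n) : F w = 0 := by
  have aux : ∀ (S : Set A) (w : List A), 
      List.Forall₂ (fun a T => a ∈ T) w (List.replicate w.length S) ↔ ∀ a ∈ w, a ∈ S := by
    intro S w
    induction w with
    | nil => simp
    | cons a w ih => simp [List.replicate_succ, ih]
  have := hF.mem_of_span ⊥ (List.replicate n G) (fun w hw => by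
    have hl := hw.length_eq
    simp only [List.length_replicate] at hl
    subst hl
    exact h w rfl ((aux G w).1 hw)) w (by
      subst hw
      have := (aux (Submodule.span R G) w).2 (by simp [hG])
      rw [← List.map_replicate (f := fun T : Set A => (Submodule.span R T : Set A)), List.forall₂_map_right_iff] at this
      exact this)
  simpa using this

end Words

section
variable {k E S N : Type*} [CommRing k] [Ring E] [Algebra k E]
    [CommRing S] [Algebra k S] [AddCommGroup N] [Module k N] [Module S N] [IsScalarTower k S N]

/-! ### Extension of scalars -/

instance multilinearMap_isScalarTower (p : ℕ) :
    IsScalarTower k S (MultilinearMap S (fun _ : Fin p => S ⊗[k] E) N) :=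
  ⟨fun a b c => by ext m; simp⟩

/-- The `S`-multilinear extension to `S ⊗ E` of a `k`-multilinear map on `E`. -/
noncomputable def extendScalars : ∀ p : ℕ, MultilinearMap k (fun _ : Fin p => E) N →ₗ[k]
      MultilinearMap S (fun _ : Fin p => S ⊗[k] E) N
  | 0 =>
    { toFun := fun c => MultilinearMap.constOfIsEmpty S _ (c default)
      map_add' := fun c c' => by ext; simp
      map_smul' := fun r c => by ext; simp }
  | p + 1 =>
    { toFun := fun c => (LinearMap.liftBaseChange S ((extendScalars p).comp c.curryLeft)).uncurryLeft
      map_add' := fun c c' => by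
        ext m
        simp only [LinearMap.uncurryLeft_apply, add_apply]
        induction m 0 with
        | zero => simp
        | tmul s x =>
          have : (c + c').curryLeft x = c.curryLeft x + c'.curryLeft x := rfl
          simp [this]
        | add x y hx hy => simp only [map_add, add_apply, hx, hy]; abel
      map_smul' := fun r c => by
        ext m
        simp only [LinearMap.uncurryLeft_apply, smul_apply, RingHom.id_apply]
        induction m 0 with
        | zero => simp
        | tmul s x =>
          have : (r • c).curryLeft x = r • c.curryLeft x := rfl
          simp only [LinearMap.liftBaseChange_tmul, LinearMap.comp_apply, this, map_smul, smul_apply]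
          exact smul_comm _ _ _
        | add x y hx hy => simp only [map_add, add_apply, hx, hy, smul_add] }

theorem extendScalars_apply (p : ℕ) (c : MultilinearMap k (fun _ : Fin p => E) N) (a : Fin p → E) :
    extendScalars (S := S) p c (fun i => 1 ⊗ₜ a i) = c a := by
  induction p with
  | zero => exact congrArg c (Subsingleton.elim _ _)
  | succ p ih =>
    have := ih (c.curryLeft (a 0)) (fun i => a i.succ)
    simp only [extendScalars, LinearMap.coe_mk, AddHom.coe_mk, LinearMap.uncurryLeft_apply,
      LinearMap.liftBaseChange_tmul, one_smul, LinearMap.comp_apply]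
    refine this.trans ?_
    rw [MultilinearMap.curryLeft_apply]
    congr 1
    exact Fin.cons_self_tail a
end

section Graded

variable {R A : Type*} [CommRing R] [Ring A] [Algebra R A] (𝒜 : ℤ → Submodule R A)
  [GradedAlgebra 𝒜] {V : Type*} (e : V → A)

/-- The Koszul sign of an odd operator passing a letter of `A[1]`: `a ↦ (-1)^{|a|-1} a`. -/
noncomputable def koszul : A →ₗ[R] A :=
  DirectSum.toModule R ℤ A (fun d => ((d - 1).negOnePow : ℤ) • (𝒜 d).subtype) ∘ₗ
    (DirectSum.decomposeLinearEquiv 𝒜).toLinearMap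

theorem koszul_of_mem {d : ℤ} {a : A} (ha : a ∈ 𝒜 d) :
    koszul 𝒜 a = ((d - 1).negOnePow : ℤ) • a := by
  have := DirectSum.decomposeLinearEquiv_apply_coe 𝒜 d ⟨a, ha⟩
  simp only at this
  simp only [koszul, LinearMap.comp_apply, LinearEquiv.coe_coe, this]
  rw [DirectSum.toModule_lof]
  rfl

/-- The product `m₂` of `A`, as the operation `a ⊗ b ↦ (-1)^{|a|} a b` on `A[1]`. -/
noncomputable def prodOp : List A → A
  | [a, b] => -koszul 𝒜 a * b
  | _ => 0

/-- The identity, as an operation of arity one. -/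
def idOp : List A → A
  | [a] => a
  | _ => 0

/-- The operations of arity `s ≥ q` in the family `c` belong to `CH^d(A)_{d-s}`, i.e. they are maps
`A^{⊗ s} → A` of degree `d - s`; moreover they are linear over, and normalized with respect to, the
given family `e` of idempotents of degree `0`.
If `e` is the empty family, these are all Hochschild cochains.  If `e` consists of the unit only,
these are the reduced cochains.  If `e` consists of the idempotents of the vertices of a quiver,
these are the reduced cochains of `A` regarded as a category with these vertices as objects. -/
structure IsCochain (d : ℤ) (q : ℕ) (c : Ops R A) : Prop where
  degree : ∀ (w : List A) (ds : List ℤ), q ≤ w.length →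
    List.Forall₂ (fun a i => a ∈ 𝒜 i) w ds → c.ev w ∈ 𝒜 (ds.sum + d - w.length)
  balanced : ∀ v u x y w, q ≤ (u ++ x :: y :: w).length →
    c.ev (u ++ (x * e v) :: y :: w) = c.ev (u ++ x :: (e v * y) :: w)
  left : ∀ v x w, q ≤ (x :: w).length → c.ev ((e v * x) :: w) = e v * c.ev (x :: w)
  right : ∀ v u x, q ≤ (u ++ [x]).length → c.ev (u ++ [x * e v]) = c.ev (u ++ [x]) * e v
  normalized : ∀ v u w, q ≤ (u ++ e v :: w).length → c.ev (u ++ e v :: w) = 0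

/-- A minimal `R`-linear `A_n`-structure `(m₂, …, m_n)` on `A` (an `A_∞`-structure if `n = ⊤`),
where `m₁ = 0` and `m₂` is the product of `A`, and `m_p ∈ CH^2(A)_{2-p}` for `p ≥ 3`.
The last field is the `A_∞`-identity `D_m D_m = 0` on `Bar_{≤ n}(A)`.  (The entries with index
`p > n`, `p ≥ 3`, are set to zero, they are not part of the structure.) -/
@[ext]
structure AnStructure (n : ℕ∞) where
  op : Ops R A
  low : ∀ w : List A, w.length ≤ 2 → op.ev w = prodOp 𝒜 w
  cochain : IsCochain 𝒜 e 2 3 op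
  truncated : ∀ p : ℕ, 3 ≤ p → n < p → op p = 0
  identity : ∀ w : List A, (w.length : ℕ∞) ≤ n → insertSum (koszul 𝒜) op.ev op.ev w = 0

/-- A gauge transformation `(f₁ = id, f₂, …, f_{n-1})`, with `f_p ∈ CH^1(A)_{1-p}`: an element of
the quotient of the gauge group by the transformations with `f_p = 0` for `2 ≤ p < n` (of the full
gauge group if `n = ⊤`). -/
@[ext]
structure Gauge (n : ℕ∞) where
  op : Ops R A
  low : ∀ w : List A, w.length ≤ 1 → op.ev w = idOp w
  cochain : IsCochain 𝒜 e 1 2 op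
  truncated : ∀ p : ℕ, 2 ≤ p → n ≤ p → op p = 0

/-- `f * m = m'` for `A_n`-structures, i.e. `α_f D_m = D_{m'} α_f` on `Bar_{≤ n}(A)`. -/
def Transforms (n : ℕ∞) (f m m' : Ops R A) : Prop :=
  ∀ w : List A, (w.length : ℕ∞) ≤ n →
    insertSum (koszul 𝒜) f.ev m.ev w = blockSum m'.ev f.ev w

/-- `HH^1(A)_{-i} = 0` (for `i ≥ 1`): each `f ∈ CH^1(A)_{-i}` (which has arity `i + 1`) with
`[m₂, f] = 0` is of the form `[m₂, h]` with `h ∈ CH^0(A)_{-i}` (which has arity `i`).  Here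
`[m₂, c]` is the supercommutator of the coderivations `D_{m₂}`, of degree `1`, and `D_c`, of degree
`0` for `c = f` and of degree `-1` for `c = h`. -/
def HH1Vanishes (i : ℕ) : Prop :=
  ∀ f : Ops R A, (∀ p, p ≠ i + 1 → f p = 0) → IsCochain 𝒜 e 1 1 f →
    (∀ w, insertSum id (prodOp 𝒜) f.ev w - insertSum (koszul 𝒜) f.ev (prodOp 𝒜) w = 0) →
    ∃ h : Ops R A, (∀ p, p ≠ i → h p = 0) ∧ IsCochain 𝒜 e 0 1 h ∧
      ∀ w, f.ev w = insertSum (koszul 𝒜) (prodOp 𝒜) h.ev w +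
        insertSum (koszul 𝒜) h.ev (prodOp 𝒜) w

end Graded

section BaseChange

variable {k E : Type*} [CommRing k] [Ring E] [Algebra k E]
  {R R' : Type*} [CommRing R] [Algebra k R] [CommRing R'] [Algebra k R']

/-- `φ ⊗ id : R ⊗ E → R' ⊗ E`. -/
noncomputable def coeffMap (E : Type*) [Ring E] [Algebra k E] (φ : R →ₐ[k] R') :
    R ⊗[k] E →ₐ[k] R' ⊗[k] E :=
  Algebra.TensorProduct.map φ (AlgHom.id k E)

@[simp] theorem coeffMap_tmul (φ : R →ₐ[k] R') (r : R) (x : E) :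
    coeffMap E φ (r ⊗ₜ x) = φ r ⊗ₜ x := rfl

theorem coeffMap_smul (φ : R →ₐ[k] R') (r : R) (a : R ⊗[k] E) :
    coeffMap E φ (r • a) = φ r • coeffMap E φ a := by
  induction a with
  | zero => simp
  | tmul s x => simp [TensorProduct.smul_tmul']
  | add x y hx hy => simp [smul_add, hx, hy]

/-- Base change of `R`-multilinear operations on `R ⊗ E` along `φ : R → R'`. -/
noncomputable def Ops.map (φ : R →ₐ[k] R') (c : Ops R (R ⊗[k] E)) : Ops R' (R' ⊗[k] E) :=
  fun p => extendScalars p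
    (((coeffMap E φ).toLinearMap.compMultilinearMap ((c p).restrictScalars k)).compLinearMap
      fun _ => (Algebra.TensorProduct.includeRight : E →ₐ[k] R ⊗[k] E).toLinearMap)

theorem span_pure (R : Type*) [CommRing R] [Algebra k R] : 
    Submodule.span R (Set.range fun x : E => (1 : R) ⊗ₜ[k] x) = ⊤ := by
  have := Submodule.baseChange_eq_span (R := k) (A := R) (p := (⊤ : Submodule k E))
  rw [Submodule.baseChange_top] at this
  rw [this]; congr 1; ext; simp

theorem Ops.ev_map_pure (φ : R →ₐ[k] R') (c : Ops R (R ⊗[k] E)) (x : List E) :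
    (c.map φ).ev (x.map fun a => 1 ⊗ₜ a) = coeffMap E φ (c.ev (x.map fun a => 1 ⊗ₜ a)) := by
  rw [Ops.ev_eq _ (p := x.length) _ (by simp), Ops.ev_eq c (p := x.length) _ (by simp)]
  have := extendScalars_apply (S := R') x.length
    (((coeffMap E φ).toLinearMap.compMultilinearMap ((c x.length).restrictScalars k)).compLinearMap
      fun _ => (Algebra.TensorProduct.includeRight : E →ₐ[k] R ⊗[k] E).toLinearMap) x.get
  simp only [Ops.map]
  convert this using 2
  · ext i; simp
  · simp

theorem exists_pure_word {w : List (R ⊗[k] E)}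
    (h : ∀ a ∈ w, a ∈ Set.range fun x : E => (1 : R) ⊗ₜ[k] x) :
    ∃ x : List E, w = x.map fun a => 1 ⊗ₜ a := by
  induction w with
  | nil => exact ⟨[], rfl⟩
  | cons a w ih =>
    obtain ⟨y, rfl⟩ := h a (by simp)
    obtain ⟨x, rfl⟩ := ih fun b hb => h b (by simp [hb])
    exact ⟨y :: x, rfl⟩

theorem Ops.ev_map (φ : R →ₐ[k] R') (c : Ops R (R ⊗[k] E)) (w : List (R ⊗[k] E)) :
    (c.map φ).ev (w.map (coeffMap E φ)) = coeffMap E φ (c.ev w) := by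
  let _ : Module R (R' ⊗[k] E) := Module.compHom _ φ.toRingHom
  have hs : ∀ (r : R) (a : R' ⊗[k] E), r • a = φ r • a := fun _ _ => rfl
  have hF : IsMultilin (R := R) (fun w : List (R ⊗[k] E) =>
      (c.map φ).ev (w.map (coeffMap E φ)) - coeffMap E φ (c.ev w)) := by
    refine IsMultilin.sub ⟨fun u x y v => ?_, fun u r x v => ?_⟩ ⟨fun u x y v => ?_, fun u r x v => ?_⟩
    · simp only [List.map_append, List.map_cons, map_add]
      exact (c.map φ).isMultilin.add _ _ _ _
    · simp only [List.map_append, List.map_cons, coeffMap_smul, hs]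
      exact (c.map φ).isMultilin.smul _ _ _ _
    · rw [c.isMultilin.add, map_add]
    · rw [c.isMultilin.smul, coeffMap_smul, hs]
  refine sub_eq_zero.1 (hF.eq_zero (span_pure R) w.length (fun w _ hw => ?_) w rfl)
  obtain ⟨x, rfl⟩ := exists_pure_word hw
  rw [← Ops.ev_map_pure]
  simp [Function.comp_def]

/-- Operations over `R'` that are base changes are determined by their values on words in the
image of `R ⊗ E`. -/
theorem eq_zero_of_coeffMap (φ : R →ₐ[k] R') {B : Type*} [AddCommGroup B] [Module R' B]
    {F : List (R' ⊗[k] E) → B} (hF : IsMultilin (R := R') F) (n : ℕ)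
    (h : ∀ w : List (R ⊗[k] E), w.length = n → F (w.map (coeffMap E φ)) = 0)
    (w : List (R' ⊗[k] E)) (hw : w.length = n) : F w = 0 := by
  refine hF.eq_zero (span_pure R') n (fun w hn hw => ?_) w hw
  obtain ⟨x, rfl⟩ := exists_pure_word hw
  have := h (x.map fun a => 1 ⊗ₜ a) (by simpa using hn)
  simpa [Function.comp_def] using this

theorem Ops.ext_ev {A : Type*} [Ring A] [Algebra R A] {c c' : Ops R A}
    (h : ∀ w, c.ev w = c'.ev w) : c = c' := by
  funext p; ext a
  rw [← Ops.ev_ofFn, ← Ops.ev_ofFn, h]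

theorem Ops.map_id (c : Ops R (R ⊗[k] E)) : c.map (AlgHom.id k R) = c := by
  refine Ops.ext_ev fun w => ?_
  have h1 : ∀ a : R ⊗[k] E, coeffMap E (AlgHom.id k R) a = a := fun a => by simp [coeffMap]
  have := Ops.ev_map (AlgHom.id k R) c w
  rw [h1] at this
  rw [← this]; congr 1
  exact (List.map_id'' h1 w).symm

theorem Ops.map_comp {R'' : Type*} [CommRing R''] [Algebra k R''] (φ : R →ₐ[k] R')
    (ψ : R' →ₐ[k] R'') (c : Ops R (R ⊗[k] E)) : c.map (ψ.comp φ) = (c.map φ).map ψ := by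
  refine Ops.ext_ev fun w => sub_eq_zero.1 (eq_zero_of_coeffMap (ψ.comp φ)
    ((c.map (ψ.comp φ)).isMultilin.sub ((c.map φ).map ψ).isMultilin) w.length (fun w _ => ?_) w rfl)
  have h1 : ∀ a : R ⊗[k] E, coeffMap E (ψ.comp φ) a = coeffMap E ψ (coeffMap E φ a) := fun a => by
    induction a with
    | zero => simp
    | tmul s x => simp
    | add x y hx hy => simp only [map_add, hx, hy]
  have h2 : w.map (coeffMap E (ψ.comp φ)) = (w.map (coeffMap E φ)).map (coeffMap E ψ) := by
    simp [h1]
  rw [Ops.ev_map, h2, Ops.ev_map, Ops.ev_map, h1, sub_self]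


/-! ### Naturality -/

theorem splitWrtCompositionAux_map {α β : Type*} (g : α → β) (ns : List ℕ) (w : List α) :
    (w.map g).splitWrtCompositionAux ns = (w.splitWrtCompositionAux ns).map (List.map g) := by
  induction ns generalizing w with
  | nil => rfl
  | cons n ns ih =>
    simp only [List.splitWrtCompositionAux_cons, List.map_cons, List.map_take, ← List.map_drop, ih]

theorem blockSum_map {A A' : Type*} [Ring A] [Ring A'] (g : A →+ A') {b c : List A → A}
    {b' c' : List A' → A'} (hb : ∀ w, b' (w.map g) = g (b w)) (hc : ∀ w, c' (w.map g) = g (c w))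
    (w : List A) : blockSum b' c' (w.map g) = g (blockSum b c w) := by
  have len : ∀ (w : List A') (n : ℕ), w.length = n → blockSum b' c' w =
      ∑ κ : Composition n, b' ((w.splitWrtCompositionAux κ.blocks).map c') := by
    rintro w _ rfl; rfl
  rw [len _ w.length (by simp), blockSum, map_sum]
  refine Finset.sum_congr rfl fun κ _ => ?_
  rw [splitWrtCompositionAux_map, ← hb, List.splitWrtComposition]
  congr 1
  simp [Function.comp_def, hc]

theorem insertSum_map {A A' : Type*} [Ring A] [Ring A'] (g : A →+ A') {θ : A → A} {θ' : A' → A'}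
    (hθ : ∀ a, θ' (g a) = g (θ a)) {b c : List A → A}
    {b' c' : List A' → A'} (hb : ∀ w, b' (w.map g) = g (b w)) (hc : ∀ w, c' (w.map g) = g (c w))
    (w : List A) : insertSum θ' b' c' (w.map g) = g (insertSum θ b c w) := by
  simp only [insertSum, map_sum, List.length_map]
  refine Finset.sum_congr rfl fun r _ => Finset.sum_congr rfl fun s _ => ?_
  rw [← hb]
  congr 1
  simp only [List.map_append, List.map_cons, ← hc, List.map_take, List.map_drop, List.map_map]
  congr 3
  funext a
  exact hθ a

theorem koszul_coeffMap (𝒜 : ℤ → Submodule k E) [GradedAlgebra 𝒜] (φ : R →ₐ[k] R')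
    (a : R ⊗[k] E) : koszul (fun i => (𝒜 i).baseChange R') (coeffMap E φ a) =
      coeffMap E φ (koszul (fun i => (𝒜 i).baseChange R) a) := by
  induction a with
  | zero => simp
  | add x y hx hy => simp only [map_add, hx, hy]
  | tmul r x =>
    induction x using DirectSum.Decomposition.inductionOn 𝒜 with
    | zero => simp
    | add x y hx hy => simp only [tmul_add, map_add, hx, hy]
    | @homogeneous d x =>
      rw [coeffMap_tmul, koszul_of_mem (fun i => (𝒜 i).baseChange R) (d := d)
          (Submodule.tmul_mem_baseChange_of_mem _ x.2),
        koszul_of_mem (fun i => (𝒜 i).baseChange R') (d := d)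
          (Submodule.tmul_mem_baseChange_of_mem _ x.2), map_zsmul, coeffMap_tmul]

variable (𝒜 : ℤ → Submodule k E) [GradedAlgebra 𝒜] {V : Type*} (e : V → E)

theorem coeffMap_mem (φ : R →ₐ[k] R') {d : ℤ} {a : R ⊗[k] E} (ha : a ∈ (𝒜 d).baseChange R) :
    coeffMap E φ a ∈ (𝒜 d).baseChange R' := by
  rw [Submodule.baseChange_eq_span] at ha
  induction ha using Submodule.span_induction with
  | mem a ha =>
    obtain ⟨x, hx, rfl⟩ := ha
    simpa using Submodule.tmul_mem_baseChange_of_mem _ hx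
  | zero => simp
  | add x y _ _ hx hy => rw [map_add]; exact Submodule.add_mem _ hx hy
  | smul r x _ hx => rw [coeffMap_smul]; exact Submodule.smul_mem _ _ hx

theorem forall₂_image {α β γ : Type*} (g : α → β) (T : γ → Set α) {w : List β} {ds : List γ}
    (h : List.Forall₂ (fun a i => a ∈ g '' T i) w ds) :
    ∃ x : List α, w = x.map g ∧ List.Forall₂ (fun a i => a ∈ T i) x ds := by
  induction h with
  | nil => exact ⟨[], rfl, .nil⟩
  | cons h _ ih =>
    obtain ⟨y, hy, rfl⟩ := h
    obtain ⟨x, rfl, hx⟩ := ih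
    exact ⟨y :: x, rfl, .cons hy hx⟩

/-- additive induction from pure tensors -/
theorem eq_zero_of_pure {B : Type*} [AddCommGroup B] [Module R B] (F : R ⊗[k] E →ₗ[R] B)
    (h : ∀ x : E, F (1 ⊗ₜ x) = 0) (a : R ⊗[k] E) : F a = 0 := by
  induction a with
  | zero => simp
  | add x y hx hy => rw [map_add, hx, hy, add_zero]
  | tmul r x =>
    have : r ⊗ₜ[k] x = r • ((1 : R) ⊗ₜ[k] x) := by simp [TensorProduct.smul_tmul']
    rw [this, map_smul, h, smul_zero]

theorem IsMultilin.append {A B : Type*} [Ring A] [Algebra R A] [AddCommGroup B] [Module R B]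
    {F : List A → B} (hF : IsMultilin (R := R) F) (v : List A) :
    IsMultilin (R := R) (fun u => F (u ++ v)) where
  add u x y z := by simpa using hF.add u x y (z ++ v)
  smul u r x z := by simpa using hF.smul u r x (z ++ v)

theorem IsMultilin.prepend {A B : Type*} [Ring A] [Algebra R A] [AddCommGroup B] [Module R B]
    {F : List A → B} (hF : IsMultilin (R := R) F) (v : List A) :
    IsMultilin (R := R) (fun u => F (v ++ u)) where
  add u x y z := by simpa using hF.add (v ++ u) x y z
  smul u r x z := by simpa using hF.smul (v ++ u) r x z

/-- The function of the letter in one slot. -/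
def IsMultilin.slot {A B : Type*} [Ring A] [Algebra R A] [AddCommGroup B] [Module R B]
    {F : List A → B} (hF : IsMultilin (R := R) F) (u v : List A) : A →ₗ[R] B where
  toFun x := F (u ++ x :: v)
  map_add' x y := hF.add u x y v
  map_smul' r x := hF.smul u r x v

theorem IsCochain.map (φ : R →ₐ[k] R') {d : ℤ} {q : ℕ} {c : Ops R (R ⊗[k] E)}
    (hc : IsCochain (fun i => (𝒜 i).baseChange R) (fun v => (1 : R) ⊗ₜ[k] e v) d q c) :
    IsCochain (fun i => (𝒜 i).baseChange R') (fun v => (1 : R') ⊗ₜ[k] e v) d q (c.map φ) := by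
  have hm := (c.map φ).isMultilin
  have he : ∀ v, (1 : R') ⊗ₜ[k] e v = coeffMap E φ ((1 : R) ⊗ₜ[k] e v) := fun v => by simp
  have hp : ∀ x : E, (1 : R') ⊗ₜ[k] x = coeffMap E φ ((1 : R) ⊗ₜ[k] x) := fun v => by simp
  constructor
  · intro w ds hq hw
    have hlen := hw.length_eq
    have key := hm.mem_of_span ((fun i => (𝒜 i).baseChange R') (ds.sum + d - w.length))
      (ds.map fun i => coeffMap E φ '' ((𝒜 i).baseChange R : Set (R ⊗[k] E))) (fun y hy => by
        rw [List.forall₂_map_right_iff] at hy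
        obtain ⟨x, rfl, hx⟩ := forall₂_image (coeffMap E φ)
          (fun i => ((𝒜 i).baseChange R : Set (R ⊗[k] E))) hy
        rw [Ops.ev_map]
        have hl := hx.length_eq
        have := hc.degree x ds (by omega) hx
        rw [hl, ← hlen] at this
        exact coeffMap_mem 𝒜 φ this)
    refine key w ?_
    rw [List.forall₂_map_right_iff]
    refine hw.imp fun a i ha => ?_
    have h1 : (𝒜 i).baseChange R' ≤ Submodule.span R' (coeffMap E φ '' ((𝒜 i).baseChange R : Set _)) := by
      rw [Submodule.baseChange_eq_span]
      refine Submodule.span_mono ?_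
      rintro _ ⟨x, hx, rfl⟩
      exact ⟨1 ⊗ₜ x, Submodule.tmul_mem_baseChange_of_mem _ hx, by simp⟩
    exact h1 ha
  · intro v u x y w hq
    rw [← sub_eq_zero]
    refine eq_zero_of_coeffMap φ (F := fun u => (c.map φ).ev (u ++ (x * 1 ⊗ₜ[k] e v) :: y :: w) -
      (c.map φ).ev (u ++ x :: (1 ⊗ₜ[k] e v * y) :: w)) ((hm.append _).sub (hm.append _))
      u.length (fun u' hu => ?_) u rfl
    refine eq_zero_of_coeffMap φ (F := fun w =>
      (c.map φ).ev (u'.map (coeffMap E φ) ++ (x * 1 ⊗ₜ[k] e v) :: y :: w) -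
      (c.map φ).ev (u'.map (coeffMap E φ) ++ x :: (1 ⊗ₜ[k] e v * y) :: w)) (IsMultilin.sub
        (by simpa using hm.prepend (u'.map (coeffMap E φ) ++ [x * 1 ⊗ₜ[k] e v, y]))
        (by simpa using hm.prepend (u'.map (coeffMap E φ) ++ [x, 1 ⊗ₜ[k] e v * y])))
      w.length (fun w' hw => ?_) w rfl
    set U := u'.map (coeffMap E φ)
    set W := w'.map (coeffMap E φ)
    refine eq_zero_of_pure ((hm.slot U (y :: W)).comp (LinearMap.mulRight R' (1 ⊗ₜ[k] e v)) -
      hm.slot U ((1 ⊗ₜ[k] e v * y) :: W)) (fun x => ?_) x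
    have key := fun hyp => eq_zero_of_pure
      ((hm.slot (U ++ [(1 ⊗ₜ[k] x : R' ⊗[k] E) * 1 ⊗ₜ[k] e v]) W) -
      (hm.slot (U ++ [(1 ⊗ₜ[k] x : R' ⊗[k] E)]) W).comp (LinearMap.mulLeft R' (1 ⊗ₜ[k] e v)))
      hyp y
    have h := key fun y => by
      have := hc.balanced v u' (1 ⊗ₜ x) (1 ⊗ₜ y) w' (by simp at hq ⊢; omega)
      have := congrArg (coeffMap E φ) this
      rw [← Ops.ev_map, ← Ops.ev_map] at this
      simpa [IsMultilin.slot, U, W, sub_eq_zero] using this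
    simpa [IsMultilin.slot, sub_eq_zero] using h
  · intro v x w hq
    rw [← sub_eq_zero]
    refine eq_zero_of_coeffMap φ (F := fun w => (c.map φ).ev ((1 ⊗ₜ[k] e v * x) :: w) -
      LinearMap.mulLeft R' (1 ⊗ₜ[k] e v) ((c.map φ).ev (x :: w)))
      (IsMultilin.sub (hm.prepend [_]) ⟨fun u a b z => ?_, fun u r a z => ?_⟩) w.length
      (fun w' hw => ?_) w rfl
    · rw [← map_add]; congr 1; exact hm.add (x :: u) a b z
    · rw [← map_smul]; congr 1; exact hm.smul (x :: u) r a z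
    set W := w'.map (coeffMap E φ)
    refine eq_zero_of_pure ((hm.slot [] W).comp (LinearMap.mulLeft R' (1 ⊗ₜ[k] e v)) -
      (LinearMap.mulLeft R' (1 ⊗ₜ[k] e v)).comp (hm.slot [] W)) (fun x => ?_) x
    have := hc.left v (1 ⊗ₜ x) w' (by simp at hq ⊢; omega)
    have := congrArg (coeffMap E φ) this
    rw [map_mul, ← Ops.ev_map, ← Ops.ev_map] at this
    simpa [IsMultilin.slot, W, sub_eq_zero] using this
  · intro v u x hq
    rw [← sub_eq_zero]
    refine eq_zero_of_coeffMap φ (F := fun u => (c.map φ).ev (u ++ [x * 1 ⊗ₜ[k] e v]) -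
      LinearMap.mulRight R' (1 ⊗ₜ[k] e v) ((c.map φ).ev (u ++ [x])))
      (IsMultilin.sub (hm.append [_]) ⟨fun u a b z => ?_, fun u r a z => ?_⟩) u.length
      (fun u' hu => ?_) u rfl
    · rw [← map_add, (hm.append _).add]
    · rw [← map_smul, (hm.append _).smul]
    set U := u'.map (coeffMap E φ)
    refine eq_zero_of_pure ((hm.slot U []).comp (LinearMap.mulRight R' (1 ⊗ₜ[k] e v)) -
      (LinearMap.mulRight R' (1 ⊗ₜ[k] e v)).comp (hm.slot U [])) (fun x => ?_) x
    have := hc.right v u' (1 ⊗ₜ x) (by simp at hq ⊢; omega)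
    have := congrArg (coeffMap E φ) this
    rw [map_mul, ← Ops.ev_map, ← Ops.ev_map] at this
    simpa [IsMultilin.slot, U, sub_eq_zero] using this
  · intro v u w hq
    refine eq_zero_of_coeffMap φ (F := fun u => (c.map φ).ev (u ++ (1 ⊗ₜ[k] e v) :: w))
      (hm.append _) u.length (fun u' hu => ?_) u rfl
    have hm' := hm.prepend (u'.map (coeffMap E φ) ++ [1 ⊗ₜ[k] e v])
    simp only [List.append_assoc, List.cons_append, List.nil_append] at hm'
    refine eq_zero_of_coeffMap φ (F := fun w => (c.map φ).ev (u'.map (coeffMap E φ) ++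
      (1 ⊗ₜ[k] e v) :: w)) hm'
      w.length (fun w' hw => ?_) w rfl
    have := hc.normalized v u' w' (by simp at hq ⊢; omega)
    have := congrArg (coeffMap E φ) this
    rw [← Ops.ev_map] at this
    simpa using this

/-- Base change of `A_n`-structures. -/
noncomputable def AnStructure.map (φ : R →ₐ[k] R') {n : ℕ∞}
    (m : AnStructure (fun i => (𝒜 i).baseChange R) (fun v => (1 : R) ⊗ₜ[k] e v) n) :
    AnStructure (fun i => (𝒜 i).baseChange R') (fun v => (1 : R') ⊗ₜ[k] e v) n where
  op := m.op.map φ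
  low w hw := by
    match w, hw with
    | [], _ => simpa [m.low, prodOp] using Ops.ev_map φ m.op []
    | [a], _ =>
      refine eq_zero_of_coeffMap φ (m.op.map φ).isMultilin 1 (fun w h => ?_) [a] rfl
      obtain ⟨b, rfl⟩ := List.length_eq_one_iff.1 h
      rw [Ops.ev_map, m.low _ (by simp)]; simp [prodOp]
    | [a, b], _ =>
      have hm := (m.op.map φ).isMultilin
      rw [← sub_eq_zero]
      have key := fun hyp => eq_zero_of_pure (hm.slot [] [b] + (LinearMap.mulRight R' b).comp
        (koszul (fun i => (𝒜 i).baseChange R'))) hyp a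
      have h := key fun x => by
        have key := fun hyp => eq_zero_of_pure (hm.slot [1 ⊗ₜ x] [] +
          (LinearMap.mulLeft R' (koszul (fun i => (𝒜 i).baseChange R') (1 ⊗ₜ x)))) hyp b
        have h := key fun y => by
          have := Ops.ev_map φ m.op [1 ⊗ₜ x, 1 ⊗ₜ y]
          rw [m.low _ (by simp)] at this
          simp only [prodOp, List.map_cons, List.map_nil, map_mul, map_neg,
            ← koszul_coeffMap, coeffMap_tmul, map_one] at this
          simp [IsMultilin.slot, this]
        simpa [IsMultilin.slot] using h
      simpa [IsMultilin.slot, prodOp] using h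
  cochain := m.cochain.map 𝒜 e φ
  truncated p hp hn := by
    refine MultilinearMap.ext fun a => ?_
    rw [← Ops.ev_ofFn]
    refine eq_zero_of_coeffMap φ (m.op.map φ).isMultilin p (fun w h => ?_) _ (by simp)
    rw [Ops.ev_map, Ops.ev_eq _ _ h, m.truncated p hp hn]; simp
  identity w hw := by
    refine eq_zero_of_coeffMap φ (insertSum_isMultilin (m.op.map φ).isMultilin
      (m.op.map φ).isMultilin) w.length (fun w' h => ?_) w rfl
    have := insertSum_map (coeffMap E φ : R ⊗[k] E →+ R' ⊗[k] E) (koszul_coeffMap 𝒜 φ) (Ops.ev_map φ m.op)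
      (Ops.ev_map φ m.op) w'
    refine this.trans ?_
    rw [m.identity w' (by rwa [h])]; simp

/-- Base change of gauge transformations. -/
noncomputable def Gauge.map (φ : R →ₐ[k] R') {n : ℕ∞}
    (f : Gauge (fun i => (𝒜 i).baseChange R) (fun v => (1 : R) ⊗ₜ[k] e v) n) :
    Gauge (fun i => (𝒜 i).baseChange R') (fun v => (1 : R') ⊗ₜ[k] e v) n where
  op := f.op.map φ
  low w hw := by
    match w, hw with
    | [], _ => simpa [f.low, idOp] using Ops.ev_map φ f.op []
    | [a], _ =>
      have hm := (f.op.map φ).isMultilin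
      rw [← sub_eq_zero]
      refine eq_zero_of_pure (hm.slot [] [] - LinearMap.id) (fun x => ?_) a
      have := Ops.ev_map φ f.op [1 ⊗ₜ x]
      rw [f.low _ (by simp)] at this
      simp only [idOp, List.map_cons, List.map_nil, coeffMap_tmul, map_one] at this
      simp [IsMultilin.slot, this]
  cochain := f.cochain.map 𝒜 e φ
  truncated p hp hn := by
    refine MultilinearMap.ext fun a => ?_
    rw [← Ops.ev_ofFn]
    refine eq_zero_of_coeffMap φ (f.op.map φ).isMultilin p (fun w h => ?_) _ (by simp)
    rw [Ops.ev_map, Ops.ev_eq _ _ h, f.truncated p hp hn]; simp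

theorem Transforms.map (φ : R →ₐ[k] R') {n : ℕ∞} {f m m' : Ops R (R ⊗[k] E)}
    (h : Transforms (fun i => (𝒜 i).baseChange R) n f m m') :
    Transforms (fun i => (𝒜 i).baseChange R') n (f.map φ) (m.map φ) (m'.map φ) := by
  intro w hw
  rw [← sub_eq_zero]
  refine eq_zero_of_coeffMap φ ((insertSum_isMultilin (f.map φ).isMultilin
    (m.map φ).isMultilin).sub (blockSum_isMultilin (m'.map φ).isMultilin
    (f.map φ).isMultilin)) w.length (fun w' h' => ?_) w rfl
  have h1 := insertSum_map (coeffMap E φ : R ⊗[k] E →+ R' ⊗[k] E) (koszul_coeffMap 𝒜 φ)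
    (Ops.ev_map φ f) (Ops.ev_map φ m) w'
  have h2 := blockSum_map (coeffMap E φ : R ⊗[k] E →+ R' ⊗[k] E)
    (Ops.ev_map φ m') (Ops.ev_map φ f) w'
  rw [sub_eq_zero]
  refine h1.trans (Eq.trans ?_ h2.symm)
  rw [h w' (by rwa [h'])]

end BaseChange

section Truncation

variable {R A : Type*} [CommRing R] [Ring A] [Algebra R A] (𝒜 : ℤ → Submodule R A)
  [GradedAlgebra 𝒜] {V : Type*} (e : V → A)

theorem insertSum_congr {θ : A → A} {b b' c c' : List A → A} {w : List A}
    (hb : ∀ v : List A, v.length ≤ w.length → b v = b' v)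
    (hc : ∀ v : List A, v.length ≤ w.length → c v = c' v) :
    insertSum θ b c w = insertSum θ b' c' w := by
  refine Finset.sum_congr rfl fun r hr => Finset.sum_congr rfl fun s hs => ?_
  simp only [Finset.mem_range, Finset.mem_Icc] at hr hs
  rw [hc _ (by simp), hb _ (by simp; omega)]

open Classical in
/-- Discard the operations of those arities that satisfy `P`. -/
noncomputable def Ops.discard (P : ℕ → Prop) (c : Ops R A) : Ops R A :=
  fun p => if P p then 0 else c p

theorem Ops.discard_ev (P : ℕ → Prop) (c : Ops R A) {w : List A} (h : ¬ P w.length) :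
    (c.discard P).ev w = c.ev w := by
  simp [Ops.ev, Ops.discard, h]

theorem Ops.discard_ev_zero (P : ℕ → Prop) (c : Ops R A) {w : List A} (h : P w.length) :
    (c.discard P).ev w = 0 := by
  simp [Ops.ev, Ops.discard, h]

variable {𝒜 e}

theorem IsCochain.discard (P : ℕ → Prop) {d : ℤ} {q : ℕ} {c : Ops R A}
    (hc : IsCochain 𝒜 e d q c) : IsCochain 𝒜 e d q (c.discard P) where
  degree w ds hq hw := by
    by_cases h : P w.length
    · rw [Ops.discard_ev_zero P c h]; exact Submodule.zero_mem _
    · rw [Ops.discard_ev P c h]; exact hc.degree w ds hq hw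
  balanced v u x y w hq := by
    by_cases h : P (u ++ x :: y :: w).length
    · rw [Ops.discard_ev_zero P c (by simpa using h), Ops.discard_ev_zero P c (by simpa using h)]
    · rw [Ops.discard_ev P c (by simpa using h), Ops.discard_ev P c (by simpa using h)]
      exact hc.balanced v u x y w hq
  left v x w hq := by
    by_cases h : P (x :: w).length
    · rw [Ops.discard_ev_zero P c (by simpa using h), Ops.discard_ev_zero P c (by simpa using h),
        mul_zero]
    · rw [Ops.discard_ev P c (by simpa using h), Ops.discard_ev P c (by simpa using h)]
      exact hc.left v x w hq
  right v u x hq := by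
    by_cases h : P (u ++ [x]).length
    · rw [Ops.discard_ev_zero P c (by simpa using h), Ops.discard_ev_zero P c (by simpa using h),
        zero_mul]
    · rw [Ops.discard_ev P c (by simpa using h), Ops.discard_ev P c (by simpa using h)]
      exact hc.right v u x hq
  normalized v u w hq := by
    by_cases h : P (u ++ e v :: w).length
    · rw [Ops.discard_ev_zero P c h]
    · rw [Ops.discard_ev P c h]; exact hc.normalized v u w hq

/-- The `A_n`-structure underlying an `A_{n'}`-structure, `n ≤ n'`, obtained by forgetting
`m_p` for `p > n`. -/
noncomputable def AnStructure.trunc {n n' : ℕ∞} (h : n ≤ n') (m : AnStructure 𝒜 e n') :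
    AnStructure 𝒜 e n where
  op := m.op.discard fun p => 3 ≤ p ∧ n < p
  low w hw := by rw [Ops.discard_ev _ _ (by omega), m.low w hw]
  cochain := m.cochain.discard _
  truncated p hp hn := by simp [Ops.discard, hp, hn]
  identity w hw := by
    rw [← m.identity w (hw.trans h)]
    have : ∀ v : List A, v.length ≤ w.length → ¬ (3 ≤ v.length ∧ n < v.length) :=
      fun v hv h' => absurd (h'.2.trans_le ((Nat.cast_le.2 hv).trans hw)) (lt_irrefl _)
    exact insertSum_congr (fun v hv => Ops.discard_ev _ _ (this v hv))
      (fun v hv => Ops.discard_ev _ _ (this v hv))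

/-- The projection of (truncated) gauge groups. -/
noncomputable def Gauge.trunc {n n' : ℕ∞} (_ : n ≤ n') (f : Gauge 𝒜 e n') : Gauge 𝒜 e n where
  op := f.op.discard fun p => 2 ≤ p ∧ n ≤ p
  low w hw := by rw [Ops.discard_ev _ _ (by omega), f.low w hw]
  cochain := f.cochain.discard _
  truncated p hp hn := by simp [Ops.discard, hp, hn]

theorem Ops.ev_zero_letter (c : Ops R A) (u v : List A) : c.ev (u ++ 0 :: v) = 0 := by
  have := c.isMultilin.smul u (0 : R) 0 v
  simpa using this

theorem Transforms.trunc {n n' : ℕ∞} (h : n ≤ n') {f : Gauge 𝒜 e n'} {m m' : AnStructure 𝒜 e n'}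
    (H : Transforms 𝒜 n' f.op m.op m'.op) :
    Transforms 𝒜 n (f.trunc h).op (m.trunc h).op (m'.trunc h).op := by
  intro w hw
  have h3 : ∀ v : List A, v.length ≤ w.length → ¬ (3 ≤ v.length ∧ n < v.length) :=
    fun v hv h' => absurd (h'.2.trans_le ((Nat.cast_le.2 hv).trans hw)) (lt_irrefl _)
  have h2 : ∀ v : List A, v.length < w.length → ¬ (2 ≤ v.length ∧ n ≤ v.length) :=
    fun v hv h' => absurd ((Nat.cast_lt.2 hv).trans_le (hw.trans h'.2)) (lt_irrefl _)
  have e1 : insertSum (koszul 𝒜) (f.trunc h).op.ev (m.trunc h).op.ev w =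
      insertSum (koszul 𝒜) f.op.ev m.op.ev w := by
    refine Finset.sum_congr rfl fun r hr => Finset.sum_congr rfl fun s hs => ?_
    simp only [Finset.mem_range, Finset.mem_Icc] at hr hs
    have e3 : (m.trunc h).op.ev ((w.drop r).take s) = m.op.ev ((w.drop r).take s) :=
      Ops.discard_ev _ _ (h3 _ (by simp))
    rw [e3]
    rcases Nat.lt_or_ge 1 s with h1 | h1
    · exact Ops.discard_ev _ _ (h2 _ (by simp; omega))
    · have hl : ((w.drop r).take s).length = 1 := by simp; omega
      obtain ⟨a, ha⟩ := List.length_eq_one_iff.1 hl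
      have : m.op.ev ((w.drop r).take s) = 0 := by
        rw [m.low _ (by omega), ha]; rfl
      rw [this, Ops.ev_zero_letter, Ops.ev_zero_letter]
  have e2 : blockSum (m'.trunc h).op.ev (f.trunc h).op.ev w = blockSum m'.op.ev f.op.ev w := by
    refine Finset.sum_congr rfl fun κ _ => ?_
    have e4 : ∀ g : List A → A, (m'.trunc h).op.ev ((w.splitWrtComposition κ).map g) =
        m'.op.ev ((w.splitWrtComposition κ).map g) := fun g =>
      Ops.discard_ev _ _ (h3 _ (by simp [κ.length_le]))
    rw [e4]
    rcases Nat.lt_or_ge 1 κ.length with h1 | h1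
    · congr 1
      refine List.map_congr_left fun v hv => Ops.discard_ev _ _ (h2 _ ?_)
      have h5 : v.length ∈ κ.blocks := by
        rw [← List.map_length_splitWrtComposition w κ]
        exact List.mem_map_of_mem hv
      rw [← κ.ofFn_blocksFun, List.mem_ofFn', Set.mem_range] at h5
      obtain ⟨i, hi⟩ := h5
      have h0 : 0 < w.length := by have := κ.length_le; omega
      have h6 : κ ≠ Composition.single w.length h0 := by
        rintro rfl
        simp at h1
      rw [← hi]
      exact (Composition.ne_single_iff h0).1 h6 i
    · have h6 : ∀ g : List A → A, m'.op.ev ((w.splitWrtComposition κ).map g) = 0 := by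
        intro g
        have hl : ((w.splitWrtComposition κ).map g).length ≤ 1 := by simpa using h1
        rw [m'.low _ (by omega)]
        match (w.splitWrtComposition κ).map g, hl with
        | [], _ => rfl
        | [a], _ => rfl
      rw [h6, h6]
  rw [e1, e2]
  exact H w (hw.trans h)

end Truncation

section Functors

variable {k : Type u} [Field k] {E : Type u} [Ring E] [Algebra k E] (𝒜 : ℤ → Submodule k E)
  [GradedAlgebra 𝒜] {V : Type*} (e : V → E)

/-- Minimal `R`-linear `A_n`-structures on `R ⊗ E`. -/
abbrev AnPoints (n : ℕ∞) (R : Type u) [CommRing R] [Algebra k R] : Type u :=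
  AnStructure (fun i => (𝒜 i).baseChange R) (fun v => (1 : R) ⊗ₜ[k] e v) n

/-- `R`-linear gauge transformations `(f₂, …, f_{n-1})` of `R ⊗ E`. -/
abbrev GaugePoints (n : ℕ∞) (R : Type u) [CommRing R] [Algebra k R] : Type u :=
  Gauge (fun i => (𝒜 i).baseChange R) (fun v => (1 : R) ⊗ₜ[k] e v) n

/-- The functor of points, on commutative `k`-algebras, of the scheme of minimal `A_n`-structures
on `E`. -/
noncomputable def anScheme (n : ℕ∞) : CommAlgCat.{u} k ⥤ Type u where
  obj R := AnPoints 𝒜 e n R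
  map φ := ↾fun m => m.map 𝒜 e φ.hom
  map_id R := by
    ext m : 3
    exact (AnStructure.ext (Ops.map_id m.op) : m.map 𝒜 e (AlgHom.id k R) = m)
  map_comp φ ψ := by
    ext m : 3
    exact (AnStructure.ext (Ops.map_comp φ.hom ψ.hom m.op) :
      m.map 𝒜 e (ψ.hom.comp φ.hom) = (m.map 𝒜 e φ.hom).map 𝒜 e ψ.hom)

/-- The functor of points of the group scheme of gauge transformations `(f₂, …, f_{n-1})`. -/
noncomputable def gaugeGroup (n : ℕ∞) : CommAlgCat.{u} k ⥤ Type u where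
  obj R := GaugePoints 𝒜 e n R
  map φ := ↾fun f => f.map 𝒜 e φ.hom
  map_id R := by
    ext m : 3
    exact (Gauge.ext (Ops.map_id m.op) : m.map 𝒜 e (AlgHom.id k R) = m)
  map_comp φ ψ := by
    ext m : 3
    exact (Gauge.ext (Ops.map_comp φ.hom ψ.hom m.op) :
      m.map 𝒜 e (ψ.hom.comp φ.hom) = (m.map 𝒜 e φ.hom).map 𝒜 e ψ.hom)

/-- The operations of an `R`-point of the scheme of `A_n`-structures. -/
def anOps {n : ℕ∞} {R : CommAlgCat.{u} k} (m : (anScheme 𝒜 e n).obj R) : Ops R (R ⊗[k] E) :=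
  AnStructure.op (𝒜 := fun i => (𝒜 i).baseChange R) (e := fun v => (1 : R) ⊗ₜ[k] e v) m

/-- The operations of an `R`-point of the gauge group scheme. -/
def gaugeOps {n : ℕ∞} {R : CommAlgCat.{u} k} (f : (gaugeGroup 𝒜 e n).obj R) :
    Ops R (R ⊗[k] E) :=
  Gauge.op (𝒜 := fun i => (𝒜 i).baseChange R) (e := fun v => (1 : R) ⊗ₜ[k] e v) f

/-- `m` and `m'` are in the same orbit of gauge transformations. -/
def GaugeEquivalent {n : ℕ∞} {R : Type u} [CommRing R] [Algebra k R]
    (m m' : AnPoints 𝒜 e n R) : Prop :=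
  ∃ f : GaugePoints 𝒜 e n R, Transforms (fun i => (𝒜 i).baseChange R) n f.op m.op m'.op

/-- The functor of gauge equivalence classes of minimal `A_n`-structures on `E`. -/
noncomputable def moduli (n : ℕ∞) : CommAlgCat.{u} k ⥤ Type u where
  obj R := Quot (GaugeEquivalent 𝒜 e (n := n) (R := R))
  map φ := ↾Quot.map (fun m => m.map 𝒜 e φ.hom)
    fun _ _ ⟨f, h⟩ => ⟨f.map 𝒜 e φ.hom, h.map 𝒜 φ.hom⟩
  map_id R := by
    ext m
    induction m using Quot.ind with | _ m =>
    exact congrArg (Quot.mk _) (AnStructure.ext (Ops.map_id m.op))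
  map_comp φ ψ := by
    ext m
    induction m using Quot.ind with | _ m =>
    exact congrArg (Quot.mk _) (AnStructure.ext (Ops.map_comp φ.hom ψ.hom m.op))

/-- The projection from `A_n`-structures to gauge equivalence classes. -/
noncomputable def toModuli (n : ℕ∞) : anScheme 𝒜 e n ⟶ moduli 𝒜 e n where
  app _ := ↾fun m => Quot.mk _ m
  naturality _ _ _ := rfl

theorem Ops.discard_map {R R' : Type u} [CommRing R] [Algebra k R] [CommRing R'] [Algebra k R']
    (φ : R →ₐ[k] R') (P : ℕ → Prop) (c : Ops R (R ⊗[k] E)) :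
    (c.discard P).map φ = (c.map φ).discard P := by
  refine Ops.ext_ev fun w => sub_eq_zero.1 (eq_zero_of_coeffMap φ
    (((c.discard P).map φ).isMultilin.sub ((c.map φ).discard P).isMultilin) w.length
    (fun w _ => ?_) w rfl)
  rw [Ops.ev_map]
  by_cases h : P w.length
  · rw [Ops.discard_ev_zero P c h, Ops.discard_ev_zero _ _ (by simpa using h)]; simp
  · rw [Ops.discard_ev P c h, Ops.discard_ev _ _ (by simpa using h), Ops.ev_map, sub_self]

/-- The functors of gauge equivalence classes of `A_n`-structures for all `n ≤ ∞`, with the maps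
given by forgetting the higher operations. -/
noncomputable def moduliTower : ℕ∞ᵒᵖ ⥤ CommAlgCat.{u} k ⥤ Type u where
  obj n := moduli 𝒜 e n.unop
  map h :=
    { app := fun R => ↾Quot.map (fun m => m.trunc (leOfHom h.unop))
        fun _ _ ⟨f, H⟩ => ⟨f.trunc (leOfHom h.unop), H.trunc (leOfHom h.unop)⟩
      naturality := fun R R' φ => by
        ext m
        induction m using Quot.ind with | _ m =>
        exact congrArg (Quot.mk _) (AnStructure.ext (Ops.discard_map φ.hom _ m.op).symm) }
  map_id n := by
    ext R m
    induction m using Quot.ind with | _ m =>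
    refine congrArg (Quot.mk _) (AnStructure.ext (funext fun p => ?_))
    simp only [AnStructure.trunc, Ops.discard]
    split_ifs with h
    · exact (m.truncated p h.1 h.2).symm
    · rfl
  map_comp {n₁ n₂ n₃} h h' := by
    ext R m
    induction m using Quot.ind with | _ m =>
    refine congrArg (Quot.mk _) (AnStructure.ext (funext fun p => ?_))
    have := leOfHom h'.unop
    simp only [AnStructure.trunc, Ops.discard]
    split_ifs with h1 h2 <;> first | rfl | exact absurd ⟨h2.1, this.trans_lt h2.2⟩ h1

/-- The inclusion of the finite stages: `n ↦ n + 3`. -/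
def finiteStage : ℕ ⥤ ℕ∞ := Monotone.functor (f := fun n : ℕ => ((n + 3 : ℕ) : ℕ∞))
  fun _ _ h => Nat.cast_le.2 (Nat.add_le_add_right h 3)

end Functors

/-! ### Nice sections

Affine schemes over `k` and their morphisms are treated through functors of points: an affine
scheme is a corepresentable functor on commutative `k`-algebras, and morphisms are natural
transformations. -/

section NiceSection

variable {k : Type u} [Field k]

/-- `S` is a closed subfunctor (closed subscheme) of `X`: for each `x : Spec R → X` the preimage of
`S` is the closed subscheme of `Spec R` defined by some ideal `I`. -/
def IsClosedSubscheme {X : CommAlgCat.{u} k ⥤ Type u} (S : Subfunctor X) : Prop :=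
  ∀ (R : CommAlgCat.{u} k) (x : X.obj R), ∃ I : Ideal R,
    ∀ (R' : CommAlgCat.{u} k) (φ : R ⟶ R'), X.map φ x ∈ S.obj R' ↔ ∀ a ∈ I, φ.hom a = 0

/-- A closed subscheme `S ⊂ X` is a nice section for the action of `G` on `X` if there is a
morphism `(ρ, π) : X → G × S` such that `π` is `G`-invariant, `ρ(S) = 1` and `ρ(x) π(x) = x`. -/
def IsNiceSection (G X : CommAlgCat.{u} k ⥤ Type u) [∀ R, Group (G.obj R)]
    [∀ R, MulAction (G.obj R) (X.obj R)] (S : Subfunctor X) : Prop :=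
  IsClosedSubscheme S ∧ ∃ (ρ : X ⟶ G) (π : X ⟶ S.toFunctor),
    (∀ (R : CommAlgCat.{u} k) (g : G.obj R) (x : X.obj R), π.app R (g • x) = π.app R x) ∧
    (∀ (R : CommAlgCat.{u} k) (x : X.obj R), x ∈ S.obj R → ρ.app R x = 1) ∧
    (∀ (R : CommAlgCat.{u} k) (x : X.obj R), ρ.app R x • (π.app R x : X.obj R) = x)

end NiceSection

end AInf

open AInf

/-! Operations are treated as functions of words: `pull` is composition with a coalgebra map `α_f`,
and `sandwich` with third argument `idOp` is composition with a coderivation. A multilinear function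
of words is a linear image of the universal one, which takes values in the tensor algebra. In the
convolution ring of such functions `α_f` is the geometric series `1/(1 - f)`, and a coderivation is
a product of three factors. The coalgebra identities thereby become computations in a ring:
`pull_pull`, `sandwich_pull`, `sandwich_sandwich`, and `sandwich_of_homotopy`, by which a cochain
`h` in `CH^0` yields a gauge transformation that commutes with `D_m`. Inverses, the structures `f *
m` and the gauge transformation of a homotopy are fixed points of maps that are contracting for the
length of words (`exists_fixed_word`). This gives the gauge group and its action.

To lowest order the action is the Hochschild differential `δ`: if `f` is the identity below arity `p
- 1`, then `(f * m)_p = m_p - δ f_{p-1}` (`first_order`). Over the field `k` there is a linear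
pseudo-inverse `s` of `δ` on `CH^1` that lowers the arity by one; it extends to all `R ⊗ E`,
compatibly with change of `R` (`exists_splitting`). Call `m` normal if `s m = 0`, and `f` reduced if
`s δ f = f` in arities at least two. On reduced `f` the map `f ↦ f + s (f * m)` is contracting, and
a fixed point is a reduced `f` for which `f * m` is normal. Such an `f` is unique up to truncation
(`Splitting.reduced_unique`), so the normalizer and the normal form are natural in `R`. The normal
structures form a closed subscheme, and none of this needs a condition on `HH^1`.

The vanishing of `HH^1` makes the normal form invariant (`Splitting.orbit_unique`). Let `f` carry a
normal `m` to a normal `m'`, and suppose that they agree below arity `N`. If the lowest nontrivial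
component of `f` is `f_{i+1}` with `i + 3 ≤ N`, it is a cocycle, because `m` and `m'` agree in arity
`i + 2`. Hence it equals `[m₂, h]`, and composing `f` with the automorphism of `m` given by `-h`
removes it (`IsGaugeWord.exists_kill`). So `f` may be assumed to begin in arity `N - 1`, where `m'_N
= m_N - δ f_{N-1}`. Applying `s` gives `s δ f_{N-1} = 0`, whence `δ f_{N-1} = δ s δ f_{N-1} = 0` and
`m'_N = m_N`. The hypothesis on `HH^1` over `k` passes to `R ⊗ E`, again by a pseudo-inverse that
extends to `R`.

Each gauge class thus contains exactly one normal structure. Truncation preserves normality, so a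
compatible family of classes is represented by a compatible family of normal structures, and these
glue to an `A_∞`-structure. Therefore `moduli 𝒜 e ⊤` is the limit of the finite stages, and the
Yoneda embedding identifies it with the functor of the colimit of the representing algebras. -/

namespace AInf

/-! ### Sums over the cuttings of a word -/

section Splits

variable {A B C : Type*} [AddCommMonoid B] [AddCommMonoid C]

/-- The sum of `G v x` over all ways of writing a word as `v ++ x`. -/
def splitSum : List A → (List A → List A → B) → B
  | [], G => G [] []
  | a :: w, G => G [] (a :: w) + splitSum w fun v x => G (a :: v) x

theorem splitSum_nil (G : List A → List A → B) : splitSum [] G = G [] [] := rfl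

theorem splitSum_cons (a : A) (w : List A) (G : List A → List A → B) :
    splitSum (a :: w) G = G [] (a :: w) + splitSum w fun v x => G (a :: v) x := rfl

theorem splitSum_eq_sum_range (w : List A) (G : List A → List A → B) :
    splitSum w G = ∑ s ∈ Finset.range (w.length + 1), G (w.take s) (w.drop s) := by
  induction w generalizing G with
  | nil => simp [splitSum]
  | cons a w ih =>
    rw [splitSum_cons, ih, List.length_cons, Finset.sum_range_succ' _ (w.length + 1), add_comm]
    rfl

theorem splitSum_congr {w : List A} {G G' : List A → List A → B}
    (h : ∀ v x, v ++ x = w → G v x = G' v x) : splitSum w G = splitSum w G' := by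
  induction w generalizing G G' with
  | nil => exact h [] [] rfl
  | cons a w ih =>
    rw [splitSum_cons, splitSum_cons, h [] (a :: w) rfl]
    congr 1
    exact ih fun v x hvx => h (a :: v) x (by simp [hvx])

theorem splitSum_zero (w : List A) : splitSum w (fun _ _ => (0 : B)) = 0 := by
  induction w with
  | nil => rfl
  | cons a w ih => rw [splitSum_cons, ih, add_zero]

theorem splitSum_eq_zero {w : List A} {G : List A → List A → B}
    (h : ∀ v x, v ++ x = w → G v x = 0) : splitSum w G = 0 :=
  (splitSum_congr h).trans (splitSum_zero w)

theorem splitSum_add (w : List A) (G G' : List A → List A → B) :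
    splitSum w (fun v x => G v x + G' v x) = splitSum w G + splitSum w G' := by
  simp only [splitSum_eq_sum_range, Finset.sum_add_distrib]

theorem map_splitSum {F : Type*} [FunLike F B C] [AddMonoidHomClass F B C] (L : F) (w : List A)
    (G : List A → List A → B) : L (splitSum w G) = splitSum w fun v x => L (G v x) := by
  simp only [splitSum_eq_sum_range, map_sum]

/-- Both sides run over the cuttings into three pieces. This is the coassociativity of
deconcatenation, and the source of associativity of the convolution product. -/
theorem splitSum_assoc (w : List A) (G : List A → List A → List A → B) :
    splitSum w (fun v x => splitSum x fun y z => G v y z) =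
      splitSum w (fun t z => splitSum t fun v y => G v y z) := by
  induction w generalizing G with
  | nil => rfl
  | cons a w ih =>
    simp only [splitSum_cons, splitSum_nil, splitSum_add]
    rw [ih, add_assoc]

/-- The cut at the junction of `p` and `q` occurs in both sums on the right; the extra term on the
left compensates for this. -/
theorem splitSum_append (p q : List A) (G : List A → List A → B) :
    splitSum (p ++ q) G + G p q =
      splitSum p (fun v x => G v (x ++ q)) + splitSum q (fun v x => G (p ++ v) x) := by
  induction p generalizing G with
  | nil => simp [splitSum_nil, add_comm]
  | cons a p ih =>
    have := ih fun v x => G (a :: v) x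
    simp only [List.cons_append, splitSum_cons]
    rw [add_assoc, this, add_assoc]

end Splits

/-! ### Composition with coalgebra maps -/

section Pull

variable {A B C : Type*} [AddCommMonoid B] [AddCommMonoid C]

/-- A composition of `n + 1` is its first block `s + 1` together with a composition of `n - s`.
Since `F` depends only on the list of blocks, no transport between types of compositions is needed.
-/
theorem sum_composition_succ (n : ℕ) (F : List ℕ → B) :
    ∑ κ : Composition (n + 1), F κ.blocks =
      ∑ s ∈ Finset.range (n + 1), ∑ κ : Composition (n - s), F ((s + 1) :: κ.blocks) := by
  rw [Finset.sum_sigma']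
  symm
  refine Finset.sum_bij (fun x hx => ⟨(x.1 + 1) :: x.2.blocks, ?_, ?_⟩) ?_ ?_ ?_ ?_
  · intro i hi
    rcases List.mem_cons.1 hi with rfl | hi
    · omega
    · exact x.2.blocks_pos hi
  · have := x.2.blocks_sum
    simp only [Finset.mem_sigma, Finset.mem_range] at hx
    simp; omega
  · intros; exact Finset.mem_univ _
  · rintro ⟨s, κ⟩ _ ⟨s', κ'⟩ _ h
    simp only [Composition.mk.injEq, List.cons.injEq, add_left_inj] at h
    obtain ⟨rfl, h⟩ := h
    simp only [Sigma.mk.injEq, heq_eq_eq, true_and]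
    exact Composition.ext h
  · rintro ⟨bl, hp, hs⟩ _
    cases bl with
    | nil => simp at hs
    | cons s bl =>
      have h0 : 0 < s := hp (by simp)
      simp only [List.sum_cons] at hs
      refine ⟨⟨s - 1, ⟨bl, fun hi => hp (by simp [hi]), by omega⟩⟩, by simp; omega, ?_⟩
      ext1
      simp; omega
  · intros; rfl

/-- `pull X f (a₁ … aₚ) = ∑ X (f (block₁), …, f (block_q))`: the composite of `X` with the
coalgebra map with component `f`. -/
def pull (X : List A → B) (f : List A → A) (w : List A) : B :=
  ∑ κ : Composition w.length, X ((w.splitWrtComposition κ).map f)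

theorem pull_eq_sum (X : List A → B) (f : List A → A) (w : List A) (n : ℕ) (h : w.length = n) :
    pull X f w = ∑ κ : Composition n, X ((w.splitWrtCompositionAux κ.blocks).map f) := by
  subst h; rfl

@[simp] theorem pull_nil (X : List A → B) (f : List A → A) : pull X f [] = X [] := by
  have h : ∀ κ : Composition 0, κ.blocks = [] := fun κ => κ.blocks_eq_nil.2 rfl
  rw [pull_eq_sum _ _ _ 0 rfl]
  simp only [h]
  rw [Finset.sum_const, Finset.card_univ, composition_card]
  simp [List.splitWrtCompositionAux]

/-- The first block consists of `a` and a prefix of `w`. This recursion replaces the sum over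
compositions in most of what follows. -/
theorem pull_cons (X : List A → B) (f : List A → A) (a : A) (w : List A) :
    pull X f (a :: w) = splitSum w fun v x => pull (fun t => X (f (a :: v) :: t)) f x := by
  rw [pull_eq_sum _ _ _ (w.length + 1) rfl,
    sum_composition_succ w.length fun ns => X (((a :: w).splitWrtCompositionAux ns).map f),
    splitSum_eq_sum_range]
  refine Finset.sum_congr rfl fun s _ => ?_
  rw [pull_eq_sum _ _ _ (w.length - s) (by simp)]
  refine Finset.sum_congr rfl fun κ _ => ?_
  rw [List.splitWrtCompositionAux_cons]
  rfl

@[elab_as_elim]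
theorem length_induction {P : List A → Prop}
    (h : ∀ w, (∀ v : List A, v.length < w.length → P v) → P w) (w : List A) : P w := by
  generalize hn : w.length = n
  induction n using Nat.strong_induction_on generalizing w with
  | _ n ih => exact h w fun v hv => ih _ (hn ▸ hv) v rfl

theorem length_le_of_append_eq {v x w : List A} (h : v ++ x = w) : x.length ≤ w.length := by
  rw [← h]; simp

theorem length_le_of_append_eq' {v x w : List A} (h : v ++ x = w) : v.length ≤ w.length := by
  rw [← h]; simp

theorem pull_congr {X X' : List A → B} {f f' : List A → A} {w : List A}
    (hX : ∀ v : List A, v.length ≤ w.length → X v = X' v)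
    (hf : ∀ v : List A, v ≠ [] → v.length ≤ w.length → f v = f' v) : pull X f w = pull X' f' w := by
  induction w using length_induction generalizing X X' with
  | h w ih =>
    match w with
    | [] => simpa using hX [] le_rfl
    | a :: w =>
      rw [pull_cons, pull_cons]
      refine splitSum_congr fun v x h => ?_
      have h1 := length_le_of_append_eq h
      have h2 := length_le_of_append_eq' h
      refine ih x (by simp; omega) (fun t ht => ?_) fun t ht0 ht => hf t ht0 (by simp; omega)
      rw [hf _ (by simp) (by simp; omega), hX _ (by simp; omega)]

theorem pull_add (X Y : List A → B) (f : List A → A) (w : List A) :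
    pull (fun t => X t + Y t) f w = pull X f w + pull Y f w := Finset.sum_add_distrib

theorem pull_zero (f : List A → A) (w : List A) : pull (fun _ => (0 : B)) f w = 0 :=
  Finset.sum_const_zero

theorem map_pull {F : Type*} [FunLike F B C] [AddMonoidHomClass F B C] (L : F) (X : List A → B)
    (f : List A → A) (w : List A) : L (pull X f w) = pull (fun t => L (X t)) f w :=
  map_sum L _ _

end Pull

/-! ### Insertion of one operation, with blocks to its right -/

section Sandwich

variable {A B C : Type*} [AddCommMonoid B] [AddCommMonoid C]

/-- `sandwich θ X c u (a₁ … aₚ) = ∑ X (θ a₁, …, θ aᵣ, c (aᵣ₊₁, …, aᵣ₊ₛ), u (block₁), …, u (block_q))`,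
over all nonempty subwords `aᵣ₊₁, …, aᵣ₊ₛ` and all ways of cutting the rest of the word into nonempty
blocks. -/
def sandwich (θ : A → A) (c u : List A → A) : List A → (List A → B) → B
  | [], _ => 0
  | a :: w, X => (splitSum w fun v x => pull (fun t => X (c (a :: v) :: t)) u x) +
      sandwich θ c u w fun t => X (θ a :: t)

variable (θ : A → A) (c u : List A → A)

@[simp] theorem sandwich_nil (X : List A → B) : sandwich θ c u [] X = 0 := rfl

theorem sandwich_cons (a : A) (w : List A) (X : List A → B) :
    sandwich θ c u (a :: w) X =
      (splitSum w fun v x => pull (fun t => X (c (a :: v) :: t)) u x) +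
        sandwich θ c u w fun t => X (θ a :: t) := rfl

variable {θ c u}

/-- The operation `c` takes at least one letter, so `u` only sees strictly shorter words. This
strictness makes the equation for the gauge transformation of a homotopy recursive. -/
theorem sandwich_congr {c' u' : List A → A} {w : List A} {X X' : List A → B}
    (hX : ∀ v : List A, v.length ≤ w.length → X v = X' v)
    (hc : ∀ v : List A, v ≠ [] → v.length ≤ w.length → c v = c' v)
    (hu : ∀ v : List A, v ≠ [] → v.length < w.length → u v = u' v) :
    sandwich θ c u w X = sandwich θ c' u' w X' := by
  induction w generalizing X X' with
  | nil => rfl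
  | cons a w ih =>
    rw [sandwich_cons, sandwich_cons]
    congr 1
    · refine splitSum_congr fun v x h => ?_
      have h1 := length_le_of_append_eq h
      have h2 := length_le_of_append_eq' h
      refine pull_congr (fun t ht => ?_) fun t ht0 ht => hu t ht0 (by simp; omega)
      rw [hc _ (by simp) (by simp; omega), hX _ (by simp; omega)]
    · exact ih (fun v hv => hX _ (by simpa using hv)) (fun v hv0 hv => hc _ hv0 (by simp; omega))
        fun v hv0 hv => hu v hv0 (by simp; omega)

theorem sandwich_zero (w : List A) : sandwich θ c u w (fun _ => (0 : B)) = 0 := by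
  induction w with
  | nil => rfl
  | cons a w ih => rw [sandwich_cons, ih]; simp [pull_zero, splitSum_zero]

theorem sandwich_add (w : List A) (X Y : List A → B) :
    sandwich θ c u w (fun t => X t + Y t) = sandwich θ c u w X + sandwich θ c u w Y := by
  induction w generalizing X Y with
  | nil => simp
  | cons a w ih =>
    simp only [sandwich_cons, ih, pull_add, splitSum_add]
    exact add_add_add_comm _ _ _ _

theorem map_sandwich {F : Type*} [FunLike F B C] [AddMonoidHomClass F B C] (L : F) (w : List A)
    (X : List A → B) : L (sandwich θ c u w X) = sandwich θ c u w fun t => L (X t) := by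
  induction w generalizing X with
  | nil => simp
  | cons a w ih => simp only [sandwich_cons, map_add, ih, map_splitSum, map_pull]

end Sandwich

/-! ### The convolution ring -/

/-- Functions of words with values in a ring, with the convolution product. -/
@[ext]
structure Conv (A S : Type*) where
  val : List A → S

namespace Conv

variable {A S : Type*} [Ring S]

instance : Zero (Conv A S) := ⟨⟨fun _ => 0⟩⟩

instance : Add (Conv A S) := ⟨fun X Y => ⟨fun w => X.val w + Y.val w⟩⟩

instance : Neg (Conv A S) := ⟨fun X => ⟨fun w => -X.val w⟩⟩

instance : Mul (Conv A S) := ⟨fun X Y => ⟨fun w => splitSum w fun v x => X.val v * Y.val x⟩⟩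

instance : One (Conv A S) := ⟨⟨fun w => match w with | [] => 1 | _ :: _ => 0⟩⟩

theorem mul_apply (X Y : Conv A S) (w : List A) :
    (X * Y).val w = splitSum w fun v x => X.val v * Y.val x := rfl

theorem add_apply (X Y : Conv A S) (w : List A) : (X + Y).val w = X.val w + Y.val w := rfl

theorem zero_apply (w : List A) : (0 : Conv A S).val w = 0 := rfl

@[simp] theorem one_nil : (1 : Conv A S).val [] = 1 := rfl

@[simp] theorem one_cons (a : A) (w : List A) : (1 : Conv A S).val (a :: w) = 0 := rfl

theorem mul_nil (X Y : Conv A S) : (X * Y).val [] = X.val [] * Y.val [] := rfl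

theorem mul_cons (X Y : Conv A S) (a : A) (w : List A) :
    (X * Y).val (a :: w) = X.val [] * Y.val (a :: w) +
      splitSum w fun v x => X.val (a :: v) * Y.val x := rfl

theorem ext_val {X Y : Conv A S} (h : ∀ w, X.val w = Y.val w) : X = Y := Conv.ext (funext h)

/-- The function `v ↦ X (a :: v)`. -/
def tail (X : Conv A S) (a : A) : Conv A S := ⟨fun v => X.val (a :: v)⟩

theorem mul_cons' (X Y : Conv A S) (a : A) (w : List A) :
    (X * Y).val (a :: w) = X.val [] * Y.val (a :: w) + (X.tail a * Y).val w := rfl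

instance : Ring (Conv A S) where
  add_assoc X Y Z := ext_val fun w => add_assoc _ _ _
  zero_add X := ext_val fun w => zero_add _
  add_zero X := ext_val fun w => add_zero _
  add_comm X Y := ext_val fun w => add_comm _ _
  neg_add_cancel X := ext_val fun w => neg_add_cancel _
  left_distrib X Y Z := by
    refine ext_val fun w => ?_
    simp only [mul_apply, add_apply, mul_add, splitSum_add]
  right_distrib X Y Z := by
    refine ext_val fun w => ?_
    simp only [mul_apply, add_apply, add_mul, splitSum_add]
  zero_mul X := ext_val fun w => splitSum_eq_zero fun v x _ => by rw [zero_apply, zero_mul]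
  mul_zero X := ext_val fun w => splitSum_eq_zero fun v x _ => by rw [zero_apply, mul_zero]
  mul_assoc X Y Z := by
    refine ext_val fun w => ?_
    have h1 : ∀ (s : S) (x : List A) (G : List A → List A → S),
        s * splitSum x G = splitSum x fun v y => s * G v y := fun s x G =>
      map_splitSum (AddMonoidHom.mulLeft s) x G
    have h2 : ∀ (s : S) (x : List A) (G : List A → List A → S),
        splitSum x G * s = splitSum x fun v y => G v y * s := fun s x G =>
      map_splitSum (AddMonoidHom.mulRight s) x G
    simp only [mul_apply, h1, h2, mul_assoc]
    exact (splitSum_assoc w fun v y z => X.val v * (Y.val y * Z.val z)).symm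
  one_mul X := by
    refine ext_val fun w => ?_
    cases w with
    | nil => rw [mul_nil, one_nil, one_mul]
    | cons a w =>
      rw [mul_cons, one_nil, one_mul, splitSum_eq_zero, add_zero]
      intros; rw [one_cons, zero_mul]
  mul_one X := by
    refine ext_val fun w => ?_
    induction w generalizing X with
    | nil => rw [mul_nil, one_nil, mul_one]
    | cons a w ih =>
      rw [mul_cons', one_cons, mul_zero, zero_add, ih]
      rfl
  zsmul := zsmulRec
  nsmul := nsmulRec

theorem sub_apply (X Y : Conv A S) (w : List A) : (X - Y).val w = X.val w - Y.val w := by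
  rw [sub_eq_add_neg, sub_eq_add_neg]; rfl

/-- Post-composition with a ring homomorphism. -/
def mapRingHom {S' : Type*} [Ring S'] (φ : S →+* S') : Conv A S →+* Conv A S' where
  toFun X := ⟨fun w => φ (X.val w)⟩
  map_one' := ext_val fun w => by cases w <;> simp
  map_mul' X Y := ext_val fun w => by simp only [mul_apply, map_splitSum, map_mul]
  map_zero' := ext_val fun w => map_zero φ
  map_add' X Y := ext_val fun w => map_add φ _ _

theorem mapRingHom_apply {S' : Type*} [Ring S'] (φ : S →+* S') (X : Conv A S) (w : List A) :
    (mapRingHom φ X).val w = φ (X.val w) := rfl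

/-- Precomposition with the action of a map of letters. -/
def twist (θ : A → A) : Conv A S →+* Conv A S where
  toFun X := ⟨fun w => X.val (w.map θ)⟩
  map_one' := ext_val fun w => by cases w <;> simp
  map_mul' X Y := ext_val fun w => by
    simp only
    induction w generalizing X with
    | nil => rfl
    | cons a w ih =>
      rw [List.map_cons, mul_cons', mul_cons', ih]
      rfl
  map_zero' := rfl
  map_add' _ _ := rfl

theorem twist_apply (θ : A → A) (X : Conv A S) (w : List A) :
    (twist θ X).val w = X.val (w.map θ) := rfl

/-- A factor that vanishes on the empty word consumes a letter, so multiplication by it is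
contracting for the filtration by length. -/
theorem mul_eq_of_vanish {K X Y : Conv A S} (hK : K.val [] = 0) {n : ℕ}
    (h : ∀ w : List A, w.length < n → X.val w = Y.val w) (w : List A) (hw : w.length ≤ n) :
    (K * X).val w = (K * Y).val w := by
  cases w with
  | nil => rw [mul_nil, mul_nil, hK, zero_mul, zero_mul]
  | cons a w =>
    rw [mul_cons, mul_cons, hK, zero_mul, zero_mul]
    congr 1
    refine splitSum_congr fun v x e => ?_
    have h1 := length_le_of_append_eq e
    rw [h x (by simp at hw; omega)]

/-- The equation `X = Y + K X` has at most one solution if `K` vanishes on the empty word. -/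
theorem eq_of_recursion {K Y X X' : Conv A S} (hK : K.val [] = 0) (h : X = Y + K * X)
    (h' : X' = Y + K * X') : X = X' := by
  refine ext_val fun w => ?_
  induction w using length_induction with
  | h w ih =>
    rw [h, h', add_apply, add_apply, mul_eq_of_vanish hK (n := w.length) (fun v hv => ih v hv) w le_rfl]

theorem mul_vanish_left {X Y : Conv A S} {n : ℕ} (h : ∀ w : List A, w.length ≤ n → X.val w = 0)
    (w : List A) (hw : w.length ≤ n) : (X * Y).val w = 0 :=
  splitSum_eq_zero fun v x e => by
    rw [h v ((length_le_of_append_eq' e).trans hw), zero_mul]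

theorem mul_vanish_right {X Y : Conv A S} {n : ℕ} (h : ∀ w : List A, w.length ≤ n → Y.val w = 0)
    (w : List A) (hw : w.length ≤ n) : (X * Y).val w = 0 :=
  splitSum_eq_zero fun v x e => by
    rw [h x ((length_le_of_append_eq e).trans hw), mul_zero]

/-- `X ↦ X ∘ α_f` is a ring endomorphism. -/
def pullHom (f : List A → A) : Conv A S →+* Conv A S where
  toFun X := ⟨pull X.val f⟩
  map_one' := ext_val fun w => by
    cases w with
    | nil => simp
    | cons a w =>
      simp only [pull_cons, one_cons]
      exact splitSum_eq_zero fun v x _ => pull_zero f x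
  map_mul' X Y := ext_val fun w => by
    simp only [mul_apply]
    induction w using length_induction generalizing X with
    | h w ih =>
      match w with
      | [] => simp only [pull_nil, splitSum_nil, mul_nil]
      | a :: w =>
        rw [pull_cons, splitSum_cons]
        -- The convolution product cuts either before the block of `a` or after it; the second case
        -- is the induction hypothesis for a tail of `X`.
        have h1 : ∀ v x, v ++ x = w → pull (fun t => (X * Y).val (f (a :: v) :: t)) f x =
            X.val [] * pull (fun t => Y.val (f (a :: v) :: t)) f x +
            splitSum x fun y z => pull (fun t => X.val (f (a :: v) :: t)) f y * pull Y.val f z := by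
          intro v x h
          simp only [mul_cons']
          rw [pull_add]
          congr 1
          · exact (map_pull (AddMonoidHom.mulLeft (X.val [])) _ f x).symm
          · exact ih x (by have := length_le_of_append_eq h; simp; omega) (X.tail (f (a :: v)))
        rw [splitSum_congr h1, splitSum_add, pull_nil, pull_cons,
          splitSum_assoc w (fun v y z => pull (fun t => X.val (f (a :: v) :: t)) f y * pull Y.val f z)]
        congr 1
        · exact (map_splitSum (AddMonoidHom.mulLeft (X.val [])) w _).symm
        · refine splitSum_congr fun v x _ => ?_
          rw [pull_cons]
          exact (map_splitSum (AddMonoidHom.mulRight (pull Y.val f x)) v _).symm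
  map_zero' := ext_val fun w => pull_zero f w
  map_add' X Y := ext_val fun w => pull_add X.val Y.val f w

theorem pullHom_apply (f : List A → A) (X : Conv A S) (w : List A) :
    (pullHom f X).val w = pull X.val f w := rfl

/-- `X ↦ X ∘ H`, for the `θ`-twisted coderivation `H` with component `c` along the identity and the
coalgebra map with component `u`. -/
def insertHom (θ : A → A) (c u : List A → A) : Conv A S →+ Conv A S where
  toFun X := ⟨fun w => sandwich θ c u w X.val⟩
  map_zero' := ext_val fun w => sandwich_zero w
  map_add' X Y := ext_val fun w => sandwich_add w X.val Y.val

theorem insertHom_apply (θ : A → A) (c u : List A → A) (X : Conv A S) (w : List A) :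
    (insertHom θ c u X).val w = sandwich θ c u w X.val := rfl

theorem insertHom_nil (θ : A → A) (c u : List A → A) (X : Conv A S) :
    (insertHom θ c u X).val [] = 0 := rfl

theorem insertHom_cons (θ : A → A) (c u : List A → A) (X : Conv A S) (a : A) (w : List A) :
    (insertHom θ c u X).val (a :: w) =
      (splitSum w fun v x => (pullHom u (X.tail (c (a :: v)))).val x) +
      (insertHom θ c u (X.tail (θ a))).val w := rfl

theorem insertHom_one (θ : A → A) (c u : List A → A) : insertHom θ c u (1 : Conv A S) = 0 := by
  refine ext_val fun w => ?_
  cases w with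
  | nil => rfl
  | cons a w =>
    rw [insertHom_apply, sandwich_cons]
    simp only [one_cons, sandwich_zero, pull_zero, splitSum_zero, add_zero]
    rfl

theorem tail_mul (X Y : Conv A S) (a : A) :
    (X * Y).tail a = ⟨fun w => X.val [] * (Y.tail a).val w⟩ + X.tail a * Y := rfl

theorem pullHom_mulLeft (f : List A → A) (s : S) (X : Conv A S) (w : List A) :
    (pullHom f ⟨fun w => s * X.val w⟩).val w = s * (pullHom f X).val w :=
  (map_pull (AddMonoidHom.mulLeft s) X.val f w).symm

theorem insertHom_mulLeft (θ : A → A) (c u : List A → A) (s : S) (X : Conv A S) (w : List A) :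
    (insertHom θ c u ⟨fun w => s * X.val w⟩).val w = s * (insertHom θ c u X).val w :=
  (map_sandwich (AddMonoidHom.mulLeft s) w X.val).symm

/-- The inserted operation falls into one of the two factors. Whatever lies to its left is twisted
by `θ`, and whatever lies to its right is cut into `u`-blocks. This twisted Leibniz rule carries the
sign computations below. -/
theorem insertHom_mul (θ : A → A) (c u : List A → A) (X Y : Conv A S) :
    insertHom θ c u (X * Y) = insertHom θ c u X * pullHom u Y + twist θ X * insertHom θ c u Y := by
  refine ext_val fun w => ?_
  rw [add_apply]
  induction w generalizing X with
  | nil => simp [insertHom_nil, mul_nil]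
  | cons a w ih =>
    rw [mul_cons', mul_cons', insertHom_nil, zero_mul, zero_add, insertHom_cons]
    have h1 : ∀ v x, v ++ x = w → (pullHom u ((X * Y).tail (c (a :: v)))).val x =
        X.val [] * (pullHom u (Y.tail (c (a :: v)))).val x +
        splitSum x fun y z => (pullHom u (X.tail (c (a :: v)))).val y * (pullHom u Y).val z := by
      intro v x h
      rw [tail_mul, map_add, add_apply, pullHom_mulLeft, map_mul, mul_apply]
    rw [splitSum_congr h1, splitSum_add, tail_mul, map_add, add_apply, insertHom_mulLeft, ih,
      splitSum_assoc w (fun v y z =>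
        (pullHom u (X.tail (c (a :: v)))).val y * (pullHom u Y).val z)]
    have h5 : ((insertHom θ c u X).tail a * pullHom u Y).val w =
        (splitSum w fun t z => splitSum t fun v y =>
          (pullHom u (X.tail (c (a :: v)))).val y * (pullHom u Y).val z) +
        (insertHom θ c u (X.tail (θ a)) * pullHom u Y).val w := by
      rw [mul_apply, mul_apply, ← splitSum_add]
      refine splitSum_congr fun v x _ => ?_
      rw [tail, insertHom_cons, add_mul]
      congr 1
      exact (map_splitSum (AddMonoidHom.mulRight _) v _)
    have h6 : (splitSum w fun v x => X.val [] * (pullHom u (Y.tail (c (a :: v)))).val x) =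
        X.val [] * splitSum w fun v x => (pullHom u (Y.tail (c (a :: v)))).val x :=
      (map_splitSum (AddMonoidHom.mulLeft (X.val [])) w _).symm
    have h7 : ((twist θ X).tail a * insertHom θ c u Y).val w =
      (twist θ (X.tail (θ a)) * insertHom θ c u Y).val w := rfl
    have h8 : (twist θ X).val [] = X.val [] := rfl
    rw [h5, h6, h7, h8, insertHom_cons, mul_add]
    abel

end Conv

end AInf

namespace AInf

/-! ### Multilinear functions of words and the tensor algebra -/

section Multilinear

variable {R A B C : Type*} [CommRing R] [Ring A] [Algebra R A] [AddCommGroup B] [Module R B]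
  [AddCommGroup C] [Module R C]

theorem IsMultilin.zero_letter {F : List A → B} (hF : IsMultilin (R := R) F) (u v : List A) :
    F (u ++ 0 :: v) = 0 := by
  simpa using hF.smul u (0 : R) 0 v

theorem IsMultilin.neg_letter {F : List A → B} (hF : IsMultilin (R := R) F) (u v : List A) (x : A) :
    F (u ++ (-x) :: v) = -F (u ++ x :: v) := by
  simpa using hF.smul u (-1 : R) x v

theorem IsMultilin.tail {F : List A → B} (hF : IsMultilin (R := R) F) (a : A) :
    IsMultilin (R := R) fun v => F (a :: v) :=
  ⟨fun u x y v => hF.add (a :: u) x y v, fun u r x v => hF.smul (a :: u) r x v⟩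

theorem IsMultilin.comp {F : List A → B} (hF : IsMultilin (R := R) F) (L : B →ₗ[R] C) :
    IsMultilin (R := R) fun w => L (F w) :=
  ⟨fun u x y v => by rw [hF.add, map_add], fun u r x v => by rw [hF.smul, map_smul]⟩

theorem IsMultilin.map {F : List A → B} (hF : IsMultilin (R := R) F) (θ : A →ₗ[R] A) :
    IsMultilin (R := R) fun w => F (w.map θ) :=
  ⟨fun u x y v => by simp [hF.add], fun u r x v => by simp [hF.smul]⟩

theorem IsMultilin.addFun {F G : List A → B} (hF : IsMultilin (R := R) F)
    (hG : IsMultilin (R := R) G) : IsMultilin (R := R) (fun w => F w + G w) where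
  add u x y v := by rw [hF.add, hG.add]; abel
  smul u r x v := by rw [hF.smul, hG.smul, smul_add]

theorem IsMultilin.zeroFun : IsMultilin (R := R) (fun _ : List A => (0 : B)) where
  add u x y v := by simp
  smul u r x v := by simp

/-- A multilinear function of words, restricted to the words of length `n`. -/
def IsMultilin.toMultilinearMap {F : List A → B} (hF : IsMultilin (R := R) F) (n : ℕ) :
    MultilinearMap R (fun _ : Fin n => A) B := by
  have key : ∀ [DecidableEq (Fin n)] (a : Fin n → A) (i : Fin n) (x : A),
      List.ofFn (Function.update a i x) =
        (List.ofFn a).take i ++ x :: (List.ofFn a).drop (i + 1) := by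
    intro _ a i x
    have h := List.set_eq_take_append_cons_drop (l := List.ofFn a) (i := i) (a := x)
    rw [if_pos (by simp)] at h
    rw [← h]
    apply List.ext_getElem
    · simp
    · intro j h1 h2
      simp only [List.getElem_ofFn, List.getElem_set, Function.update_apply, Fin.ext_iff]
      split_ifs <;> first | rfl | omega
  exact
    { toFun := fun a => F (List.ofFn a)
      map_update_add' := fun a i x y => by simp only [key, hF.add]
      map_update_smul' := fun a i r x => by simp only [key, hF.smul] }

theorem IsMultilin.toMultilinearMap_apply {F : List A → B} (hF : IsMultilin (R := R) F) (n : ℕ)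
    (a : Fin n → A) : hF.toMultilinearMap n a = F (List.ofFn a) := rfl

/-- The family of operations given by a multilinear function of words. -/
def Ops.ofWord (F : List A → A) (hF : IsMultilin (R := R) F) : Ops R A :=
  fun n => hF.toMultilinearMap n

@[simp] theorem Ops.ofWord_ev (F : List A → A) (hF : IsMultilin (R := R) F) (w : List A) :
    (Ops.ofWord F hF).ev w = F w := by
  rw [Ops.ev, Ops.ofWord, IsMultilin.toMultilinearMap_apply, List.ofFn_get]

/-- The linear map on the tensor algebra given by a multilinear function of words. -/
noncomputable def IsMultilin.lift {F : List A → B} (hF : IsMultilin (R := R) F) :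
    TensorAlgebra R A →ₗ[R] B :=
  DirectSum.toModule R ℕ B (fun n => PiTensorProduct.lift (hF.toMultilinearMap n)) ∘ₗ
    TensorAlgebra.toDirectSum.toLinearMap

/-- The word `a₁ ⊗ … ⊗ aₚ` in the tensor algebra. -/
def tensorWord (R : Type*) {A : Type*} [CommRing R] [Ring A] [Algebra R A] (w : List A) :
    TensorAlgebra R A := (w.map (TensorAlgebra.ι R)).prod

/-- By this universal property an identity between composites of multilinear functions need only be
checked for `tensorWord`, that is, in the convolution ring with values in the tensor algebra. -/
theorem IsMultilin.lift_tensorWord {F : List A → B} (hF : IsMultilin (R := R) F) (w : List A) :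
    hF.lift (tensorWord R w) = F w := by
  have : tensorWord R w = TensorAlgebra.tprod R A w.length w.get := by
    rw [tensorWord, TensorAlgebra.tprod_apply]
    congr 1
    apply List.ext_getElem <;> simp
  rw [this, IsMultilin.lift, LinearMap.comp_apply, AlgHom.toLinearMap_apply,
    TensorAlgebra.toDirectSum_tensorPower_tprod]
  refine (DirectSum.toModule_lof R _ _).trans ?_
  rw [PiTensorProduct.lift.tprod, hF.toMultilinearMap_apply, List.ofFn_get]

theorem tensorWord_isMultilin : IsMultilin (R := R) (tensorWord R (A := A)) :=
  ⟨fun u x y v => by simp [tensorWord, mul_add, add_mul], fun u r x v => by simp [tensorWord]⟩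

theorem IsMultilin.mul {S : Type*} [Ring S] [Algebra R S] {X Y : Conv A S}
    (hX : IsMultilin (R := R) X.val) (hY : IsMultilin (R := R) Y.val) :
    IsMultilin (R := R) (X * Y).val where
  add u x y v := by
    induction u generalizing X with
    | nil =>
      simp only [List.nil_append, Conv.mul_cons]
      have h1 := hY.add [] x y v
      have h2 : ∀ v, X.val ((x + y) :: v) = X.val (x :: v) + X.val (y :: v) := hX.add [] x y
      simp only [List.nil_append] at h1
      simp only [h1, h2, mul_add, add_mul, splitSum_add]
      abel
    | cons a u ih =>
      have h1 := hY.add (a :: u) x y v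
      have h2 := ih (X := X.tail a) (hX.tail a)
      simp only [List.cons_append] at h1 ⊢
      simp only [Conv.mul_cons', h1, h2, mul_add]
      abel
  smul u r x v := by
    induction u generalizing X with
    | nil =>
      simp only [List.nil_append, Conv.mul_cons]
      have h1 := hY.smul [] r x v
      have h2 : ∀ v, X.val ((r • x) :: v) = r • X.val (x :: v) := hX.smul [] r x
      simp only [List.nil_append] at h1
      simp only [h1, h2, mul_smul_comm, smul_mul_assoc, smul_add]
      congr 1
      exact (map_splitSum (DistribSMul.toAddMonoidHom S r) v _).symm
    | cons a u ih =>
      have h1 := hY.smul (a :: u) r x v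
      have h2 := ih (X := X.tail a) (hX.tail a)
      simp only [List.cons_append] at h1 ⊢
      simp only [Conv.mul_cons', h1, h2, mul_smul_comm, smul_add]

theorem IsMultilin.one {S : Type*} [Ring S] [Algebra R S] :
    IsMultilin (R := R) (1 : Conv A S).val where
  add u x y v := by cases u <;> simp
  smul u r x v := by cases u <;> simp

end Multilinear

/-! ### Coalgebra maps as geometric series -/

section Identities

variable {R A B : Type*} [CommRing R] [Ring A] [Algebra R A] [AddCommGroup B] [Module R B]

local notation "𝕋" => TensorAlgebra R A

/-- The function `w ↦ f w`, with values in the degree one part of the tensor algebra. -/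
def hat (R : Type*) {A : Type*} [CommRing R] [Ring A] [Algebra R A] (f : List A → A) :
    Conv A (TensorAlgebra R A) := ⟨fun w => TensorAlgebra.ι R (f w)⟩

/-- The identity of the tensor algebra, as a function of words. -/
def tword (R A : Type*) [CommRing R] [Ring A] [Algebra R A] : Conv A (TensorAlgebra R A) :=
  ⟨tensorWord R⟩

/-- The ring endomorphism of the tensor algebra given by a linear map. -/
def thetaHom (θ : A →ₗ[R] A) : 𝕋 →+* 𝕋 := (TensorAlgebra.lift R (TensorAlgebra.ι R ∘ₗ θ)).toRingHom

theorem thetaHom_ι (θ : A →ₗ[R] A) (a : A) :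
    thetaHom θ (TensorAlgebra.ι R a) = TensorAlgebra.ι R (θ a) := by
  simp [thetaHom]

theorem hat_nil {f : List A → A} (hf : f [] = 0) : (hat R f).val [] = 0 := by
  simp [hat, hf]

theorem hat_isMultilin {f : List A → A} (hf : IsMultilin (R := R) f) :
    IsMultilin (R := R) (hat R f).val := hf.comp (TensorAlgebra.ι R)

theorem hat_add (f g : List A → A) : hat R (fun w => f w + g w) = hat R f + hat R g :=
  Conv.ext_val fun _ => map_add _ _ _

theorem hat_neg (f : List A → A) : hat R (fun w => -f w) = -hat R f :=
  Conv.ext_val fun _ => map_neg _ _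

theorem hat_sub (f g : List A → A) : hat R (fun w => f w - g w) = hat R f - hat R g :=
  Conv.ext_val fun w => by rw [Conv.sub_apply]; exact map_sub _ _ _

theorem tword_isMultilin : IsMultilin (R := R) (tword R A).val := tensorWord_isMultilin

theorem idOp_isMultilin : IsMultilin (R := R) (idOp (A := A)) where
  add u x y v := by
    match u, v with
    | [], [] => simp [idOp]
    | [], _ :: _ => simp [idOp]
    | [_], _ => simp [idOp]
    | _ :: _ :: _, _ => simp [idOp]
  smul u r x v := by
    match u, v with
    | [], [] => simp [idOp]
    | [], _ :: _ => simp [idOp]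
    | [_], _ => simp [idOp]
    | _ :: _ :: _, _ => simp [idOp]

/-- Split off the first block. By `Conv.eq_of_recursion` this determines the left side as the
geometric series `1/(1 - hat R f)`. -/
theorem pullHom_tword {f : List A → A} (hf : f [] = 0) :
    Conv.pullHom f (tword R A) = 1 + hat R f * Conv.pullHom f (tword R A) := by
  refine Conv.ext_val fun w => ?_
  rw [Conv.add_apply]
  cases w with
  | nil =>
    rw [Conv.mul_nil, hat_nil hf, zero_mul, add_zero, Conv.pullHom_apply, pull_nil]
    simp [tword, tensorWord]
  | cons a w =>
    rw [Conv.one_cons, zero_add, Conv.mul_cons, hat_nil hf, zero_mul, zero_add, Conv.pullHom_apply,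
      pull_cons]
    refine splitSum_congr fun v x _ => ?_
    exact (map_pull (AddMonoidHom.mulLeft (TensorAlgebra.ι R (f (a :: v)))) _ f x).symm

theorem insertHom_tword_rec (θ : A →ₗ[R] A) {c u : List A → A} (hc : c [] = 0) :
    Conv.insertHom θ c u (tword R A) = hat R c * Conv.pullHom u (tword R A) +
      Conv.twist θ (hat R idOp) * Conv.insertHom θ c u (tword R A) := by
  refine Conv.ext_val fun w => ?_
  rw [Conv.add_apply]
  cases w with
  | nil => rw [Conv.mul_nil, Conv.mul_nil, hat_nil hc, Conv.insertHom_nil, zero_mul, mul_zero,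
      add_zero]
  | cons a w =>
    rw [Conv.insertHom_apply, sandwich_cons, Conv.mul_cons, hat_nil hc, zero_mul, zero_add]
    congr 1
    · refine splitSum_congr fun v x _ => ?_
      exact (map_pull (AddMonoidHom.mulLeft (TensorAlgebra.ι R (c (a :: v)))) _ u x).symm
    · have h1 : (Conv.twist θ (hat R idOp)).val [] = 0 := by
        simp [Conv.twist_apply, hat, idOp]
      rw [Conv.mul_cons, h1, zero_mul, zero_add]
      have h2 : sandwich θ c u w (fun t => (tword R A).val (θ a :: t)) =
          TensorAlgebra.ι R (θ a) * (Conv.insertHom θ c u (tword R A)).val w :=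
        (map_sandwich (AddMonoidHom.mulLeft (TensorAlgebra.ι R (θ a))) _ _).symm
      rw [h2]
      cases w with
      | nil => rfl
      | cons b w =>
        rw [splitSum_cons]
        simp only [Conv.twist_apply, hat, List.map_cons, List.map_nil, idOp]
        simp [splitSum_zero]

/-- On a block with several letters `idOp` produces the letter zero, which kills `X`. Only the
cutting into single letters remains. -/
theorem pull_idOp {X : List A → B} (hX : IsMultilin (R := R) X) (w : List A) :
    pull X idOp w = X w := by
  induction w using length_induction generalizing X with
  | h w ih =>
    match w with
    | [] => simp
    | a :: w =>
      rw [pull_cons]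
      cases w with
      | nil => simp [splitSum_nil, idOp]
      | cons b w =>
        rw [splitSum_cons, splitSum_eq_zero, add_zero, ih _ (by simp) (hX.tail _)]
        · rfl
        · intro v x h
          have : (fun t => X (idOp (a :: b :: v) :: t)) = fun _ => 0 := by
            funext t
            exact hX.zero_letter [] t
          rw [this, pull_zero]

theorem pullHom_idOp {X : Conv A 𝕋} (hX : IsMultilin (R := R) X.val) : Conv.pullHom idOp X = X :=
  Conv.ext_val fun w => pull_idOp hX w

theorem tword_rec : tword R A = 1 + hat R idOp * tword R A := by
  have := pullHom_tword (R := R) (f := idOp (A := A)) rfl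
  rwa [pullHom_idOp tword_isMultilin] at this

theorem twist_nil {θ : A → A} {X : Conv A 𝕋} (h : X.val [] = 0) : (Conv.twist θ X).val [] = 0 := h

theorem twist_tword (θ : A →ₗ[R] A) :
    Conv.twist θ (tword R A) = Conv.mapRingHom (thetaHom θ) (tword R A) := by
  refine Conv.ext_val fun w => ?_
  rw [Conv.twist_apply, Conv.mapRingHom_apply]
  simp only [tword, tensorWord, map_list_prod, List.map_map]
  congr 1
  refine List.map_congr_left fun a _ => ?_
  exact (thetaHom_ι θ a).symm

/-- Both sides solve the recursion of `insertHom_tword_rec`. The three factors are the twisted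
letters on the left, the inserted operation and the blocks on the right. -/
theorem insertHom_tword (θ : A →ₗ[R] A) {c u : List A → A} (hc : c [] = 0) :
    Conv.insertHom θ c u (tword R A) =
      Conv.twist θ (tword R A) * hat R c * Conv.pullHom u (tword R A) := by
  refine Conv.eq_of_recursion (K := Conv.twist θ (hat R idOp)) ?_ (insertHom_tword_rec θ hc) ?_
  · exact twist_nil (hat_nil rfl)
  · nth_rewrite 1 [tword_rec]
    rw [map_add, map_one, map_mul]
    noncomm_ring

theorem pullHom_hat (f g : List A → A) :
    Conv.pullHom g (hat R f) = hat R (pull f g) :=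
  Conv.ext_val fun w => (map_pull (TensorAlgebra.ι R) f g w).symm

theorem insertHom_hat (θ : A → A) (c u f : List A → A) :
    Conv.insertHom θ c u (hat R f) = hat R fun w => sandwich θ c u w f :=
  Conv.ext_val fun w => (map_sandwich (TensorAlgebra.ι R) w f).symm

theorem pullHom_map {φ : 𝕋 →+* 𝕋} (f : List A → A) (X : Conv A 𝕋) :
    Conv.pullHom f (Conv.mapRingHom φ X) = Conv.mapRingHom φ (Conv.pullHom f X) :=
  Conv.ext_val fun w => (map_pull φ X.val f w).symm

theorem insertHom_map {φ : 𝕋 →+* 𝕋} (θ : A → A) (c u : List A → A) (X : Conv A 𝕋) :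
    Conv.insertHom θ c u (Conv.mapRingHom φ X) = Conv.mapRingHom φ (Conv.insertHom θ c u X) :=
  Conv.ext_val fun w => (map_sandwich φ w X.val).symm

theorem map_hat (θ : A →ₗ[R] A) (f : List A → A) :
    Conv.mapRingHom (thetaHom θ) (hat R f) = hat R fun w => θ (f w) :=
  Conv.ext_val fun w => thetaHom_ι θ (f w)

theorem twist_hat (θ : A → A) (f : List A → A) :
    Conv.twist θ (hat R f) = hat R fun w => f (w.map θ) := rfl

theorem pull_eq_lift {X : List A → B} (hX : IsMultilin (R := R) X) (f : List A → A) (w : List A) :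
    pull X f w = hX.lift ((Conv.pullHom f (tword R A)).val w) := by
  rw [Conv.pullHom_apply, map_pull]
  congr 1; funext t; exact (hX.lift_tensorWord t).symm

theorem sandwich_eq_lift {X : List A → B} (hX : IsMultilin (R := R) X) (θ : A → A)
    (c u : List A → A) (w : List A) :
    sandwich θ c u w X = hX.lift ((Conv.insertHom θ c u (tword R A)).val w) := by
  rw [Conv.insertHom_apply, map_sandwich]
  congr 1; funext t; exact (hX.lift_tensorWord t).symm

theorem pow_isMultilin {X : Conv A 𝕋} (hX : IsMultilin (R := R) X.val) (k : ℕ) :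
    IsMultilin (R := R) (X ^ k).val := by
  induction k with
  | zero => rw [pow_zero]; exact .one
  | succ k ih => rw [pow_succ]; exact ih.mul hX

theorem geom_isMultilin {X : Conv A 𝕋} (hX : IsMultilin (R := R) X.val) (n : ℕ) :
    IsMultilin (R := R) (∑ k ∈ Finset.range n, X ^ k).val := by
  induction n with
  | zero => rw [Finset.sum_range_zero]; exact .zeroFun
  | succ n ih => rw [Finset.sum_range_succ]; exact ih.addFun (pow_isMultilin hX n)

/-- On words of length less than `n` the geometric series equals the sum of its first `n` terms, and
powers of a multilinear function are multilinear. -/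
theorem pullHom_tword_isMultilin {f : List A → A} (hf : IsMultilin (R := R) f) (h0 : f [] = 0) :
    IsMultilin (R := R) (Conv.pullHom f (tword R A)).val := by
  have key : ∀ (n : ℕ) (w : List A), w.length < n → (Conv.pullHom f (tword R A)).val w =
      (∑ k ∈ Finset.range n, hat R f ^ k).val w := by
    intro n
    induction n with
    | zero => intro w h; omega
    | succ n ih =>
      intro w h
      rw [Finset.sum_range_succ', pow_zero, add_comm]
      simp only [pow_succ' _ (_ : ℕ), ← Finset.mul_sum]
      rw [pullHom_tword h0, Conv.add_apply, Conv.add_apply,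
        Conv.mul_eq_of_vanish (hat_nil h0) ih w (by omega)]
  have h := fun n => geom_isMultilin (hat_isMultilin hf) n
  constructor
  · intro u x y v
    rw [key (u.length + v.length + 2) _ (by simp; omega),
      key (u.length + v.length + 2) _ (by simp; omega),
      key (u.length + v.length + 2) _ (by simp; omega), (h _).add]
  · intro u r x v
    rw [key (u.length + v.length + 2) _ (by simp; omega),
      key (u.length + v.length + 2) _ (by simp; omega), (h _).smul]

theorem pull_isMultilin {X : List A → B} {f : List A → A} (hX : IsMultilin (R := R) X)
    (hf : IsMultilin (R := R) f) (h0 : f [] = 0) : IsMultilin (R := R) (pull X f) := by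
  have : pull X f = fun w => hX.lift ((Conv.pullHom f (tword R A)).val w) :=
    funext fun w => pull_eq_lift hX f w
  rw [this]
  exact (pullHom_tword_isMultilin hf h0).comp hX.lift

theorem insertHom_tword_isMultilin (θ : A →ₗ[R] A) {c u : List A → A}
    (hc : IsMultilin (R := R) c) (hc0 : c [] = 0) (hu : IsMultilin (R := R) u) (hu0 : u [] = 0) :
    IsMultilin (R := R) (Conv.insertHom θ c u (tword R A)).val := by
  rw [insertHom_tword θ hc0]
  exact ((tword_isMultilin.map θ).mul (hat_isMultilin hc)).mul (pullHom_tword_isMultilin hu hu0)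

theorem sandwich_isMultilin (θ : A →ₗ[R] A) {X : List A → B} {c u : List A → A}
    (hX : IsMultilin (R := R) X) (hc : IsMultilin (R := R) c) (hc0 : c [] = 0)
    (hu : IsMultilin (R := R) u) (hu0 : u [] = 0) :
    IsMultilin (R := R) (fun w => sandwich θ c u w X) := by
  have : (fun w => sandwich θ c u w X) =
      fun w => hX.lift ((Conv.insertHom θ c u (tword R A)).val w) :=
    funext fun w => sandwich_eq_lift hX θ c u w
  rw [this]
  exact (insertHom_tword_isMultilin θ hc hc0 hu hu0).comp hX.lift

/-- Composition of coalgebra maps. -/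
theorem pull_pull {X : List A → B} (hX : IsMultilin (R := R) X) {f g : List A → A}
    (hf : f [] = 0) (w : List A) :
    pull (pull X f) g w = pull X (pull f g) w := by
  -- Both sides are the geometric series of `pull f g`, because `Conv.pullHom g` is a ring
  -- homomorphism.
  have h1 : Conv.pullHom g (Conv.pullHom f (tword R A)) = Conv.pullHom (pull f g) (tword R A) := by
    refine Conv.eq_of_recursion (K := hat R (pull f g)) (Y := 1) (hat_nil (by simpa)) ?_
      (pullHom_tword (by simpa))
    nth_rewrite 1 [pullHom_tword hf]
    rw [map_add, map_one, map_mul, pullHom_hat]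
  have h2 : pull X f = fun w => hX.lift ((Conv.pullHom f (tword R A)).val w) :=
    funext fun w => pull_eq_lift hX f w
  rw [h2, ← map_pull, pull_eq_lift hX, ← h1]
  rfl

/-- The resolvent identity for the inverses of `1 - hat R idOp` and `1 - hat R u`. -/
theorem pullHom_sub {u : List A → A} (hu : u [] = 0) :
    Conv.pullHom u (tword R A) = tword R A + tword R A * hat R (fun w => u w - idOp w) *
      Conv.pullHom u (tword R A) := by
  set α := Conv.pullHom u (tword R A)
  have h1 : α = 1 + hat R u * α := pullHom_tword hu
  have h2 : tword R A = 1 + hat R idOp * tword R A := tword_rec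
  refine Conv.eq_of_recursion (K := hat R idOp)
    (Y := 1 + hat R (fun w => u w - idOp w) * α) (hat_nil rfl) ?_ ?_
  · rw [hat_sub]
    nth_rewrite 1 [h1]
    noncomm_ring
  · nth_rewrite 1 2 [h2]
    noncomm_ring

/-- A telescoping expansion that isolates `X w`. If `u` is the identity on letters, the inserted
block `u - id` needs at least two letters, so the second term only sees `X` on shorter words. -/
theorem pull_eq_add_sandwich {X : List A → B} (hX : IsMultilin (R := R) X) {u : List A → A}
    (hu : u [] = 0) (w : List A) :
    pull X u w = X w + sandwich id (fun w => u w - idOp w) u w X := by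
  have hid : (id : A → A) = (LinearMap.id : A →ₗ[R] A) := rfl
  have h1 : Conv.twist (id : A → A) (tword R A) = tword R A :=
    Conv.ext_val fun w => by rw [Conv.twist_apply, List.map_id]
  have h2 : (Conv.pullHom u (tword R A)).val w = tensorWord R w + (tword R A *
      hat R (fun w => u w - idOp w) * Conv.pullHom u (tword R A)).val w :=
    congrArg (fun X : Conv A 𝕋 => X.val w) (pullHom_sub hu)
  rw [sandwich_eq_lift hX, hid, insertHom_tword _ (by simp [hu, idOp]), ← hid, h1,
    pull_eq_lift hX, h2, map_add, hX.lift_tensorWord]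

/-! ### Coderivations with signs: squares, intertwining, homotopies -/

section Koszul

variable (θ : A →ₗ[R] A)

/-- If `D_{m'} α_f` and `α_f D_m` have the same components on words of length at most `n`, then
they agree on these words. -/
theorem sandwich_pull {f m m' : List A → A} (hf : IsMultilin (R := R) f) (hf0 : f [] = 0)
    (hfθ : ∀ w, f (w.map θ) = θ (f w)) (hm0' : m' [] = 0) {n : ℕ}
    (h : ∀ w : List A, w.length ≤ n → sandwich θ m idOp w f = pull m' f w)
    {X : List A → B} (hX : IsMultilin (R := R) X) (w : List A) (hw : w.length ≤ n) :
    sandwich θ m idOp w (pull X f) = pull (fun t => sandwich θ m' idOp t X) f w := by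
  set I := tword R A
  set α := Conv.pullHom f I
  have hα : α = 1 + hat R f * α := pullHom_tword hf0
  -- As `f` is even, `α_f` commutes with the sign operator: both sides satisfy the same recursion.
  have h1 : Conv.twist θ α = Conv.mapRingHom (thetaHom θ) α := by
    refine Conv.eq_of_recursion (K := Conv.twist θ (hat R f)) (Y := 1) (twist_nil (hat_nil hf0))
      ?_ ?_
    · nth_rewrite 1 [hα]
      rw [map_add, map_one, map_mul]
    · nth_rewrite 1 [hα]
      rw [map_add, map_one, map_mul, map_hat, twist_hat]
      simp only [hfθ]
  have h2 : Conv.insertHom θ m idOp α =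
      Conv.twist θ α * hat R (fun w => sandwich θ m idOp w f) * α := by
    refine Conv.eq_of_recursion (K := Conv.twist θ (hat R f)) (twist_nil (hat_nil hf0))
      (Y := hat R (fun w => sandwich θ m idOp w f) * α) ?_ ?_
    · nth_rewrite 1 [hα]
      rw [map_add, Conv.insertHom_one, zero_add, Conv.insertHom_mul, insertHom_hat,
        pullHom_idOp (pullHom_tword_isMultilin hf hf0)]
    · nth_rewrite 1 [hα]
      rw [map_add, map_one, map_mul]
      noncomm_ring
  have h3 : Conv.pullHom f (Conv.insertHom θ m' idOp I) =
      Conv.twist θ α * hat R (pull m' f) * α := by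
    rw [insertHom_tword θ hm0', pullHom_idOp tword_isMultilin, map_mul, map_mul, twist_tword,
      pullHom_map, pullHom_hat, h1]
  have h4 : (Conv.insertHom θ m idOp α).val w = (Conv.pullHom f (Conv.insertHom θ m' idOp I)).val w := by
    -- The two composites differ by the difference of their components, multiplied from both sides,
    -- and multiplication preserves vanishing on words of length at most `n`.
    rw [← sub_eq_zero, ← Conv.sub_apply, h2, h3, ← sub_mul, ← mul_sub, ← hat_sub]
    refine Conv.mul_vanish_left (n := n) (fun w hw => Conv.mul_vanish_right (n := n)
      (fun w hw => ?_) w hw) w hw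
    simp [hat, h w hw]
  have h5 : pull X f = fun w => hX.lift (α.val w) := funext fun w => pull_eq_lift hX f w
  have h6 : (fun t => sandwich θ m' idOp t X) =
      fun w => hX.lift ((Conv.insertHom θ m' idOp I).val w) :=
    funext fun w => sandwich_eq_lift hX θ m' idOp w
  rw [h5, h6, ← map_sandwich, ← map_pull]
  exact congrArg hX.lift h4

variable {θ} (hθ : ∀ a, θ (θ a) = a)
include hθ

theorem thetaHom_thetaHom (x : 𝕋) : thetaHom θ (thetaHom θ x) = x := by
  have : (TensorAlgebra.lift R (TensorAlgebra.ι R ∘ₗ θ)).comp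
      (TensorAlgebra.lift R (TensorAlgebra.ι R ∘ₗ θ)) = AlgHom.id R 𝕋 := by
    ext a; simp [hθ]
  exact DFunLike.congr_fun this x

theorem map_map_thetaHom (X : Conv A 𝕋) :
    Conv.mapRingHom (thetaHom θ) (Conv.mapRingHom (thetaHom θ) X) = X :=
  Conv.ext_val fun w => thetaHom_thetaHom hθ _

theorem twist_twist (X : Conv A 𝕋) : Conv.twist θ (Conv.twist θ X) = X :=
  Conv.ext_val fun w => by simp [Conv.twist_apply, Function.comp_def, hθ]

/-- In `D_m D_m` the terms in which the two operations act on disjoint subwords cancel in pairs,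
since `m` is odd. What remains is one insertion of the component; its prefix is untwisted because
`θ` is an involution. -/
theorem insertHom_insertHom {m : List A → A} (hm : IsMultilin (R := R) m) (hm0 : m [] = 0)
    (hmθ : ∀ w, m (w.map θ) = -θ (m w)) :
    Conv.insertHom θ m idOp (Conv.insertHom θ m idOp (tword R A)) =
      tword R A * (hat R (fun w => sandwich θ m idOp w m) * tword R A) := by
  have hI : Conv.pullHom idOp (tword R A) = tword R A := pullHom_idOp tword_isMultilin
  have h1 : Conv.insertHom θ m idOp (tword R A) = Conv.twist θ (tword R A) * (hat R m * tword R A) := by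
    rw [insertHom_tword θ hm0, hI, mul_assoc]
  have h2 : Conv.insertHom θ m idOp (Conv.twist θ (tword R A)) =
      tword R A * (hat R (fun w => θ (m w)) * Conv.twist θ (tword R A)) := by
    rw [twist_tword, insertHom_map, h1, map_mul, map_mul, map_hat, twist_tword,
      map_map_thetaHom hθ]
  have h3 : Conv.twist θ (hat R m) = -hat R fun w => θ (m w) := by
    rw [twist_hat, ← hat_neg]; simp only [hmθ]
  nth_rewrite 1 [h1]
  rw [Conv.insertHom_mul, Conv.insertHom_mul, insertHom_hat, h2, map_mul, hI,
    pullHom_idOp (hat_isMultilin hm), twist_twist hθ, h3, h1]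
  noncomm_ring

/-- If `D_m D_m` has vanishing component on words of length at most `n`, then it vanishes there. -/
theorem sandwich_sandwich {m : List A → A} (hm : IsMultilin (R := R) m) (hm0 : m [] = 0)
    (hmθ : ∀ w, m (w.map θ) = -θ (m w)) {n : ℕ}
    (h : ∀ w : List A, w.length ≤ n → sandwich θ m idOp w m = 0)
    {X : List A → B} (hX : IsMultilin (R := R) X) (w : List A) (hw : w.length ≤ n) :
    sandwich θ m idOp w (fun t => sandwich θ m idOp t X) = 0 := by
  have h6 : (fun t => sandwich θ m idOp t X) =
      fun w => hX.lift ((Conv.insertHom θ m idOp (tword R A)).val w) :=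
    funext fun w => sandwich_eq_lift hX θ m idOp w
  have h7 : (tword R A * (hat R (fun w => sandwich θ m idOp w m) * tword R A)).val w = 0 :=
    Conv.mul_vanish_right (n := n) (Conv.mul_vanish_left fun w hw => by simp [hat, h w hw]) w hw
  rw [h6, ← map_sandwich]
  refine (congrArg hX.lift ?_).trans (map_zero _)
  rw [← h7, ← insertHom_insertHom hθ hm hm0 hmθ]
  rfl

/-- The endomorphism `u = id + [D_m, H]` given by a homotopy with component `h` commutes with
`D_m`, on words of length at most `n`. -/
theorem sandwich_of_homotopy {m h u : List A → A} (hm : IsMultilin (R := R) m) (hm0 : m [] = 0)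
    (hmθ : ∀ w, m (w.map θ) = -θ (m w)) (hh : IsMultilin (R := R) h) (hh0 : h [] = 0)
    (hhθ : ∀ w, h (w.map θ) = -θ (h w)) (hu : IsMultilin (R := R) u) (hu0 : u [] = 0)
    (hu1 : ∀ w, u w = idOp w + (sandwich θ h u w m + sandwich θ m idOp w h)) {n : ℕ}
    (hmm : ∀ w : List A, w.length ≤ n → sandwich θ m idOp w m = 0)
    (w : List A) (hw : w.length ≤ n) : sandwich θ m idOp w u = pull m u w := by
  set I := tword R A with hIdef
  set J := Conv.twist θ I with hJdef
  set α := Conv.pullHom u I with hα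
  let Δ := Conv.insertHom (S := 𝕋) θ m idOp
  let H := Conv.insertHom (S := 𝕋) θ h u
  have hI : Conv.pullHom idOp I = I := pullHom_idOp tword_isMultilin
  have hJ : J = Conv.mapRingHom (thetaHom θ) I := twist_tword θ
  have hαm : IsMultilin (R := R) α.val := pullHom_tword_isMultilin hu hu0
  have h1 : Δ I = J * (hat R m * I) := by
    rw [← mul_assoc]; exact (insertHom_tword θ hm0).trans (by rw [hI])
  have h2 : H I = J * (hat R h * α) := by
    rw [← mul_assoc]; exact insertHom_tword θ hh0
  have h3 : Δ J = I * (hat R (fun w => θ (m w)) * J) := by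
    rw [hJ]
    refine (insertHom_map θ m idOp I).trans ?_
    refine (congrArg _ h1).trans ?_
    rw [map_mul, map_mul, map_hat, hJ, map_map_thetaHom hθ]
  have h4 : H J = I * (hat R (fun w => θ (h w)) * Conv.mapRingHom (thetaHom θ) α) := by
    rw [hJ]
    refine (insertHom_map θ h u I).trans ?_
    refine (congrArg _ h2).trans ?_
    rw [map_mul, map_mul, map_hat, hJ, map_map_thetaHom hθ]
  have h5 : Conv.twist θ (hat R m) = -hat R fun w => θ (m w) := by
    rw [twist_hat, ← hat_neg]; simp only [hmθ]
  have h6 : Conv.twist θ (hat R h) = -hat R fun w => θ (h w) := by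
    rw [twist_hat, ← hat_neg]; simp only [hhθ]
  have h7 : Δ (H I) = I * (hat R (fun w => θ (m w)) * J) * (hat R h * α) +
      I * (hat R (fun w => sandwich θ m idOp w h) * α - hat R (fun w => θ (h w)) * Δ α) := by
    rw [h2]
    refine (Conv.insertHom_mul _ _ _ _ _).trans ?_
    rw [Conv.insertHom_mul, insertHom_hat, map_mul, pullHom_idOp (hat_isMultilin hh),
      pullHom_idOp hαm, twist_twist hθ, h6, neg_mul, ← sub_eq_add_neg]
    exact congrArg (· * _ + _) h3
  have h8 : Conv.pullHom u (Δ I) = Conv.mapRingHom (thetaHom θ) α * (hat R (pull m u) * α) := by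
    rw [h1, map_mul, map_mul, pullHom_hat, hJ, pullHom_map]
  have h9 : H (Δ I) = I * (hat R (fun w => θ (h w)) * Conv.pullHom u (Δ I)) +
      I * (hat R (fun w => sandwich θ h u w m) * α - hat R (fun w => θ (m w)) * (J * (hat R h * α))) := by
    rw [h8, h1]
    refine (Conv.insertHom_mul _ _ _ _ _).trans ?_
    rw [Conv.insertHom_mul, insertHom_hat, map_mul, pullHom_hat, twist_twist hθ, h5, neg_mul,
      ← sub_eq_add_neg]
    rw [show Conv.insertHom θ h u J = _ from h4, show Conv.insertHom θ h u I = _ from h2]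
    noncomm_ring
  -- `Z` is the failure of `α` to commute with `Δ`, and `W` is the resulting error in the formula `α
  -- = I + Δ H I + H Δ I`.
  set Z := Conv.pullHom u (Δ I) - Δ α with hZ
  set W := I * (hat R (fun w => θ (h w)) * Z) with hW
  have h10 : α = I + (Δ (H I) + H (Δ I)) - W := by
    have hc : (fun w => u w - idOp w) = fun w => sandwich θ h u w m + sandwich θ m idOp w h :=
      funext fun w => by rw [hu1 w]; abel
    have := pullHom_sub (R := R) hu0
    rw [hc, hat_add] at this
    rw [hα, this, ← hIdef, ← hα, hW, hZ, h7, h9]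
    noncomm_ring
  have hΔI : IsMultilin (R := R) (Δ I).val :=
    insertHom_tword_isMultilin θ hm hm0 idOp_isMultilin rfl
  have hHI : IsMultilin (R := R) (H I).val := insertHom_tword_isMultilin θ hh hh0 hu hu0
  -- Compose the formula for `α` with the linear extension of `Δ I` to the tensor algebra.
  have h11 : ∀ v, (Conv.pullHom u (Δ I)).val v = (Δ I + (Δ (H (Δ I)) + H (Δ (Δ I)))).val v -
      hΔI.lift (W.val v) := by
    intro v
    rw [Conv.pullHom_apply, pull_eq_lift hΔI, ← hIdef, ← hα, h10, Conv.sub_apply, map_sub]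
    congr 1
    rw [Conv.add_apply, Conv.add_apply, map_add, map_add, Conv.add_apply, Conv.add_apply]
    congr 1
    · exact hΔI.lift_tensorWord v
    · congr 1
      · have := sandwich_eq_lift hΔI θ h u
        have e : H (Δ I) = ⟨fun w => hΔI.lift ((H I).val w)⟩ := Conv.ext_val this
        rw [e]
        exact map_sandwich hΔI.lift v (H I).val
      · have := sandwich_eq_lift hΔI θ m idOp
        have e : Δ (Δ I) = ⟨fun w => hΔI.lift ((Δ I).val w)⟩ := Conv.ext_val this
        rw [e]
        exact map_sandwich hΔI.lift v (Δ I).val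
  have h12 : Δ α = Δ I + (Δ (Δ (H I)) + Δ (H (Δ I))) - Δ W := by
    rw [h10, map_sub, map_add, map_add]
  have hΔΔ : ∀ {X : Conv A 𝕋}, IsMultilin (R := R) X.val → ∀ w : List A, w.length ≤ n →
      (Δ (Δ X)).val w = 0 := fun hX w hw => sandwich_sandwich hθ hm hm0 hmθ hmm hX w hw
  -- Induction on the length. As `h` vanishes on the empty word, `W` on words of length `p` involves
  -- `Z` on shorter words only, so it vanishes. Without `W` the two expressions differ by terms that
  -- contain `Δ Δ`.
  have hZ0 : ∀ p ≤ n, ∀ v : List A, v.length ≤ p → Z.val v = 0 := by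
    intro p
    induction p using Nat.strong_induction_on with
    | _ p ih =>
      intro hp v hv
      have hW0 : ∀ v : List A, v.length ≤ p → W.val v = 0 := by
        refine Conv.mul_vanish_right fun v hv => ?_
        rw [Conv.mul_eq_of_vanish (Y := 0) (hat_nil (by rw [hh0, map_zero])) (n := p)
          (fun t ht => ih (p - 1) (by omega) (by omega) t (by omega)) v hv, mul_zero]
        rfl
      have hΔW : (Δ W).val v = 0 := by
        refine (sandwich_congr (X' := fun _ => 0) (fun t ht => hW0 t (ht.trans hv))
          (fun _ _ _ => rfl) (fun _ _ _ => rfl)).trans (sandwich_zero v)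
      have hHΔΔ : (H (Δ (Δ I))).val v = 0 :=
        (sandwich_congr (X' := fun _ => 0) (fun t ht => hΔΔ tword_isMultilin t (ht.trans (hv.trans hp)))
          (fun _ _ _ => rfl) (fun _ _ _ => rfl)).trans (sandwich_zero v)
      rw [hZ, Conv.sub_apply, h11, h12, hW0 v hv, map_zero, Conv.sub_apply, hΔW,
        Conv.add_apply, Conv.add_apply, Conv.add_apply, Conv.add_apply, hHΔΔ,
        hΔΔ hHI v (hv.trans hp)]
      abel
  have h13 := hZ0 n le_rfl w hw
  have h14 : (Conv.pullHom u (Δ I)).val w = (Δ α).val w := by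
    rwa [hZ, Conv.sub_apply, sub_eq_zero] at h13
  -- The linear extension of `idOp` is the projection of the tensor algebra onto its degree one
  -- part; it recovers `u` and `m` from `α` and `Δ I`.
  have hid : ∀ v, idOp (A := A) v = (idOp_isMultilin (R := R)).lift (tensorWord R v) := fun v =>
    ((idOp_isMultilin (R := R)).lift_tensorWord v).symm
  have h15 : ∀ v, u v = (idOp_isMultilin (R := R)).lift (α.val v) := by
    intro v
    rw [← pull_eq_lift idOp_isMultilin u v]
    cases v with
    | nil => simpa [idOp] using hu0
    | cons a v =>
      rw [pull_cons, splitSum_eq_sum_range, Finset.sum_range_succ, Finset.sum_eq_zero, zero_add]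
      · simp [idOp]
      · intro s hs
        simp only [Finset.mem_range] at hs
        cases hd : v.drop s with
        | nil => simp at hd; omega
        | cons b t =>
          rw [pull_cons]
          exact splitSum_eq_zero fun v x _ => by simp only [idOp]; exact pull_zero _ _
  have h16 : ∀ v, m v = (idOp_isMultilin (R := R)).lift ((Δ I).val v) := by
    intro v
    rw [← sandwich_eq_lift idOp_isMultilin θ m idOp v]
    cases v with
    | nil => simpa using hm0
    | cons a v =>
      rw [sandwich_cons, splitSum_eq_sum_range, Finset.sum_range_succ, Finset.sum_eq_zero, zero_add]
      · have : sandwich θ m idOp v (fun t => idOp (θ a :: t)) = 0 := by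
          cases v with
          | nil => rfl
          | cons b v =>
            rw [sandwich_cons, splitSum_eq_zero, zero_add]
            · exact sandwich_zero v
            · intro v x _; simp only [idOp]; exact pull_zero _ _
        rw [this]
        simp [idOp]
      · intro s hs
        simp only [Finset.mem_range] at hs
        cases hd : v.drop s with
        | nil => simp at hd; omega
        | cons b t =>
          rw [pull_cons]
          exact splitSum_eq_zero fun v x _ => by simp only [idOp]; exact pull_zero _ _
  have h17 := congrArg (idOp_isMultilin (R := R)).lift h14
  rw [Conv.pullHom_apply, map_pull] at h17
  simp only [← h16] at h17
  rw [h17]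
  symm
  refine (map_sandwich (idOp_isMultilin (R := R)).lift w α.val).trans ?_
  simp only [← h15]

end Koszul

end Identities

/-! ### Comparison with `insertSum` -/

section InsertSum

variable {R A : Type*} [CommRing R] [Ring A] [Algebra R A]

theorem insertSum_cons (θ : A → A) (b c : List A → A) (a : A) (w : List A) :
    insertSum θ b c (a :: w) = (splitSum w fun v x => b (c (a :: v) :: x)) +
      insertSum θ (fun t => b (θ a :: t)) c w := by
  have h0 : ∀ (n : ℕ) (G : ℕ → A), ∑ s ∈ Finset.Icc 1 (n + 1), G s =
      ∑ s ∈ Finset.range (n + 1), G (s + 1) := by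
    intro n G
    rw [Finset.range_eq_Ico, Finset.sum_Ico_add' G 0 (n + 1) 1]
    rfl
  rw [insertSum, List.length_cons, Finset.sum_range_succ', add_comm]
  congr 1
  · rw [splitSum_eq_sum_range, Nat.sub_zero, h0]
    refine Finset.sum_congr rfl fun s _ => ?_
    rw [Nat.zero_add]
    rfl
  · refine Finset.sum_congr rfl fun r _ => ?_
    rw [Nat.add_sub_add_right]
    refine Finset.sum_congr rfl fun s _ => ?_
    rw [show r + 1 + s = (r + s) + 1 by omega]
    rfl

theorem insertSum_eq_sandwich (θ : A → A) {b : List A → A} (hb : IsMultilin (R := R) b)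
    (c : List A → A) (w : List A) : insertSum θ b c w = sandwich θ c idOp w b := by
  induction w generalizing b with
  | nil => rfl
  | cons a w ih =>
    rw [insertSum_cons, sandwich_cons, ih (hb.tail _)]
    congr 1
    exact splitSum_congr fun v x _ => (pull_idOp (hb.tail _) x).symm

end InsertSum

end AInf

namespace AInf

/-! ### Vanishing criteria for sums over cuttings -/

section MoreSplits

variable {A B : Type*} [AddCommGroup B]

theorem splitSum_concat (u : List A) (x : A) (G : List A → List A → B) :
    splitSum (u ++ [x]) G = G (u ++ [x]) [] + splitSum u fun p q => G p (q ++ [x]) := by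
  have := splitSum_append u [x] G
  rw [splitSum_cons, splitSum_nil, List.append_nil] at this
  refine add_right_cancel (this.trans ?_)
  abel

/-- For balancedness: the three hypotheses correspond to cuts after both letters, between them, and
before them. -/
theorem splitSum_congr_junction {G : List A → List A → B} {u w : List A} {x y x' y' : A}
    (hv : ∀ v, G (u ++ x :: y :: v) = G (u ++ x' :: y' :: v))
    (hm : G (u ++ [x]) (y :: w) = G (u ++ [x']) (y' :: w))
    (hx : ∀ p q, p ++ q = u → G p (q ++ x :: y :: w) = G p (q ++ x' :: y' :: w)) :
    splitSum (u ++ x :: y :: w) G = splitSum (u ++ x' :: y' :: w) G := by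
  induction u generalizing G with
  | nil =>
    have h := hx [] [] rfl
    simp only [List.nil_append, splitSum_cons] at *
    rw [hm, h]
    simp only [hv]
  | cons a u ih =>
    simp only [List.cons_append, splitSum_cons]
    congr 1
    · exact hx [] (a :: u) rfl
    · exact ih (fun v => hv v) hm fun p q h => hx (a :: p) q (by simp [h])

theorem splitSum_of_vanish {G : List A → List A → B} {u x : List A} {y : A}
    (h : ∀ v z, v ++ z = x → G (u ++ y :: v) z = 0) :
    splitSum (u ++ y :: x) G = splitSum u fun p q => G p (q ++ y :: x) := by
  induction u generalizing G with
  | nil =>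
    have h' : ∀ v z, v ++ z = x → G (y :: v) z = 0 := h
    rw [List.nil_append, splitSum_cons, splitSum_nil, splitSum_eq_zero h', add_zero]
    rfl
  | cons a u ih =>
    rw [List.cons_append, splitSum_cons, splitSum_cons, ih h]
    rfl

theorem pull_of_vanish {F : List A → B} (h : ∀ t, t ≠ [] → F t = 0) (f : List A → A) {w : List A}
    (hw : w ≠ []) : pull F f w = 0 := by
  cases w with
  | nil => exact absurd rfl hw
  | cons a w =>
    rw [pull_cons]
    refine splitSum_eq_zero fun v x _ => ?_
    simp only [h _ (List.cons_ne_nil _ _)]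
    exact pull_zero f x

theorem sandwich_of_vanish {F : List A → B} (h : ∀ t, t ≠ [] → F t = 0) (θ : A → A)
    (c u : List A → A) (w : List A) : sandwich θ c u w F = 0 := by
  cases w with
  | nil => rfl
  | cons a w =>
    rw [sandwich_cons]
    simp only [h _ (List.cons_ne_nil _ _)]
    simp [pull_zero, splitSum_zero, sandwich_zero]

theorem splitSum_last (w : List A) (G : List A → List A → B) (h : ∀ v x, x ≠ [] → G v x = 0) :
    splitSum w G = G w [] := by
  induction w generalizing G with
  | nil => rfl
  | cons a w ih =>
    rw [splitSum_cons, h _ _ (List.cons_ne_nil _ _), zero_add, ih _ fun v x => h (a :: v) x]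

end MoreSplits

section Components

variable {A : Type*} [Ring A]

/-- As a function of words `idOp` is the projection of `Bar(A)` to words of length one, so it
extracts the component of a coalgebra map. -/
theorem pull_idOp_left {f : List A → A} (hf : f [] = 0) (w : List A) : pull idOp f w = f w := by
  cases w with
  | nil => simpa [idOp] using hf.symm
  | cons a w =>
    rw [pull_cons, splitSum_last]
    · simp [idOp]
    · intro v x hx
      exact pull_of_vanish (fun t ht => by cases t with
        | nil => exact absurd rfl ht
        | cons b t => rfl) f hx

theorem sandwich_idOp_left (θ : A → A) {c u : List A → A} (hc : c [] = 0) (w : List A) :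
    sandwich θ c u w idOp = c w := by
  cases w with
  | nil => exact hc.symm
  | cons a w =>
    rw [sandwich_cons, splitSum_last]
    · have : sandwich θ c u w (fun t => idOp (θ a :: t)) = 0 :=
        sandwich_of_vanish (fun t ht => by cases t with
          | nil => exact absurd rfl ht
          | cons b t => rfl) _ _ _ _
      rw [this, add_zero]
      simp [idOp]
    · intro v x hx
      exact pull_of_vanish (fun t ht => by cases t with
        | nil => exact absurd rfl ht
        | cons b t => rfl) u hx

end Components

/-! ### Degrees and Koszul signs -/

section Degrees

variable {R A : Type*} [CommRing R] [Ring A] [Algebra R A] (𝒜 : ℤ → Submodule R A)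

/-- The letters of `w` are homogeneous, and `w` has degree `n` as an element of `Bar(A)`. -/
def HomWord : List A → ℤ → Prop
  | [], n => n = 0
  | a :: w, n => ∃ i, a ∈ 𝒜 i ∧ HomWord w (n - i + 1)

theorem homWord_append {v x : List A} {n : ℤ} (h : HomWord 𝒜 (v ++ x) n) :
    ∃ p, HomWord 𝒜 v p ∧ HomWord 𝒜 x (n - p) := by
  induction v generalizing n with
  | nil => exact ⟨0, rfl, by simpa using h⟩
  | cons a v ih =>
    obtain ⟨i, ha, h⟩ := h
    obtain ⟨p, hp, hx⟩ := ih h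
    exact ⟨p + i - 1, ⟨i, ha, by convert hp using 1; ring⟩, by convert hx using 1; ring⟩

theorem homWord_of_forall₂ {w : List A} {ds : List ℤ}
    (h : List.Forall₂ (fun a i => a ∈ 𝒜 i) w ds) : HomWord 𝒜 w (ds.sum - w.length) := by
  induction h with
  | nil => simp [HomWord]
  | cons ha _ ih => exact ⟨_, ha, by convert ih using 1; simp; ring⟩

theorem HomWord.exists_forall₂ {w : List A} {n : ℤ} (h : HomWord 𝒜 w n) :
    ∃ ds : List ℤ, List.Forall₂ (fun a i => a ∈ 𝒜 i) w ds ∧ ds.sum - w.length = n := by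
  induction w generalizing n with
  | nil => exact ⟨[], .nil, by simp [HomWord] at h; simp [h]⟩
  | cons a w ih =>
    obtain ⟨i, ha, h⟩ := h
    obtain ⟨ds, h1, h2⟩ := ih h
    exact ⟨i :: ds, .cons ha h1, by simp; omega⟩

theorem exists_homWord {w : List A} (h : ∀ a ∈ w, ∃ i, a ∈ 𝒜 i) : ∃ n, HomWord 𝒜 w n := by
  induction w with
  | nil => exact ⟨0, rfl⟩
  | cons a w ih =>
    obtain ⟨i, hi⟩ := h a (by simp)
    obtain ⟨n, hn⟩ := ih fun b hb => h b (by simp [hb])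
    exact ⟨n + i - 1, i, hi, by convert hn using 1; ring⟩

/-- `X` maps words of degree `n` to elements of degree `n + d` of `A`, i.e. `X` has degree `d - 1`
as a map `Bar(A) → A[1]`. -/
def HasDegree (d : ℤ) (X : List A → A) : Prop :=
  ∀ w n, HomWord 𝒜 w n → X w ∈ 𝒜 (n + d)

variable {𝒜}

theorem splitSum_mem {B : Type*} [AddCommGroup B] [Module R B] (N : Submodule R B) {w : List A}
    {G : List A → List A → B} (h : ∀ v x, v ++ x = w → G v x ∈ N) : splitSum w G ∈ N := by
  rw [splitSum_eq_sum_range]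
  exact N.sum_mem fun s _ => h _ _ (List.take_append_drop s w)

theorem HasDegree.tail {d i : ℤ} {X : List A → A} (hX : HasDegree 𝒜 d X) {b : A} (hb : b ∈ 𝒜 i) :
    HasDegree 𝒜 (d + i - 1) fun t => X (b :: t) := by
  intro w n hw
  convert hX (b :: w) (n + i - 1) ⟨i, hb, by convert hw using 1; ring⟩ using 2
  ring

theorem HasDegree.pull {d : ℤ} {X f : List A → A} (hX : HasDegree 𝒜 d X) (hf : HasDegree 𝒜 1 f) :
    HasDegree 𝒜 d (pull X f) := by
  intro w n hw
  induction w using length_induction generalizing X d n with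
  | h w ih =>
    match w with
    | [] => simpa using hX [] n hw
    | a :: w =>
      rw [pull_cons]
      refine splitSum_mem _ fun v x h => ?_
      subst h
      obtain ⟨p, hv, hx⟩ := homWord_append 𝒜 (v := a :: v) hw
      have := ih x (by simp) (hX.tail (hf _ _ hv)) (n - p) hx
      convert this using 2
      ring_nf

/-- Degrees of maps to `A[1]` add, and the index `d` exceeds that degree by one; hence `d + d' - 1`.
-/
theorem HasDegree.sandwich [GradedAlgebra 𝒜] {d d' : ℤ} {X c u : List A → A} (hX : HasDegree 𝒜 d X)
    (hc : HasDegree 𝒜 d' c) (hu : HasDegree 𝒜 1 u) :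
    HasDegree 𝒜 (d + d' - 1) fun w => sandwich (koszul 𝒜) c u w X := by
  intro w n hw
  induction w generalizing X d n with
  | nil => exact Submodule.zero_mem _
  | cons a w ih =>
    beta_reduce
    rw [sandwich_cons]
    refine Submodule.add_mem _ (splitSum_mem _ fun v x h => ?_) ?_
    · subst h
      obtain ⟨p, hv, hx⟩ := homWord_append 𝒜 (v := a :: v) hw
      have := (hX.tail (hc _ _ hv)).pull hu x (n - p) hx
      convert this using 2
      ring
    · obtain ⟨i, ha, hw⟩ := hw
      have hθ : koszul 𝒜 a ∈ 𝒜 i := by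
        rw [koszul_of_mem 𝒜 ha]
        exact zsmul_mem ha _
      convert ih (hX.tail hθ) _ hw using 2
      ring

theorem HasDegree.add {d : ℤ} {X Y : List A → A} (hX : HasDegree 𝒜 d X) (hY : HasDegree 𝒜 d Y) :
    HasDegree 𝒜 d fun w => X w + Y w :=
  fun w n hw => Submodule.add_mem _ (hX w n hw) (hY w n hw)

theorem HasDegree.sub {d : ℤ} {X Y : List A → A} (hX : HasDegree 𝒜 d X) (hY : HasDegree 𝒜 d Y) :
    HasDegree 𝒜 d fun w => X w - Y w :=
  fun w n hw => Submodule.sub_mem _ (hX w n hw) (hY w n hw)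

theorem hasDegree_idOp : HasDegree 𝒜 1 (idOp (A := A)) := by
  intro w n hw
  match w with
  | [] => exact Submodule.zero_mem _
  | [a] =>
    obtain ⟨i, ha, hw⟩ := hw
    have : n + 1 = i := by simp only [HomWord] at hw; omega
    rw [this]; exact ha
  | _ :: _ :: _ => exact Submodule.zero_mem _

variable (𝒜) [GradedAlgebra 𝒜]

theorem span_homogeneous : Submodule.span R {a : A | ∃ i, a ∈ 𝒜 i} = ⊤ := by
  rw [eq_top_iff]
  intro a _
  induction a using DirectSum.Decomposition.inductionOn 𝒜 with
  | zero => exact Submodule.zero_mem _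
  | add x y hx hy => exact Submodule.add_mem _ (hx trivial) (hy trivial)
  | @homogeneous i x => exact Submodule.subset_span ⟨i, x.2⟩

theorem ext_homogeneous {B : Type*} [AddCommGroup B] [Module R B] (F G : A →ₗ[R] B)
    (h : ∀ i, ∀ a ∈ 𝒜 i, F a = G a) (a : A) : F a = G a := by
  have : F = G := LinearMap.ext_on (span_homogeneous 𝒜) fun a ⟨i, ha⟩ => h i a ha
  rw [this]

theorem negOnePow_smul_smul (n : ℤ) (a : A) :
    (n.negOnePow : ℤ) • (n.negOnePow : ℤ) • a = a := by
  rw [smul_smul, ← Units.val_mul, ← Int.negOnePow_add, Int.negOnePow_even _ ⟨n, rfl⟩]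
  simp

theorem koszul_mem {i : ℤ} {a : A} (ha : a ∈ 𝒜 i) : koszul 𝒜 a ∈ 𝒜 i := by
  rw [koszul_of_mem 𝒜 ha]
  exact zsmul_mem ha _

theorem koszul_koszul (a : A) : koszul 𝒜 (koszul 𝒜 a) = a := by
  refine ext_homogeneous 𝒜 (koszul 𝒜 ∘ₗ koszul 𝒜) LinearMap.id (fun i a ha => ?_) a
  rw [LinearMap.comp_apply, koszul_of_mem 𝒜 (koszul_mem 𝒜 ha), koszul_of_mem 𝒜 ha,
    negOnePow_smul_smul]
  rfl

theorem koszul_mul {e : A} (he : e ∈ 𝒜 0) (a : A) : koszul 𝒜 (a * e) = koszul 𝒜 a * e := by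
  refine ext_homogeneous 𝒜 (koszul 𝒜 ∘ₗ LinearMap.mulRight R e)
    (LinearMap.mulRight R e ∘ₗ koszul 𝒜) (fun i a ha => ?_) a
  have h := SetLike.mul_mem_graded ha he
  rw [add_zero] at h
  simp only [LinearMap.comp_apply, LinearMap.mulRight_apply]
  rw [koszul_of_mem 𝒜 h, koszul_of_mem 𝒜 ha, smul_mul_assoc]

theorem mul_koszul {e : A} (he : e ∈ 𝒜 0) (a : A) : koszul 𝒜 (e * a) = e * koszul 𝒜 a := by
  refine ext_homogeneous 𝒜 (koszul 𝒜 ∘ₗ LinearMap.mulLeft R e)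
    (LinearMap.mulLeft R e ∘ₗ koszul 𝒜) (fun i a ha => ?_) a
  have h := SetLike.mul_mem_graded he ha
  rw [zero_add] at h
  simp only [LinearMap.comp_apply, LinearMap.mulLeft_apply]
  rw [koszul_of_mem 𝒜 h, koszul_of_mem 𝒜 ha, mul_smul_comm]

theorem koszul_unit {e : A} (he : e ∈ 𝒜 0) : koszul 𝒜 e = -e := by
  rw [koszul_of_mem 𝒜 he]
  simp

theorem prodOp_isMultilin : IsMultilin (R := R) (prodOp 𝒜) where
  add u x y v := by
    match u, v with
    | [], [] => simp [prodOp]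
    | [], [_] => simp [prodOp, add_mul, add_comm]
    | [], _ :: _ :: _ => simp [prodOp]
    | [_], [] => simp [prodOp, mul_add]
    | [_], _ :: _ => simp [prodOp]
    | _ :: _ :: _, _ => simp [prodOp]
  smul u r x v := by
    match u, v with
    | [], [] => simp [prodOp]
    | [], [_] => simp [prodOp]
    | [], _ :: _ :: _ => simp [prodOp]
    | [_], [] => simp [prodOp]
    | [_], _ :: _ => simp [prodOp]
    | _ :: _ :: _, _ => simp [prodOp]

theorem hasDegree_prodOp : HasDegree 𝒜 2 (prodOp 𝒜) := by
  intro w n hw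
  match w with
  | [] => exact Submodule.zero_mem _
  | [a] => exact Submodule.zero_mem _
  | [a, b] =>
    obtain ⟨i, ha, j, hb, hw⟩ := hw
    have : n + 2 = i + j := by simp only [HomWord] at hw; omega
    rw [this]
    exact SetLike.mul_mem_graded (neg_mem (koszul_mem 𝒜 ha)) hb
  | _ :: _ :: _ :: _ => exact Submodule.zero_mem _

variable {𝒜}

theorem IsMultilin.map_koszul_homWord {X : List A → A} (hX : IsMultilin (R := R) X) (u w : List A)
    {n : ℤ} (hw : HomWord 𝒜 w n) :
    X (u ++ w.map (koszul 𝒜)) = (n.negOnePow : ℤ) • X (u ++ w) := by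
  induction w generalizing u n with
  | nil =>
    simp only [HomWord] at hw
    simp [hw]
  | cons a w ih =>
    obtain ⟨i, ha, hw⟩ := hw
    have h1 : ∀ (z : ℤˣ) v, X (u ++ ((z : ℤ) • a) :: v) = (z : ℤ) • X (u ++ a :: v) := by
      intro z v
      rcases Int.units_eq_one_or z with rfl | rfl
      · simp
      · simpa using hX.neg_letter u v a
    have h2 := ih (u ++ [a]) hw
    simp only [List.append_assoc, List.cons_append, List.nil_append] at h2
    rw [List.map_cons, koszul_of_mem 𝒜 ha, h1, h2, smul_smul, ← Units.val_mul, ← Int.negOnePow_add]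
    congr 3
    ring

/-- Applying the sign operator to every letter of a homogeneous word multiplies `X` by the sign of
the degree of the word, which differs from the sign of the value by the parity of `d - 1`.
Homogeneous letters suffice, as they span. -/
theorem HasDegree.map_koszul {d : ℤ} {X : List A → A} (hX : IsMultilin (R := R) X)
    (hd : HasDegree 𝒜 d X) (w : List A) :
    X (w.map (koszul 𝒜)) = ((d - 1).negOnePow : ℤ) • koszul 𝒜 (X w) := by
  rw [← sub_eq_zero]
  refine ((hX.map (koszul 𝒜)).sub (hX.comp (((d - 1).negOnePow : ℤ) • koszul 𝒜))).eq_zero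
    (span_homogeneous 𝒜) w.length (fun w _ hw => ?_) w rfl
  obtain ⟨n, hn⟩ := exists_homWord 𝒜 hw
  have h1 := hX.map_koszul_homWord [] w hn
  simp only [List.nil_append] at h1
  rw [h1, LinearMap.smul_apply, koszul_of_mem 𝒜 (hd w n hn), smul_smul, ← Units.val_mul,
    ← Int.negOnePow_add, sub_eq_zero, Int.negOnePow_def, Int.negOnePow_def]
  congr 2
  rw [← Int.negOnePow_def, ← Int.negOnePow_def, Int.negOnePow_eq_iff]
  ring_nf
  exact ⟨1 - d, by ring⟩

theorem HasDegree.even {X : List A → A} (hX : IsMultilin (R := R) X)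
    (hd : HasDegree 𝒜 1 X) (w : List A) : X (w.map (koszul 𝒜)) = koszul 𝒜 (X w) := by
  rw [hd.map_koszul hX]; simp

theorem HasDegree.odd {X : List A → A} (hX : IsMultilin (R := R) X)
    (hd : HasDegree 𝒜 2 X) (w : List A) : X (w.map (koszul 𝒜)) = -koszul 𝒜 (X w) := by
  rw [hd.map_koszul hX]; simp

theorem HasDegree.odd' {X : List A → A} (hX : IsMultilin (R := R) X)
    (hd : HasDegree 𝒜 0 X) (w : List A) : X (w.map (koszul 𝒜)) = -koszul 𝒜 (X w) := by
  rw [hd.map_koszul hX]; simp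

end Degrees

/-! ### Linearity over the idempotents -/

section ELinear

variable {A B : Type*} [Ring A] [AddCommGroup B] (e : A)

/-- `X (…, x e, y, …) = X (…, x, e y, …)`. -/
def Balanced (X : List A → B) : Prop :=
  ∀ u x y w, X (u ++ (x * e) :: y :: w) = X (u ++ x :: (e * y) :: w)

/-- `X` is balanced and linear with respect to `e` on both sides. -/
structure ELinear (X : List A → A) : Prop where
  balanced : Balanced e X
  left : ∀ x w, X ((e * x) :: w) = e * X (x :: w)
  right : ∀ u x, X (u ++ [x * e]) = X (u ++ [x]) * e

variable {e}

theorem Balanced.tail {X : List A → B} (hX : Balanced e X) (b : A) :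
    Balanced e fun t => X (b :: t) := fun u x y w => hX (b :: u) x y w

theorem Balanced.pull_junction {X : List A → B} (hX : Balanced e X) {f : List A → A}
    (hf : ELinear e f) (b y : A) (w : List A) :
    pull (fun t => X ((b * e) :: t)) f (y :: w) = pull (fun t => X (b :: t)) f ((e * y) :: w) := by
  rw [pull_cons, pull_cons]
  refine splitSum_congr fun v x _ => ?_
  rw [hf.left]
  congr 1
  funext t
  exact hX [] b _ t

/-- If the two letters lie in one block, `f` is balanced. If the cut is between them, `e` leaves the
right end of one block, passes through `X`, and enters the left end of the next. -/
theorem Balanced.pull {X : List A → B} (hX : Balanced e X) {f : List A → A} (hf : ELinear e f) :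
    Balanced e (pull X f) := by
  intro u x y w
  generalize hn : u.length = n
  induction n using Nat.strong_induction_on generalizing u X with
  | _ n ih =>
    match u with
    | [] =>
      simp only [List.nil_append]
      have h1 := hf.right [] x
      simp only [List.nil_append] at h1
      rw [pull_cons, pull_cons, splitSum_cons, splitSum_cons, h1, hX.pull_junction hf]
      congr 1
      refine splitSum_congr fun v z _ => ?_
      have := hf.balanced [] x y v
      simp only [List.nil_append] at this
      rw [this]
    | a :: u =>
      simp only [List.cons_append, pull_cons]
      refine splitSum_congr_junction (fun v => ?_) ?_ fun p q h => ?_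
      · have := hf.balanced (a :: u) x y v
        simp only [List.cons_append] at this
        rw [this]
      · have := hf.right (a :: u) x
        simp only [List.cons_append] at this
        rw [this, hX.pull_junction hf]
      · have h1 := length_le_of_append_eq h
        exact ih q.length (by simp at hn; omega) (hX.tail _) q rfl

theorem pull_right {X : List A → B} {f : List A → A} (hf : ELinear e f) {L : B →+ B}
    (hX : ∀ u x, X (u ++ [x * e]) = L (X (u ++ [x]))) (u : List A) (x : A) :
    pull X f (u ++ [x * e]) = L (pull X f (u ++ [x])) := by
  generalize hn : u.length = n
  induction n using Nat.strong_induction_on generalizing u X with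
  | _ n ih =>
    match u with
    | [] =>
      have h1 := hf.right [] x
      have h2 := hX [] (f [x])
      simp only [List.nil_append] at h1 h2 ⊢
      rw [pull_cons, pull_cons, splitSum_nil, splitSum_nil, pull_nil, pull_nil, h1, h2]
    | a :: u =>
      have h1 := hf.right (a :: u) x
      have h2 := hX [] (f (a :: (u ++ [x])))
      simp only [List.cons_append, List.nil_append] at h1 h2
      rw [List.cons_append, List.cons_append, pull_cons, pull_cons, splitSum_concat,
        splitSum_concat, map_add, pull_nil, pull_nil, h1, h2, map_splitSum]
      congr 1
      refine splitSum_congr fun p q h => ?_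
      have h3 := length_le_of_append_eq h
      exact ih q.length (by simp at hn; omega) (fun u x => hX (_ :: u) x) q rfl

theorem pull_left {X : List A → B} {f : List A → A} (hf : ELinear e f) {L : B →+ B}
    (hX : ∀ x w, X ((e * x) :: w) = L (X (x :: w))) (x : A) (w : List A) :
    pull X f ((e * x) :: w) = L (pull X f (x :: w)) := by
  rw [pull_cons, pull_cons, map_splitSum]
  refine splitSum_congr fun v z _ => ?_
  rw [map_pull]
  simp only [hf.left, hX]

theorem ELinear.pull {X f : List A → A} (hX : ELinear e X) (hf : ELinear e f) :
    ELinear e (pull X f) where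
  balanced := hX.balanced.pull hf
  left := pull_left (L := AddMonoidHom.mulLeft e) hf hX.left
  right := pull_right (L := AddMonoidHom.mulRight e) hf hX.right

variable {θ : A → A} (hθl : ∀ a, θ (e * a) = e * θ a) (hθr : ∀ a, θ (a * e) = θ a * e)

include hθl in
theorem Balanced.sandwich_junction {X : List A → B} (hX : Balanced e X) {c u : List A → A}
    (hc : ELinear e c) (b y : A) (w : List A) :
    sandwich θ c u (y :: w) (fun t => X ((b * e) :: t)) =
      sandwich θ c u ((e * y) :: w) fun t => X (b :: t) := by
  rw [sandwich_cons, sandwich_cons]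
  simp only [hc.left, hθl]
  congr 1
  · refine splitSum_congr fun v x _ => ?_
    congr 1
    funext t
    exact hX [] b _ t
  · congr 1
    funext t
    exact hX [] b _ t

include hθl hθr in
theorem Balanced.sandwich {X : List A → B} (hX : Balanced e X) {c u : List A → A}
    (hc : ELinear e c) (hu : ELinear e u) : Balanced e fun w => sandwich θ c u w X := by
  intro p x y w
  induction p generalizing X with
  | nil =>
    simp only [List.nil_append]
    have h1 := hc.right [] x
    simp only [List.nil_append] at h1
    rw [sandwich_cons θ c u (x * e), sandwich_cons θ c u x, hθr, hX.sandwich_junction hθl hc]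
    congr 1
    rw [splitSum_cons, splitSum_cons, h1, hX.pull_junction hu]
    congr 1
    refine splitSum_congr fun v z _ => ?_
    have := hc.balanced [] x y v
    simp only [List.nil_append] at this
    rw [this]
  | cons a p ih =>
    simp only [List.cons_append, sandwich_cons]
    congr 1
    · refine splitSum_congr_junction (fun v => ?_) ?_ fun p q h => ?_
      · have := hc.balanced (a :: p) x y v
        simp only [List.cons_append] at this
        rw [this]
      · have := hc.right (a :: p) x
        simp only [List.cons_append] at this
        rw [this, hX.pull_junction hu]
      · exact (hX.tail _).pull hu q x y w
    · exact ih (hX.tail _)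

include hθr in
theorem sandwich_right {X : List A → B} {c u : List A → A} (hc : ELinear e c) (hu : ELinear e u)
    {L : B →+ B} (hX : ∀ u x, X (u ++ [x * e]) = L (X (u ++ [x]))) (p : List A) (x : A) :
    sandwich θ c u (p ++ [x * e]) X = L (sandwich θ c u (p ++ [x]) X) := by
  induction p generalizing X with
  | nil =>
    have h1 := hc.right [] x
    have h2 := hX [] (c [x])
    simp only [List.nil_append] at h1 h2 ⊢
    simp only [sandwich_cons, splitSum_nil, pull_nil, h1, h2, sandwich_nil, add_zero]
  | cons a p ih =>
    have h1 := hc.right (a :: p) x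
    have h2 := hX [] (c (a :: (p ++ [x])))
    simp only [List.cons_append, List.nil_append] at h1 h2
    rw [List.cons_append, List.cons_append, sandwich_cons, sandwich_cons, splitSum_concat,
        splitSum_concat, map_add, map_add, pull_nil, pull_nil, h1, h2, map_splitSum,
        ih fun u x => hX (_ :: u) x]
    congr 2
    exact splitSum_congr fun p q _ => pull_right hu (fun u x => hX (_ :: u) x) q x

include hθl in
theorem sandwich_left {X : List A → B} {c u : List A → A} (hc : ELinear e c)
    {L : B →+ B} (hX : ∀ x w, X ((e * x) :: w) = L (X (x :: w))) (x : A) (w : List A) :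
    sandwich θ c u ((e * x) :: w) X = L (sandwich θ c u (x :: w) X) := by
  rw [sandwich_cons, sandwich_cons, map_add, map_splitSum, map_sandwich]
  simp only [hc.left, hθl, hX]
  congr 1
  exact splitSum_congr fun v z _ => (map_pull L _ u z).symm

include hθl hθr in
theorem ELinear.sandwich {X c u : List A → A} (hX : ELinear e X) (hc : ELinear e c)
    (hu : ELinear e u) : ELinear e fun w => sandwich θ c u w X where
  balanced := hX.balanced.sandwich hθl hθr hc hu
  left := sandwich_left (L := AddMonoidHom.mulLeft e) hθl hc hX.left
  right := sandwich_right (L := AddMonoidHom.mulRight e) hθr hc hu hX.right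

theorem ELinear.add {X Y : List A → A} (hX : ELinear e X) (hY : ELinear e Y) :
    ELinear e fun w => X w + Y w where
  balanced u x y w := by simp only [hX.balanced u x y w, hY.balanced u x y w]
  left x w := by rw [hX.left, hY.left, mul_add]
  right u x := by rw [hX.right, hY.right, add_mul]

theorem ELinear.sub {X Y : List A → A} (hX : ELinear e X) (hY : ELinear e Y) :
    ELinear e fun w => X w - Y w where
  balanced u x y w := by simp only [hX.balanced u x y w, hY.balanced u x y w]
  left x w := by rw [hX.left, hY.left, mul_sub]
  right u x := by rw [hX.right, hY.right, sub_mul]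

theorem eLinear_idOp : ELinear e (idOp (A := A)) where
  balanced u x y w := by
    match u with
    | [] => rfl
    | [_] => rfl
    | _ :: _ :: _ => rfl
  left x w := by cases w <;> simp [idOp]
  right u x := by
    match u with
    | [] => rfl
    | [_] => simp [idOp]
    | _ :: _ :: _ => simp [idOp]

end ELinear

theorem eLinear_prodOp {R A : Type*} [CommRing R] [Ring A] [Algebra R A] (𝒜 : ℤ → Submodule R A)
    [GradedAlgebra 𝒜] {e : A} (he : e ∈ 𝒜 0) : ELinear e (prodOp 𝒜) where
  balanced u x y w := by
    match u, w with
    | [], [] => simp [prodOp, koszul_mul 𝒜 he, mul_assoc]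
    | [], _ :: _ => rfl
    | [_], _ => rfl
    | _ :: _ :: _, _ => simp [prodOp]
  left x w := by
    match w with
    | [] => simp [prodOp]
    | [_] => simp [prodOp, mul_koszul 𝒜 he, mul_assoc]
    | _ :: _ :: _ => simp [prodOp]
  right u x := by
    match u with
    | [] => simp [prodOp]
    | [_] => simp [prodOp, mul_assoc]
    | _ :: _ :: _ => simp [prodOp]

/-! ### Normalization -/

section Normalized

variable {R A B : Type*} [CommRing R] [Ring A] [Algebra R A] [AddCommGroup B] [Module R B] {e : A}

/-- `X` vanishes on words of length at least `q` that contain the letter `e`. -/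
def Normalized (e : A) (q : ℕ) (X : List A → B) : Prop :=
  ∀ u w, q ≤ (u ++ e :: w).length → X (u ++ e :: w) = 0

/-- A longer block that contains `e` contributes zero, so `e` is a block by itself and separates the
cuttings of `u` and `x`. -/
theorem pull_unit {X : List A → B} (hX : IsMultilin (R := R) X) {f : List A → A} (hf1 : f [e] = e)
    (hf : Normalized e 2 f) (u x : List A) :
    pull X f (u ++ e :: x) = pull (fun p => pull (fun q => X (p ++ e :: q)) f x) f u := by
  generalize hn : u.length = n
  induction n using Nat.strong_induction_on generalizing u X with
  | _ n ih =>
    match u with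
    | [] =>
      rw [List.nil_append, pull_cons, pull_nil]
      cases x with
      | nil => simp [splitSum_nil, hf1]
      | cons b x =>
        rw [splitSum_cons, splitSum_eq_zero, add_zero, hf1]
        · rfl
        · intro v z _
          have h := hf [] (b :: v) (by simp)
          rw [List.nil_append] at h
          have : (fun t => X (f (e :: b :: v) :: t)) = fun _ => 0 := by
            funext t; rw [h]; exact hX.zero_letter [] t
          rw [this, pull_zero]
    | a :: u =>
      rw [List.cons_append, pull_cons, pull_cons, splitSum_of_vanish]
      · refine splitSum_congr fun p q h => ?_
        have h1 := length_le_of_append_eq h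
        exact ih q.length (by simp at hn; omega) (hX.tail _) q rfl
      · intro v z _
        have h := hf (a :: u) v (by simp; omega)
        rw [List.cons_append] at h
        have : (fun t => X (f (a :: (u ++ e :: v)) :: t)) = fun _ => 0 := by
          funext t; rw [h]; exact hX.zero_letter [] t
        rw [this, pull_zero]

theorem Normalized.pull {X : List A → B} (hX : IsMultilin (R := R) X) (hn : Normalized e 2 X)
    {f : List A → A} (hf1 : f [e] = e) (hf : Normalized e 2 f) : Normalized e 2 (pull X f) := by
  intro u x h
  rw [pull_unit hX hf1 hf]
  cases u with
  | nil =>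
    rw [pull_nil]
    refine pull_of_vanish (fun t ht => hn [] t ?_) f ?_
    · have := List.length_pos_of_ne_nil ht
      simp; omega
    · rintro rfl; simp at h
  | cons a u =>
    refine pull_of_vanish (fun t ht => ?_) f (List.cons_ne_nil a u)
    have : (fun q => X (t ++ e :: q)) = fun _ => 0 := by
      funext q
      refine hn t q ?_
      have := List.length_pos_of_ne_nil ht
      simp; omega
    rw [this, pull_zero]

variable (𝒜 : ℤ → Submodule R A) [GradedAlgebra 𝒜]

/-- The function `m` agrees with the product on words of length at most two. -/
def ExtendsProd (m : List A → A) : Prop := ∀ w : List A, w.length ≤ 2 → m w = prodOp 𝒜 w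

variable {𝒜} (he : e ∈ 𝒜 0) {m : List A → A} (hm : ExtendsProd 𝒜 m) (hmn : Normalized e 3 m)
include he hm hmn

/-- Only the product is nonzero on a word that begins with `e`. Its sign is positive because `e` has
odd degree in `A[1]`. -/
theorem unit_cons (t : List A) : m (e :: t) = e * idOp t := by
  match t with
  | [] => rw [hm _ (by simp)]; simp [prodOp, idOp]
  | [a] => rw [hm _ (by simp)]; simp [prodOp, idOp, koszul_unit 𝒜 he]
  | a :: b :: t => simpa [idOp] using hmn [] (a :: b :: t) (by simp)

theorem concat_unit (t : List A) : m (t ++ [e]) = -koszul 𝒜 (idOp t) * e := by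
  match t with
  | [] => rw [hm _ (by simp)]; simp [prodOp, idOp]
  | [a] => rw [hm _ (by simp)]; simp [prodOp, idOp]
  | a :: b :: t => simpa [idOp] using hmn (a :: b :: t) [] (by simp)

theorem insert_unit_cons {X : List A → B} (hX : IsMultilin (R := R) X) (hXn : Normalized e 2 X)
    (x : List A) : sandwich (koszul 𝒜) m idOp (e :: x) X =
      match x with
      | [] => 0
      | y :: z => X ((e * y) :: z) := by
  have h0 : sandwich (koszul 𝒜) m idOp x (fun t => X (koszul 𝒜 e :: t)) = 0 := by
    refine sandwich_of_vanish (fun t ht => ?_) _ _ _ _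
    have h1 := hX.neg_letter [] t e
    have h2 := hXn [] t (by have := List.length_pos_of_ne_nil ht; simp; omega)
    simp only [List.nil_append] at h1 h2
    rw [koszul_unit 𝒜 he, h1, h2, neg_zero]
  have hz : ∀ x, pull (fun t => X ((0 : A) :: t)) idOp x = 0 := by
    intro x
    have : (fun t => X ((0 : A) :: t)) = fun _ => 0 := funext fun t => hX.zero_letter [] t
    rw [this, pull_zero]
  rw [sandwich_cons, h0, add_zero]
  match x with
  | [] =>
    have h1 := unit_cons he hm hmn []
    rw [splitSum_nil, h1]
    simp only [idOp, mul_zero]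
    exact hz []
  | y :: z =>
    rw [splitSum_cons, unit_cons he hm hmn]
    simp only [idOp, mul_zero]
    rw [hz, zero_add]
    have h3 : ∀ x, pull (fun t => X (m [e, y] :: t)) idOp x = X ((e * y) :: x) := fun x => by
      rw [unit_cons he hm hmn, pull_idOp (hX.tail _)]; rfl
    cases z with
    | nil => rw [splitSum_nil, h3]
    | cons z0 z =>
      rw [splitSum_cons, splitSum_eq_zero, h3, add_zero]
      intro v x _
      rw [unit_cons he hm hmn]
      simp only [idOp, mul_zero]
      exact hz x

theorem insert_unit_first {X : List A → B} (hX : IsMultilin (R := R) X) (hXn : Normalized e 2 X)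
    (a : A) (u x : List A) :
    (splitSum (u ++ e :: x) fun v z => pull (fun t => X (m (a :: v) :: t)) idOp z) =
      if u = [] then X ((-koszul 𝒜 a * e) :: x) else 0 := by
  have hz : ∀ x, pull (fun t => X ((0 : A) :: t)) idOp x = 0 := by
    intro x
    have : (fun t => X ((0 : A) :: t)) = fun _ => 0 := funext fun t => hX.zero_letter [] t
    rw [this, pull_zero]
  cases u with
  | nil =>
    have h1 : m [a] = 0 := by rw [hm _ (by simp)]; rfl
    have h2 := concat_unit he hm hmn [a]
    simp only [idOp, List.cons_append, List.nil_append] at h2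
    rw [List.nil_append, splitSum_cons, h1, hz, zero_add, if_pos rfl]
    cases x with
    | nil => simp [splitSum_nil, h2]
    | cons b x =>
      rw [splitSum_cons, h2, pull_idOp (hX.tail _), splitSum_eq_zero, add_zero]
      intro v x _
      have := hmn [a] (b :: v) (by simp)
      simp only [List.cons_append, List.nil_append] at this
      rw [this, hz]
  | cons b u =>
    rw [if_neg (List.cons_ne_nil _ _), splitSum_of_vanish]
    · refine splitSum_eq_zero fun p q _ => ?_
      rw [pull_idOp (hX.tail _)]
      exact hXn (m (a :: p) :: q) x (by simp; omega)
    · intro v x _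
      have := hmn (a :: b :: u) v (by simp; omega)
      simp only [List.cons_append] at this
      rw [List.cons_append, this, hz]

/-- Only the products of `e` with its two neighbours survive. They have opposite signs, and they
cancel because `X` is balanced. -/
theorem insert_unit_interior {X : List A → B} (hX : IsMultilin (R := R) X) (hXn : Normalized e 2 X)
    (hXb : Balanced e X) {u x : List A} (hu : u ≠ []) (hx : x ≠ []) :
    sandwich (koszul 𝒜) m idOp (u ++ e :: x) X = 0 := by
  induction u generalizing X with
  | nil => exact absurd rfl hu
  | cons a u ih =>
    have hn' : ∀ b : A, Normalized e 2 fun t => X (b :: t) := fun b u w h =>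
      hXn (b :: u) w (by simp; omega)
    rw [List.cons_append, sandwich_cons, insert_unit_first he hm hmn hX hXn]
    cases u with
    | nil =>
      rw [List.nil_append, insert_unit_cons he hm hmn (hX.tail _) (hn' _), if_pos rfl]
      cases x with
      | nil => exact absurd rfl hx
      | cons y z =>
        have h1 := hX.neg_letter [] (y :: z) (koszul 𝒜 a * e)
        have h2 := hXb [] (koszul 𝒜 a) y z
        simp only [List.nil_append] at h1 h2
        rw [neg_mul, h1, h2, neg_add_cancel]
    | cons b u =>
      rw [if_neg (List.cons_ne_nil _ _), zero_add]
      exact ih (hX.tail _) (hn' _) (hXb.tail _) (List.cons_ne_nil _ _)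

theorem insert_concat_unit {X : List A → A} (hX : IsMultilin (R := R) X) (hXn : Normalized e 2 X)
    (hXr : ∀ u x, X (u ++ [x * e]) = X (u ++ [x]) * e) {u : List A} (hu : u ≠ []) :
    sandwich (koszul 𝒜) m idOp (u ++ [e]) X = -X (u.map (koszul 𝒜)) * e := by
  induction u generalizing X with
  | nil => exact absurd rfl hu
  | cons a u ih =>
    have hn' : ∀ b : A, Normalized e 2 fun t => X (b :: t) := fun b u w h =>
      hXn (b :: u) w (by simp; omega)
    rw [List.cons_append, sandwich_cons, insert_unit_first he hm hmn hX hXn]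
    cases u with
    | nil =>
      rw [List.nil_append, insert_unit_cons he hm hmn (hX.tail _) (hn' _), if_pos rfl]
      have h1 := hX.neg_letter [] [] (koszul 𝒜 a * e)
      have h2 := hXr [] (koszul 𝒜 a)
      simp only [List.nil_append] at h1 h2
      rw [neg_mul, h1, h2]
      simp
    | cons b u =>
      rw [if_neg (List.cons_ne_nil _ _), zero_add]
      exact ih (hX.tail _) (hn' _) (fun u x => hXr (_ :: u) x) (List.cons_ne_nil _ _)

/-- For a gauge transformation `f`, the component of `f D_m` on a word that contains `e` is the
component of `D_m' α_f`. -/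
theorem insert_eq_pull_unit {m' : List A → A} (hm' : ExtendsProd 𝒜 m') (hmn' : Normalized e 3 m')
    (hmm' : IsMultilin (R := R) m') {f : List A → A} (hf : IsMultilin (R := R) f) (hf0 : f [] = 0)
    (hf1 : f [e] = e) (hfn : Normalized e 2 f) (hfe : ELinear e f)
    (hfθ : ∀ w, f (w.map (koszul 𝒜)) = koszul 𝒜 (f w)) (u x : List A)
    (h : 2 ≤ (u ++ e :: x).length) :
    sandwich (koszul 𝒜) m idOp (u ++ e :: x) f = pull m' f (u ++ e :: x) := by
  rw [pull_unit hmm' hf1 hfn]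
  have h1 : ∀ x, pull (fun q => m' ([] ++ e :: q)) f x = e * f x := by
    intro x
    simp only [List.nil_append, unit_cons he hm' hmn']
    rw [← pull_idOp_left hf0 x]
    exact (map_pull (AddMonoidHom.mulLeft e) idOp f x).symm
  cases u with
  | nil =>
    rw [List.nil_append, insert_unit_cons he hm hmn hf hfn, pull_nil, h1]
    cases x with
    | nil => simp at h
    | cons y z => exact hfe.left y z
  | cons a u =>
    cases x with
    | nil =>
      simp only [pull_nil]
      rw [insert_concat_unit he hm hmn hf hfn hfe.right (List.cons_ne_nil _ _), hfθ]
      simp only [concat_unit he hm' hmn']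
      rw [← pull_idOp_left hf0 (a :: u)]
      have h3 := map_pull (-(AddMonoidHom.mulRight e).comp (koszul 𝒜 : A →+ A)) idOp f (a :: u)
      simpa using h3
    | cons y z =>
      rw [insert_unit_interior he hm hmn hf hfn hfe.balanced (List.cons_ne_nil _ _)
        (List.cons_ne_nil _ _)]
      symm
      refine pull_of_vanish (fun t ht => pull_of_vanish (fun s hs => ?_) _ (List.cons_ne_nil _ _))
        _ (List.cons_ne_nil _ _)
      have h2 := List.length_pos_of_ne_nil ht
      have h3 := List.length_pos_of_ne_nil hs
      exact hmn' t s (by simp; omega)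

-- The letter `e` lies inside the argument of `h`, which then vanishes, or it reaches `X` up to
-- sign, to the left of `h` as a twisted letter or to the right as a block by itself. In the last
-- two cases `X` has another argument, the value of `h`, and is normalized.
omit hm hmn in
theorem sandwich_unit_vanish {h u : List A → A} (hh : Normalized e 1 h) (hu1 : u [e] = e)
    (hun : Normalized e 2 u) {X : List A → B} (hX : IsMultilin (R := R) X) (hXn : Normalized e 2 X)
    (p x : List A) : sandwich (koszul 𝒜) h u (p ++ e :: x) X = 0 := by
  have hz : ∀ x, pull (fun t => X ((0 : A) :: t)) u x = 0 := by
    intro x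
    have : (fun t => X ((0 : A) :: t)) = fun _ => 0 := funext fun t => hX.zero_letter [] t
    rw [this, pull_zero]
  induction p generalizing X with
  | nil =>
    rw [List.nil_append, sandwich_cons, splitSum_eq_zero, zero_add]
    · refine sandwich_of_vanish (fun t ht => ?_) _ _ _ _
      have h1 := hX.neg_letter [] t e
      have h2 := hXn [] t (by have := List.length_pos_of_ne_nil ht; simp; omega)
      simp only [List.nil_append] at h1 h2
      rw [koszul_unit 𝒜 he, h1, h2, neg_zero]
    · intro v z _
      have := hh [] v (by simp)
      rw [List.nil_append] at this
      rw [this, hz]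
  | cons a p ih =>
    have hn' : ∀ b : A, ∀ u w, X (b :: (u ++ e :: w)) = 0 := fun b u w =>
      hXn (b :: u) w (by simp; omega)
    rw [List.cons_append, sandwich_cons, splitSum_of_vanish, splitSum_eq_zero, zero_add]
    · refine ih (hX.tail _) (fun u w _ => hn' _ u w) fun x => ?_
      have : (fun t => X (koszul 𝒜 a :: 0 :: t)) = fun _ => 0 :=
        funext fun t => hX.zero_letter [_] t
      rw [this, pull_zero]
    · intro v z _
      rw [pull_unit (hX.tail _) hu1 hun]
      simp only [hn', pull_zero]
    · intro v z _
      have := hh (a :: p) v (by simp)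
      rw [List.cons_append] at this
      rw [this, hz]

/-- Used to show that the gauge transformation of a homotopy is normalized. If `e` is at an end of
the word, its product with the value of `h` cancels its product with the neighbouring letter; in the
interior both terms vanish. -/
theorem sandwich_unit_of_homotopy {h u : List A → A} (hmm : IsMultilin (R := R) m)
    (hh : IsMultilin (R := R) h) (hh0 : h [] = 0)
    (hhn : Normalized e 1 h) (hhe : ELinear e h)
    (hhθ : ∀ w, h (w.map (koszul 𝒜)) = -koszul 𝒜 (h w)) (hu1 : u [e] = e)
    (hun : Normalized e 2 u) (p x : List A) :
    sandwich (koszul 𝒜) h u (p ++ e :: x) m + sandwich (koszul 𝒜) m idOp (p ++ e :: x) h = 0 := by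
  have hhn' : Normalized e 2 h := fun u w _ => hhn u w (by simp; omega)
  cases p with
  | nil =>
    have h1 : sandwich (koszul 𝒜) h u (e :: x) m = -e * h x := by
      rw [sandwich_cons, splitSum_eq_zero, zero_add]
      · have : (fun t => m (koszul 𝒜 e :: t)) = fun t => AddMonoidHom.mulLeft (-e) (idOp t) := by
          funext t
          have h1 := hmm.neg_letter [] t e
          simp only [List.nil_append] at h1
          rw [koszul_unit 𝒜 he, h1, unit_cons he hm hmn]
          simp
        rw [this, ← map_sandwich, sandwich_idOp_left _ hh0]
        rfl
      · intro v z _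
        have := hhn [] v (by simp)
        rw [List.nil_append] at this
        rw [this]
        have : (fun t => m ((0 : A) :: t)) = fun _ => 0 := funext fun t => hmm.zero_letter [] t
        rw [this, pull_zero]
    rw [List.nil_append, h1, insert_unit_cons he hm hmn hh hhn']
    cases x with
    | nil => simp [hh0]
    | cons y z => simp [hhe.left]
  | cons a p =>
    have h1 : ∀ b : A, Normalized e 2 fun t => m (b :: t) := fun b u w h =>
      hmn (b :: u) w (by simp at h ⊢; omega)
    have h2 : sandwich (koszul 𝒜) h u (a :: p ++ e :: x) m =
        splitSum p fun s q => pull (fun t => m (h (a :: s) :: t)) u (q ++ e :: x) := by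
      rw [List.cons_append, sandwich_cons, sandwich_unit_vanish he hhn hu1 hun (hmm.tail _) (h1 _),
        add_zero, splitSum_of_vanish]
      intro v z _
      have := hhn (a :: p) v (by simp)
      rw [List.cons_append] at this
      rw [this]
      have : (fun t => m ((0 : A) :: t)) = fun _ => 0 := funext fun t => hmm.zero_letter [] t
      rw [this, pull_zero]
    cases x with
    | nil =>
      rw [h2, splitSum_last, insert_concat_unit he hm hmn hh hhn' hhe.right (List.cons_ne_nil _ _), hhθ]
      · have := concat_unit he hm hmn [h (a :: p)]
        simp only [idOp, List.cons_append, List.nil_append] at this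
        rw [pull_unit (hmm.tail _) hu1 hun]
        simp [this]
      · intro s q hq
        rw [pull_unit (hmm.tail _) hu1 hun]
        refine pull_of_vanish (fun t ht => ?_) _ hq
        rw [pull_nil]
        have := List.length_pos_of_ne_nil ht
        exact h1 _ t [] (by simp; omega)
    | cons y z =>
      rw [h2, insert_unit_interior he hm hmn hh hhn' hhe.balanced (List.cons_ne_nil _ _)
        (List.cons_ne_nil _ _), add_zero]
      refine splitSum_eq_zero fun s q _ => ?_
      rw [pull_unit (hmm.tail _) hu1 hun]
      have : (fun p => pull (fun q => m (h (a :: s) :: (p ++ e :: q))) u (y :: z)) = fun _ => 0 := by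
        funext t
        refine pull_of_vanish (fun r hr => ?_) _ (List.cons_ne_nil _ _)
        have := List.length_pos_of_ne_nil hr
        exact h1 _ t r (by simp; omega)
      rw [this, pull_zero]

end Normalized

end AInf

namespace AInf

/-! ### Fixed points of contracting maps -/

section Contraction

variable {A B : Type*}

/-- A contracting map of functions of words has a fixed point in each complete subset. -/
theorem exists_fixed_word {P : (List A → B) → Prop} {Φ : (List A → B) → List A → B}
    (hΦ : ∀ f f' w, P f → P f' → (∀ v : List A, v.length < w.length → f v = f' v) →
      Φ f w = Φ f' w)
    (hP : ∀ f, P f → P (Φ f))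
    (hlim : ∀ f, (∀ N : ℕ, ∃ f', P f' ∧ ∀ w : List A, w.length < N → f w = f' w) → P f)
    {f₀ : List A → B} (h₀ : P f₀) : ∃ f, P f ∧ ∀ w, Φ f w = f w := by
  have hPi : ∀ i, P (Φ^[i] f₀) := fun i => by
    induction i with
    | zero => exact h₀
    | succ i ih => rw [Function.iterate_succ_apply']; exact hP _ ih
  have stable : ∀ (N i j : ℕ) (w : List A), w.length < N → N ≤ i → N ≤ j →
      (Φ^[i] f₀) w = (Φ^[j] f₀) w := by
    intro N
    induction N with
    | zero => intro i j w hw; omega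
    | succ N ih =>
      intro i j w hw hi hj
      obtain ⟨i, rfl⟩ : ∃ i', i = i' + 1 := ⟨i - 1, by omega⟩
      obtain ⟨j, rfl⟩ : ∃ j', j = j' + 1 := ⟨j - 1, by omega⟩
      rw [Function.iterate_succ_apply', Function.iterate_succ_apply']
      exact hΦ _ _ w (hPi i) (hPi j) fun v hv => ih i j v (by omega) (by omega) (by omega)
  -- On words of length `l` the iterates are constant from the `(l + 1)`-st on, so the limit agrees
  -- on words shorter than `N` with the `N`-th iterate.
  have hPf : P fun w => (Φ^[w.length + 1] f₀) w :=
    hlim _ fun N => ⟨Φ^[N] f₀, hPi N, fun w hw => stable _ _ _ w (Nat.lt_succ_self _) le_rfl hw⟩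
  refine ⟨_, hPf, fun w => ?_⟩
  rw [Function.iterate_succ_apply']
  exact hΦ _ _ w hPf (hPi _) fun v hv => stable _ _ _ v (Nat.lt_succ_self _) le_rfl (by omega)

end Contraction

/-! ### Dependence on short words -/

section Locality

variable {R A B : Type*} [CommRing R] [Ring A] [Algebra R A] [AddCommGroup B] [Module R B]

theorem pull_sub (X Y : List A → B) (f : List A → A) (w : List A) :
    pull (fun t => X t - Y t) f w = pull X f w - pull Y f w := Finset.sum_sub_distrib ..

theorem sandwich_sub (θ : A → A) (c u : List A → A) (w : List A) (X Y : List A → B) :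
    sandwich θ c u w (fun t => X t - Y t) = sandwich θ c u w X - sandwich θ c u w Y := by
  rw [eq_sub_iff_add_eq, ← sandwich_add]
  simp

/-- The cutting into a single block is the only one in which `f` is evaluated on the whole word, and
`X` kills it. -/
theorem pull_congr_of_lt {X : List A → B} {f f' : List A → A} {w : List A}
    (hX : ∀ b, X [b] = 0) (hf : ∀ v : List A, v ≠ [] → v.length < w.length → f v = f' v) :
    pull X f w = pull X f' w := by
  cases w with
  | nil => simp
  | cons a w =>
    rw [pull_cons, pull_cons]
    refine splitSum_congr fun v x h => ?_
    subst h
    cases x with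
    | nil => simp [hX]
    | cons b x =>
      rw [hf (a :: v) (by simp) (by simp)]
      exact pull_congr (fun _ _ => rfl) fun t ht0 ht => hf t ht0 (by simp at ht ⊢; omega)

/-- If `Y` vanishes on words of length less than `n`, and `c` on words of length one, then
`Y ∘ H` vanishes on words of length at most `n`. -/
theorem sandwich_vanish {Y : List A → B} (hY : IsMultilin (R := R) Y) {c : List A → A}
    (hc : ∀ a, c [a] = 0) (θ : A → A) (u : List A → A) {n : ℕ}
    (h : ∀ w : List A, w.length < n → Y w = 0) (w : List A) (hw : w.length ≤ n) :
    sandwich θ c u w Y = 0 := by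
  induction w generalizing Y n with
  | nil => rfl
  | cons a w ih =>
    rw [sandwich_cons, splitSum_eq_zero, zero_add]
    · exact ih (n := n - 1) (hY.tail _) (fun v hv => h _ (by simp; omega)) (by simp at hw; omega)
    · intro v x hvx
      subst hvx
      refine (pull_congr (X' := fun _ => 0) (fun t ht => ?_) fun _ _ _ => rfl).trans (pull_zero u x)
      cases v with
      | nil => rw [hc]; exact hY.zero_letter [] t
      | cons b v => exact h _ (by simp at hw ⊢; omega)

theorem sandwich_congr_of_lt {X Y : List A → B} (hX : IsMultilin (R := R) X)
    (hY : IsMultilin (R := R) Y) {c : List A → A} (hc : ∀ a, c [a] = 0) (θ : A → A)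
    (u : List A → A) (w : List A) (h : ∀ v : List A, v.length < w.length → X v = Y v) :
    sandwich θ c u w X = sandwich θ c u w Y := by
  rw [← sub_eq_zero, ← sandwich_sub]
  exact sandwich_vanish (hX.sub hY) hc θ u (fun v hv => by rw [h v hv, sub_self]) w le_rfl

variable (𝒜 : ℤ → Submodule R A) {V : Type*} (e : V → A)

/-- Each instance of the condition involves finitely many words, so it passes to limits. This and
its analogues supply the closedness hypothesis of `exists_fixed_word`. -/
theorem IsMultilin.of_local {f : List A → B} (h : ∀ N : ℕ, ∃ f' : List A → B,
    IsMultilin (R := R) f' ∧ ∀ w : List A, w.length < N → f w = f' w) : IsMultilin (R := R) f where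
  add u x y v := by
    obtain ⟨f', hf', h⟩ := h (u.length + v.length + 2)
    rw [h _ (by simp; omega), h _ (by simp; omega), h _ (by simp; omega), hf'.add]
  smul u r x v := by
    obtain ⟨f', hf', h⟩ := h (u.length + v.length + 2)
    rw [h _ (by simp; omega), h _ (by simp; omega), hf'.smul]

theorem HasDegree.of_local {d : ℤ} {f : List A → A} (h : ∀ N : ℕ, ∃ f' : List A → A,
    HasDegree 𝒜 d f' ∧ ∀ w : List A, w.length < N → f w = f' w) : HasDegree 𝒜 d f := by
  intro w n hw
  obtain ⟨f', hf', h⟩ := h (w.length + 1)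
  rw [h w (by omega)]
  exact hf' w n hw

theorem ELinear.of_local {e : A} {f : List A → A} (h : ∀ N : ℕ, ∃ f' : List A → A,
    ELinear e f' ∧ ∀ w : List A, w.length < N → f w = f' w) : ELinear e f where
  balanced u x y w := by
    obtain ⟨f', hf', h⟩ := h (u.length + w.length + 3)
    rw [h _ (by simp; omega), h _ (by simp; omega), hf'.balanced]
  left x w := by
    obtain ⟨f', hf', h⟩ := h (w.length + 2)
    rw [h _ (by simp), h _ (by simp), hf'.left]
  right u x := by
    obtain ⟨f', hf', h⟩ := h (u.length + 2)
    rw [h _ (by simp), h _ (by simp), hf'.right]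

theorem Normalized.of_local {e : A} {q : ℕ} {f : List A → B} (h : ∀ N : ℕ, ∃ f' : List A → B,
    Normalized e q f' ∧ ∀ w : List A, w.length < N → f w = f' w) : Normalized e q f := by
  intro u w hq
  obtain ⟨f', hf', h⟩ := h (u.length + w.length + 2)
  rw [h _ (by simp; omega), hf' u w hq]

end Locality

/-! ### Gauge transformations, structures and homotopies as functions of words -/

section WordTypes

variable {R A : Type*} [CommRing R] [Ring A] [Algebra R A] (𝒜 : ℤ → Submodule R A)
  [GradedAlgebra 𝒜] {V : Type*} (e : V → A)

/-- `f` is the component of a gauge transformation. -/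
structure IsGaugeWord (f : List A → A) : Prop where
  multilin : IsMultilin (R := R) f
  low : ∀ w : List A, w.length ≤ 1 → f w = idOp w
  degree : HasDegree 𝒜 1 f
  elinear : ∀ v, ELinear (e v) f
  normalized : ∀ v, Normalized (e v) 2 f

/-- `m` satisfies the conditions on the operations of an `A_∞`-structure, except for the
`A_∞`-identity. -/
structure IsAnWord (m : List A → A) : Prop where
  multilin : IsMultilin (R := R) m
  low : ExtendsProd 𝒜 m
  degree : HasDegree 𝒜 2 m
  elinear : ∀ v, ELinear (e v) m
  normalized : ∀ v, Normalized (e v) 3 m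

/-- `h` belongs to `CH^0`. -/
structure IsHomotopyWord (h : List A → A) : Prop where
  multilin : IsMultilin (R := R) h
  nil : h [] = 0
  degree : HasDegree 𝒜 0 h
  elinear : ∀ v, ELinear (e v) h
  normalized : ∀ v, Normalized (e v) 1 h

variable {𝒜 e}

theorem IsGaugeWord.nil {f : List A → A} (hf : IsGaugeWord 𝒜 e f) : f [] = 0 := hf.low [] (by simp)

theorem IsGaugeWord.one {f : List A → A} (hf : IsGaugeWord 𝒜 e f) (a : A) : f [a] = a :=
  hf.low [a] (by simp)

theorem IsGaugeWord.even {f : List A → A} (hf : IsGaugeWord 𝒜 e f) (w : List A) :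
    f (w.map (koszul 𝒜)) = koszul 𝒜 (f w) := hf.degree.even hf.multilin w

theorem IsAnWord.nil {m : List A → A} (hm : IsAnWord 𝒜 e m) : m [] = 0 := hm.low [] (by simp)

theorem IsAnWord.one {m : List A → A} (hm : IsAnWord 𝒜 e m) (a : A) : m [a] = 0 :=
  hm.low [a] (by simp)

theorem IsAnWord.odd {m : List A → A} (hm : IsAnWord 𝒜 e m) (w : List A) :
    m (w.map (koszul 𝒜)) = -koszul 𝒜 (m w) := hm.degree.odd hm.multilin w

theorem IsHomotopyWord.odd {h : List A → A} (hh : IsHomotopyWord 𝒜 e h) (w : List A) :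
    h (w.map (koszul 𝒜)) = -koszul 𝒜 (h w) := hh.degree.odd' hh.multilin w

theorem normalized_idOp (v : A) : Normalized v 2 (idOp (A := A)) := by
  intro u w h
  match u, w with
  | [], [] => simp at h
  | [], _ :: _ => rfl
  | [_], _ => rfl
  | _ :: _ :: _, _ => rfl

theorem isGaugeWord_idOp : IsGaugeWord 𝒜 e (idOp (A := A)) :=
  ⟨idOp_isMultilin, fun _ _ => rfl, hasDegree_idOp, fun _ => eLinear_idOp, fun _ =>
    normalized_idOp _⟩

theorem IsGaugeWord.of_local {f : List A → A} (h : ∀ N : ℕ, ∃ f' : List A → A,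
    IsGaugeWord 𝒜 e f' ∧ ∀ w : List A, w.length < N → f w = f' w) : IsGaugeWord 𝒜 e f where
  multilin := .of_local fun N => let ⟨f', h, h'⟩ := h N; ⟨f', h.multilin, h'⟩
  low w hw := let ⟨f', h, h'⟩ := h 2; (h' w (by omega)).trans (h.low w hw)
  degree := .of_local 𝒜 fun N => let ⟨f', h, h'⟩ := h N; ⟨f', h.degree, h'⟩
  elinear v := .of_local fun N => let ⟨f', h, h'⟩ := h N; ⟨f', h.elinear v, h'⟩
  normalized v := .of_local fun N => let ⟨f', h, h'⟩ := h N; ⟨f', h.normalized v, h'⟩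

theorem IsAnWord.of_local {f : List A → A} (h : ∀ N : ℕ, ∃ f' : List A → A,
    IsAnWord 𝒜 e f' ∧ ∀ w : List A, w.length < N → f w = f' w) : IsAnWord 𝒜 e f where
  multilin := .of_local fun N => let ⟨f', h, h'⟩ := h N; ⟨f', h.multilin, h'⟩
  low w hw := let ⟨f', h, h'⟩ := h 3; (h' w (by omega)).trans (h.low w hw)
  degree := .of_local 𝒜 fun N => let ⟨f', h, h'⟩ := h N; ⟨f', h.degree, h'⟩
  elinear v := .of_local fun N => let ⟨f', h, h'⟩ := h N; ⟨f', h.elinear v, h'⟩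
  normalized v := .of_local fun N => let ⟨f', h, h'⟩ := h N; ⟨f', h.normalized v, h'⟩

theorem IsGaugeWord.pull {f g : List A → A} (hf : IsGaugeWord 𝒜 e f) (hg : IsGaugeWord 𝒜 e g) :
    IsGaugeWord 𝒜 e (pull f g) where
  multilin := pull_isMultilin hf.multilin hg.multilin hg.nil
  low w hw := by
    match w, hw with
    | [], _ => rw [pull_nil, hf.nil]; rfl
    | [a], _ => rw [pull_cons, splitSum_nil, pull_nil, hg.one, hf.one]; rfl
  degree := hf.degree.pull hg.degree
  elinear v := (hf.elinear v).pull (hg.elinear v)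
  normalized v := (hf.normalized v).pull hf.multilin (hg.one _) (hg.normalized v)

/-- The equation `f α_g = id` reads `g = id - (f - id) α_g`. The right side is contracting in `g`,
because `f - id` vanishes on letters. -/
theorem IsGaugeWord.exists_inverse {f : List A → A} (hf : IsGaugeWord 𝒜 e f) :
    ∃ g, IsGaugeWord 𝒜 e g ∧ ∀ w, AInf.pull f g w = idOp w := by
  have hsub : ∀ {g : List A → A}, IsGaugeWord 𝒜 e g → ∀ w,
      idOp w - AInf.pull (fun t => f t - idOp t) g w = idOp w + g w - AInf.pull f g w := by
    intro g hg w
    rw [pull_sub, pull_idOp_left hg.nil]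
    abel
  obtain ⟨g, hg, h⟩ := exists_fixed_word (P := IsGaugeWord 𝒜 e)
    (Φ := fun g w => idOp w - AInf.pull (fun t => f t - idOp t) g w)
    (fun g g' w _ _ h => by
      have := pull_congr_of_lt (X := fun t => f t - idOp t) (f := g) (f' := g') (w := w)
        (fun b => by rw [hf.one]; exact sub_self b) fun v _ hv => h v hv
      simp only [this])
    (fun g hg => by
      have hfg := hf.pull hg
      simp only [hsub hg]
      refine ⟨(idOp_isMultilin.addFun hg.multilin).sub hfg.multilin, fun w hw => ?_,
        (hasDegree_idOp.add hg.degree).sub hfg.degree,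
        fun v => (eLinear_idOp.add (hg.elinear v)).sub (hfg.elinear v), fun v u w h => ?_⟩
      · rw [hg.low w hw, hfg.low w hw]; abel
      · rw [hg.normalized v u w h, hfg.normalized v u w h, normalized_idOp _ u w h]; simp)
    (fun g hg => .of_local hg) isGaugeWord_idOp
  refine ⟨g, hg, fun w => ?_⟩
  have h1 := h w
  simp only [hsub hg] at h1
  have h2 : idOp w + g w - AInf.pull f g w - g w = idOp w - AInf.pull f g w := by abel
  rw [h1, sub_self] at h2
  exact (sub_eq_zero.1 h2.symm).symm

/-- `f` intertwines `D_m` and `D_m'` on words of length at most `n`. -/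
def WTransforms (𝒜 : ℤ → Submodule R A) [GradedAlgebra 𝒜] (n : ℕ∞) (f m m' : List A → A) : Prop :=
  ∀ w : List A, (w.length : ℕ∞) ≤ n → sandwich (koszul 𝒜) m idOp w f = pull m' f w

/-- The `A_∞`-identity on words of length at most `n`. -/
def WIdentity (𝒜 : ℤ → Submodule R A) [GradedAlgebra 𝒜] (n : ℕ∞) (m : List A → A) : Prop :=
  ∀ w : List A, (w.length : ℕ∞) ≤ n → sandwich (koszul 𝒜) m idOp w m = 0

theorem pull_injective {f : List A → A} (hf : IsGaugeWord 𝒜 e f) {X Y : List A → A}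
    (hX : IsMultilin (R := R) X) (hY : IsMultilin (R := R) Y) {n : ℕ∞}
    (h : ∀ w : List A, (w.length : ℕ∞) ≤ n → pull X f w = pull Y f w)
    (w : List A) (hw : (w.length : ℕ∞) ≤ n) : X w = Y w := by
  obtain ⟨g, hg, hfg⟩ := hf.exists_inverse
  have key : ∀ {X : List A → A}, IsMultilin (R := R) X → pull (pull X f) g w = X w := by
    intro X hX
    rw [pull_pull hX hf.nil, funext hfg, pull_idOp hX]
  rw [← key hX, ← key hY]
  exact pull_congr (fun v hv => h v ((Nat.cast_le.2 hv).trans hw)) fun _ _ _ => rfl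

variable (he : ∀ v, e v ∈ 𝒜 0)
include he

/-- The structure `m'` is a fixed point of `m' ↦ f D_m + m' - m' α_f`. This is contracting, since
`m' - m' α_f` on a word only sees `m'` on shorter words. All conditions are preserved, normalization
by `insert_eq_pull_unit`; the `A_∞`-identity plays no role. -/
theorem IsAnWord.exists_transform {f m : List A → A} (hf : IsGaugeWord 𝒜 e f)
    (hm : IsAnWord 𝒜 e m) : ∃ m', IsAnWord 𝒜 e m' ∧
      ∀ w, sandwich (koszul 𝒜) m idOp w f = AInf.pull m' f w := by
  have hfm : IsMultilin (R := R) fun w => sandwich (koszul 𝒜) m idOp w f :=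
    sandwich_isMultilin (koszul 𝒜) hf.multilin hm.multilin hm.nil idOp_isMultilin rfl
  obtain ⟨m', hm', h⟩ := exists_fixed_word (P := IsAnWord 𝒜 e)
    (Φ := fun m' w => sandwich (koszul 𝒜) m idOp w f + m' w - AInf.pull m' f w)
    (fun m₁ m₂ w h₁ h₂ h => by
      have h3 := sandwich_congr_of_lt h₁.multilin h₂.multilin (c := fun w => f w - idOp w)
        (fun a => by rw [hf.one]; exact sub_self a) id f w h
      simp only [pull_eq_add_sandwich h₁.multilin hf.nil, pull_eq_add_sandwich h₂.multilin hf.nil,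
        h3]
      abel)
    (fun m' hm' => by
      refine ⟨(hfm.addFun hm'.multilin).sub (pull_isMultilin hm'.multilin hf.multilin hf.nil),
        fun w hw => ?_, ?_, fun v => ?_, fun v u x h => ?_⟩
      · match w, hw with
        | [], _ => simp [hm'.nil, prodOp]
        | [a], _ =>
          have := hf.multilin.zero_letter [] []
          simp only [List.nil_append] at this
          simp [sandwich_cons, splitSum_nil, pull_cons, hm'.one, hm.one, this, prodOp]
        | [a, b], _ =>
          have h1 := fun b => hf.multilin.zero_letter [] [b]
          have h2 := fun a => hf.multilin.zero_letter [a] []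
          simp only [List.nil_append, List.cons_append] at h1 h2
          simp [sandwich_cons, splitSum_nil, splitSum_cons, pull_cons, hm'.one, hm.one, h1, h2,
            hf.one, idOp, hm.low [a, b] (by simp)]
      · have h1 := hf.degree.sandwich hm.degree (hasDegree_idOp (𝒜 := 𝒜))
        norm_num at h1
        exact (h1.add hm'.degree).sub (hm'.degree.pull hf.degree)
      · exact (((hf.elinear v).sandwich (mul_koszul 𝒜 (he v)) (koszul_mul 𝒜 (he v))
          (hm.elinear v) eLinear_idOp).add (hm'.elinear v)).sub ((hm'.elinear v).pull (hf.elinear v))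
      · rw [insert_eq_pull_unit (he v) hm.low (hm.normalized v) hm'.low (hm'.normalized v)
          hm'.multilin hf.multilin hf.nil (hf.one _) (hf.normalized v) (hf.elinear v) hf.even u x
          (by omega), hm'.normalized v u x h]
        abel)
    (fun g hg => .of_local hg) hm
  refine ⟨m', hm', fun w => ?_⟩
  have h1 := h w
  rw [add_sub_right_comm] at h1
  exact sub_eq_zero.1 (by simpa using h1)

omit he in
theorem sandwich_pull_of_transforms {n : ℕ∞} {f m m' : List A → A} (hf : IsGaugeWord 𝒜 e f)
    (hm' : IsAnWord 𝒜 e m') (H : WTransforms 𝒜 n f m m') {X : List A → A}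
    (hX : IsMultilin (R := R) X) (w : List A) (hw : (w.length : ℕ∞) ≤ n) :
    sandwich (koszul 𝒜) m idOp w (AInf.pull X f) =
      AInf.pull (fun t => sandwich (koszul 𝒜) m' idOp t X) f w :=
  sandwich_pull (koszul 𝒜) hf.multilin hf.nil hf.even hm'.nil (n := w.length)
    (fun v hv => H v ((Nat.cast_le.2 hv).trans hw)) hX w le_rfl

-- From `α_f D_m = D_{m'} α_f` follows `D_{m'} D_{m'} α_f = α_f D_m D_m = 0`, and composition with
-- `α_f` is injective.
omit he in
theorem WIdentity.transforms {n : ℕ∞} {f m m' : List A → A} (hf : IsGaugeWord 𝒜 e f)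
    (hm : IsAnWord 𝒜 e m) (hm' : IsAnWord 𝒜 e m') (H : WTransforms 𝒜 n f m m')
    (hid : WIdentity 𝒜 n m) : WIdentity 𝒜 n m' := by
  intro w hw
  refine pull_injective hf (sandwich_isMultilin (koszul 𝒜) hm'.multilin hm'.multilin hm'.nil
    idOp_isMultilin rfl) (Y := fun _ => 0) .zeroFun (fun w hw => ?_) w hw
  rw [pull_zero, ← sandwich_pull_of_transforms hf hm' H hm'.multilin w hw,
    ← sandwich_sandwich (koszul_koszul 𝒜) hm.multilin hm.nil hm.odd (n := w.length)
      (fun v hv => hid v ((Nat.cast_le.2 hv).trans hw)) hf.multilin w le_rfl]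
  exact sandwich_congr (fun v hv => (H v ((Nat.cast_le.2 hv).trans hw)).symm) (fun _ _ _ => rfl)
    fun _ _ _ => rfl

omit he in
theorem WTransforms.comp {n : ℕ∞} {f g m m' m'' : List A → A} (hf : IsGaugeWord 𝒜 e f)
    (hg : IsGaugeWord 𝒜 e g) (hm' : IsAnWord 𝒜 e m') (hm'' : IsAnWord 𝒜 e m'')
    (Hg : WTransforms 𝒜 n g m m') (Hf : WTransforms 𝒜 n f m' m'') :
    WTransforms 𝒜 n (AInf.pull f g) m m'' := by
  intro w hw
  rw [sandwich_pull_of_transforms hg hm' Hg hf.multilin w hw, ← pull_pull hm''.multilin hf.nil]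
  exact pull_congr (fun v hv => Hf v ((Nat.cast_le.2 hv).trans hw)) fun _ _ _ => rfl

-- As `m` and `m'` vanish on letters, the component of `f` in arity `n` does not enter the equation
-- up to length `n`. This is why the gauge group of `A_n`-structures stops at arity `n - 1`.
omit he in
theorem WTransforms.congr {n : ℕ∞} {f f' m m' : List A → A} (hf : IsGaugeWord 𝒜 e f)
    (hf' : IsGaugeWord 𝒜 e f') (hm : IsAnWord 𝒜 e m) (hm' : IsAnWord 𝒜 e m')
    (h : ∀ w : List A, (w.length : ℕ∞) < n → f w = f' w) (H : WTransforms 𝒜 n f m m') :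
    WTransforms 𝒜 n f' m m' := by
  intro w hw
  have h' : ∀ v : List A, v.length < w.length → f v = f' v := fun v hv =>
    h v ((Nat.cast_lt.2 hv).trans_le hw)
  rw [← sandwich_congr_of_lt hf.multilin hf'.multilin hm.one _ _ w h', H w hw]
  exact pull_congr_of_lt hm'.one fun v _ hv => h' v hv

omit he in
theorem WTransforms.unique {n : ℕ∞} {f m m' m'' : List A → A} (hf : IsGaugeWord 𝒜 e f)
    (hm' : IsAnWord 𝒜 e m') (hm'' : IsAnWord 𝒜 e m'') (H : WTransforms 𝒜 n f m m')
    (H' : WTransforms 𝒜 n f m m'') (w : List A) (hw : (w.length : ℕ∞) ≤ n) : m' w = m'' w :=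
  pull_injective hf hm'.multilin hm''.multilin (fun w hw => (H w hw).symm.trans (H' w hw)) w hw

omit he in
theorem WTransforms.congr_right {n : ℕ∞} {f m m₁ m₂ : List A → A}
    (h : ∀ w : List A, (w.length : ℕ∞) ≤ n → m₁ w = m₂ w)
    (H : WTransforms 𝒜 n f m m₁) : WTransforms 𝒜 n f m m₂ := fun w hw =>
  (H w hw).trans (pull_congr (fun v hv => h v ((Nat.cast_le.2 hv).trans hw)) fun _ _ _ => rfl)

omit he in
theorem WTransforms.refl (n : ℕ∞) {m : List A → A} (hm : IsAnWord 𝒜 e m) :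
    WTransforms 𝒜 n idOp m m := fun w _ => by
  rw [sandwich_idOp_left _ hm.nil, pull_idOp hm.multilin]

/-- The gauge transformation `u = id + [D_m, H]` given by an element `h` of `CH^0`. -/
theorem IsAnWord.exists_homotopy {m h : List A → A} (hm : IsAnWord 𝒜 e m)
    (hh : IsHomotopyWord 𝒜 e h) : ∃ u, IsGaugeWord 𝒜 e u ∧
      (∀ w, u w = idOp w + (sandwich (koszul 𝒜) h u w m + sandwich (koszul 𝒜) m idOp w h)) ∧
      ∀ n : ℕ∞, WIdentity 𝒜 n m → WTransforms 𝒜 n u m m := by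
  have hhm : IsMultilin (R := R) fun w => sandwich (koszul 𝒜) m idOp w h :=
    sandwich_isMultilin (koszul 𝒜) hh.multilin hm.multilin hm.nil idOp_isMultilin rfl
  obtain ⟨u, hu, hfix⟩ := exists_fixed_word (P := IsGaugeWord 𝒜 e)
    (Φ := fun u w => idOp w + (sandwich (koszul 𝒜) h u w m + sandwich (koszul 𝒜) m idOp w h))
    -- The insertion of `h` takes a letter, so `u` enters only on shorter words and the equation is
    -- contracting.
    (fun u u' w _ _ h => by
      congr 2
      exact sandwich_congr (fun _ _ => rfl) (fun _ _ _ => rfl) fun v _ hv => h v hv)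
    (fun u hu => by
      refine ⟨idOp_isMultilin.addFun ((sandwich_isMultilin (koszul 𝒜) hm.multilin hh.multilin
        hh.nil hu.multilin hu.nil).addFun hhm), fun w hw => ?_, ?_, fun v => ?_, fun v p x hp => ?_⟩
      · match w, hw with
        | [], _ => simp
        | [a], _ =>
          have := hh.multilin.zero_letter [] []
          simp only [List.nil_append] at this
          simp [sandwich_cons, splitSum_nil, hm.one, this]
      · have h1 := hh.degree.sandwich hm.degree (hasDegree_idOp (𝒜 := 𝒜))
        have h2 := hm.degree.sandwich hh.degree hu.degree
        norm_num at h1 h2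
        exact hasDegree_idOp.add (h2.add h1)
      · exact eLinear_idOp.add (((hm.elinear v).sandwich (mul_koszul 𝒜 (he v))
          (koszul_mul 𝒜 (he v)) (hh.elinear v) (hu.elinear v)).add ((hh.elinear v).sandwich
          (mul_koszul 𝒜 (he v)) (koszul_mul 𝒜 (he v)) (hm.elinear v) eLinear_idOp))
      · rw [sandwich_unit_of_homotopy (he v) hm.low (hm.normalized v) hm.multilin hh.multilin
          hh.nil (hh.normalized v) (hh.elinear v) hh.odd (hu.one _) (hu.normalized v),
          normalized_idOp _ p x hp, add_zero])
    (fun g hg => .of_local hg) isGaugeWord_idOp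
  refine ⟨u, hu, fun w => (hfix w).symm, fun n hid w hw => ?_⟩
  exact sandwich_of_homotopy (koszul_koszul 𝒜) hm.multilin hm.nil hm.odd hh.multilin hh.nil hh.odd
    hu.multilin hu.nil (fun w => (hfix w).symm) (n := w.length)
    (fun v hv => hid v ((Nat.cast_le.2 hv).trans hw)) w le_rfl

end WordTypes

/-! ### The gauge group and its action -/

section GaugeAction

variable {R A : Type*} [CommRing R] [Ring A] [Algebra R A] {𝒜 : ℤ → Submodule R A}
  [GradedAlgebra 𝒜] {V : Type*} {e : V → A}

theorem IsCochain.hasDegree {d : ℤ} {q : ℕ} {c : Ops R A} (hc : IsCochain 𝒜 e d q c)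
    {X : List A → A} (h : ∀ w : List A, w.length < q → c.ev w = X w) (hX : HasDegree 𝒜 d X) :
    HasDegree 𝒜 d c.ev := by
  intro w n hw
  rcases lt_or_ge w.length q with hq | hq
  · rw [h w hq]; exact hX w n hw
  · obtain ⟨ds, h1, h2⟩ := hw.exists_forall₂
    convert hc.degree w ds hq h1 using 2
    rw [← h2]; ring

theorem IsCochain.eLinear {d : ℤ} {q : ℕ} {c : Ops R A} (hc : IsCochain 𝒜 e d q c)
    {X : List A → A} (h : ∀ w : List A, w.length < q → c.ev w = X w) (v : V)
    (hX : ELinear (e v) X) : ELinear (e v) c.ev where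
  balanced u x y w := by
    rcases lt_or_ge (u ++ x :: y :: w).length q with hq | hq
    · rw [h _ (by simpa using hq), h _ (by simpa using hq), hX.balanced]
    · exact hc.balanced v u x y w hq
  left x w := by
    rcases lt_or_ge (x :: w).length q with hq | hq
    · rw [h _ (by simpa using hq), h _ (by simpa using hq), hX.left]
    · exact hc.left v x w hq
  right u x := by
    rcases lt_or_ge (u ++ [x]).length q with hq | hq
    · rw [h _ (by simpa using hq), h _ (by simpa using hq), hX.right]
    · exact hc.right v u x hq

theorem isCochain_of_word {d : ℤ} {q : ℕ} {c : Ops R A} (h1 : HasDegree 𝒜 d c.ev)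
    (h2 : ∀ v, ELinear (e v) c.ev) (h3 : ∀ v, Normalized (e v) q c.ev) : IsCochain 𝒜 e d q c where
  degree w ds _ hw := by
    convert h1 w _ (homWord_of_forall₂ 𝒜 hw) using 2
    ring
  balanced v u x y w _ := (h2 v).balanced u x y w
  left v x w _ := (h2 v).left x w
  right v u x _ := (h2 v).right u x
  normalized v u w h := h3 v u w h

theorem Gauge.isGaugeWord {n : ℕ∞} (f : Gauge 𝒜 e n) : IsGaugeWord 𝒜 e f.op.ev where
  multilin := f.op.isMultilin
  low := f.low
  degree := f.cochain.hasDegree (fun w hw => f.low w (by omega)) hasDegree_idOp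
  elinear v := f.cochain.eLinear (fun w hw => f.low w (by omega)) v eLinear_idOp
  normalized v u w h := f.cochain.normalized v u w h

/-- The truncated gauge transformation with a given component. -/
noncomputable def Gauge.ofWord (n : ℕ∞) (f : List A → A) (hf : IsGaugeWord 𝒜 e f) : Gauge 𝒜 e n where
  op := (Ops.ofWord f hf.multilin).discard fun p => 2 ≤ p ∧ n ≤ p
  low w hw := by rw [Ops.discard_ev _ _ (by omega), Ops.ofWord_ev, hf.low w hw]
  cochain := by
    have h : (Ops.ofWord f hf.multilin).ev = f := funext fun w => Ops.ofWord_ev f hf.multilin w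
    exact (isCochain_of_word (by rw [h]; exact hf.degree) (fun v => by rw [h]; exact hf.elinear v)
      (fun v => by rw [h]; exact hf.normalized v)).discard _
  truncated p hp hn := by simp [Ops.discard, hp, hn]

theorem Gauge.ofWord_ev {n : ℕ∞} {f : List A → A} (hf : IsGaugeWord 𝒜 e f) {w : List A}
    (hw : (w.length : ℕ∞) < n) : (Gauge.ofWord n f hf).op.ev w = f w := by
  rw [← Ops.ofWord_ev f hf.multilin w]
  exact Ops.discard_ev _ _ fun h => absurd hw (not_lt.2 h.2)

theorem Gauge.ext_ev {n : ℕ∞} {f g : Gauge 𝒜 e n}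
    (h : ∀ w : List A, (w.length : ℕ∞) < n → f.op.ev w = g.op.ev w) : f = g := by
  refine Gauge.ext (Ops.ext_ev fun w => ?_)
  by_cases h1 : (w.length : ℕ∞) < n
  · exact h w h1
  · rcases Nat.lt_or_ge w.length 2 with h2 | h2
    · rw [f.low w (by omega), g.low w (by omega)]
    · rw [Ops.ev, Ops.ev, f.truncated _ h2 (not_lt.1 h1), g.truncated _ h2 (not_lt.1 h1)]

/-- Arities at least `n` are discarded after composing. This is compatible with the group laws
because `pull` on a word only evaluates its arguments on words that are not longer. -/
noncomputable instance (n : ℕ∞) : Mul (Gauge 𝒜 e n) :=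
  ⟨fun f g => .ofWord n (pull f.op.ev g.op.ev) (f.isGaugeWord.pull g.isGaugeWord)⟩

noncomputable instance (n : ℕ∞) : One (Gauge 𝒜 e n) := ⟨.ofWord n idOp isGaugeWord_idOp⟩

noncomputable instance (n : ℕ∞) : Inv (Gauge 𝒜 e n) :=
  ⟨fun f => .ofWord n _ f.isGaugeWord.exists_inverse.choose_spec.1⟩

theorem Gauge.mul_ev {n : ℕ∞} (f g : Gauge 𝒜 e n) {w : List A} (hw : (w.length : ℕ∞) < n) :
    (f * g).op.ev w = pull f.op.ev g.op.ev w := Gauge.ofWord_ev _ hw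

theorem Gauge.one_ev {n : ℕ∞} {w : List A} (hw : (w.length : ℕ∞) < n) :
    (1 : Gauge 𝒜 e n).op.ev w = idOp w := Gauge.ofWord_ev _ hw

noncomputable instance (n : ℕ∞) : Group (Gauge 𝒜 e n) :=
  Group.ofRightAxioms
    (fun f g h => Gauge.ext_ev fun w hw => by
      rw [Gauge.mul_ev _ _ hw, Gauge.mul_ev _ _ hw]
      have h1 : ∀ v : List A, v.length ≤ w.length → (f * g).op.ev v = pull f.op.ev g.op.ev v :=
        fun v hv => Gauge.mul_ev _ _ ((Nat.cast_le.2 hv).trans_lt hw)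
      have h2 : ∀ v : List A, v.length ≤ w.length → (g * h).op.ev v = pull g.op.ev h.op.ev v :=
        fun v hv => Gauge.mul_ev _ _ ((Nat.cast_le.2 hv).trans_lt hw)
      rw [pull_congr h1 fun _ _ _ => rfl, pull_congr (fun _ _ => rfl) fun v _ hv => h2 v hv,
        pull_pull f.op.isMultilin g.isGaugeWord.nil])
    (fun f => Gauge.ext_ev fun w hw => by
      rw [Gauge.mul_ev _ _ hw, pull_congr (fun _ _ => rfl) fun v _ hv =>
        Gauge.one_ev ((Nat.cast_le.2 hv).trans_lt hw), pull_idOp f.op.isMultilin])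
    (fun f => Gauge.ext_ev fun w hw => by
      rw [Gauge.mul_ev _ _ hw, Gauge.one_ev hw, ← f.isGaugeWord.exists_inverse.choose_spec.2 w]
      exact pull_congr (fun _ _ => rfl) fun v _ hv =>
        Gauge.ofWord_ev _ ((Nat.cast_le.2 hv).trans_lt hw))

theorem AnStructure.isAnWord (he : ∀ v, e v ∈ 𝒜 0) {n : ℕ∞} (m : AnStructure 𝒜 e n) :
    IsAnWord 𝒜 e m.op.ev where
  multilin := m.op.isMultilin
  low := m.low
  degree := m.cochain.hasDegree (fun w hw => m.low w (by omega)) (hasDegree_prodOp 𝒜)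
  elinear v := m.cochain.eLinear (fun w hw => m.low w (by omega)) v (eLinear_prodOp 𝒜 (he v))
  normalized v u w h := m.cochain.normalized v u w h

theorem AnStructure.wIdentity {n : ℕ∞} (m : AnStructure 𝒜 e n) : WIdentity 𝒜 n m.op.ev :=
  fun w hw => by rw [← insertSum_eq_sandwich _ m.op.isMultilin]; exact m.identity w hw

/-- The truncation of an `A_∞`-structure given by a function of words. -/
noncomputable def AnStructure.ofWord (n : ℕ∞) (m : List A → A) (hm : IsAnWord 𝒜 e m)
    (hid : WIdentity 𝒜 n m) : AnStructure 𝒜 e n where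
  op := (Ops.ofWord m hm.multilin).discard fun p => 3 ≤ p ∧ n < p
  low w hw := by rw [Ops.discard_ev _ _ (by omega), Ops.ofWord_ev, hm.low w hw]
  cochain := by
    have h : (Ops.ofWord m hm.multilin).ev = m := funext fun w => Ops.ofWord_ev m hm.multilin w
    exact (isCochain_of_word (by rw [h]; exact hm.degree) (fun v => by rw [h]; exact hm.elinear v)
      (fun v => by rw [h]; exact hm.normalized v)).discard _
  truncated p hp hn := by simp [Ops.discard, hp, hn]
  identity w hw := by
    have h1 : ∀ v : List A, v.length ≤ w.length →
        ((Ops.ofWord m hm.multilin).discard fun p => 3 ≤ p ∧ n < p).ev v = m v := fun v hv => by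
      rw [Ops.discard_ev _ _ fun h => absurd h.2 (not_lt.2 ((Nat.cast_le.2 hv).trans hw)),
        Ops.ofWord_ev]
    rw [insertSum_congr h1 h1, insertSum_eq_sandwich _ hm.multilin]
    exact hid w hw

theorem AnStructure.ofWord_ev {n : ℕ∞} {m : List A → A} (hm : IsAnWord 𝒜 e m)
    (hid : WIdentity 𝒜 n m) {w : List A} (hw : (w.length : ℕ∞) ≤ n) :
    (AnStructure.ofWord n m hm hid).op.ev w = m w := by
  rw [← Ops.ofWord_ev m hm.multilin w]
  exact Ops.discard_ev _ _ fun h => absurd hw (not_le.2 h.2)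

theorem AnStructure.ext_ev {n : ℕ∞} {f g : AnStructure 𝒜 e n}
    (h : ∀ w : List A, (w.length : ℕ∞) ≤ n → f.op.ev w = g.op.ev w) : f = g := by
  refine AnStructure.ext (Ops.ext_ev fun w => ?_)
  by_cases h1 : (w.length : ℕ∞) ≤ n
  · exact h w h1
  · rcases Nat.lt_or_ge w.length 3 with h2 | h2
    · rw [f.low w (by omega), g.low w (by omega)]
    · rw [Ops.ev, Ops.ev, f.truncated _ h2 (not_le.1 h1), g.truncated _ h2 (not_le.1 h1)]

theorem transforms_iff {n : ℕ∞} {f m m' : Ops R A} :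
    Transforms 𝒜 n f m m' ↔ WTransforms 𝒜 n f.ev m.ev m'.ev := by
  refine forall₂_congr fun w _ => ?_
  rw [insertSum_eq_sandwich _ f.isMultilin]
  rfl

theorem AnStructure.exists_smul (he : ∀ v, e v ∈ 𝒜 0) {n : ℕ∞} (f : Gauge 𝒜 e n)
    (m : AnStructure 𝒜 e n) :
    ∃ m' : AnStructure 𝒜 e n, WTransforms 𝒜 n f.op.ev m.op.ev m'.op.ev := by
  obtain ⟨m', hm', H⟩ := (m.isAnWord he).exists_transform he f.isGaugeWord
  have hid : WIdentity 𝒜 n m' :=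
    m.wIdentity.transforms f.isGaugeWord (m.isAnWord he) hm' fun w _ => H w
  exact ⟨.ofWord n m' hm' hid, WTransforms.congr_right
    (fun w hw => (AnStructure.ofWord_ev hm' hid hw).symm) fun w _ => H w⟩

/-- As the intertwining relation determines `f * m`, the axioms of an action reduce to that relation
for the identity and for composites. -/
theorem AnStructure.eq_of_transforms (he : ∀ v, e v ∈ 𝒜 0) {n : ℕ∞} {f : Gauge 𝒜 e n}
    {m : List A → A} {m₁ m₂ : AnStructure 𝒜 e n}
    (h₁ : WTransforms 𝒜 n f.op.ev m m₁.op.ev)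
    (h₂ : WTransforms 𝒜 n f.op.ev m m₂.op.ev) : m₁ = m₂ :=
  AnStructure.ext_ev (h₁.unique f.isGaugeWord (m₁.isAnWord he) (m₂.isAnWord he) h₂)

/-- The action of gauge transformations on `A_n`-structures. -/
@[reducible] noncomputable def gaugeAction (he : ∀ v, e v ∈ 𝒜 0) (n : ℕ∞) :
    MulAction (Gauge 𝒜 e n) (AnStructure 𝒜 e n) where
  smul f m := (m.exists_smul he f).choose
  one_smul m := by
    refine AnStructure.eq_of_transforms he (f := 1) (m := m.op.ev)
      (m.exists_smul he 1).choose_spec ?_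
    exact (WTransforms.refl n (m.isAnWord he)).congr isGaugeWord_idOp (Gauge.isGaugeWord _)
      (m.isAnWord he) (m.isAnWord he) fun w hw => (Gauge.one_ev hw).symm
  mul_smul f g m := by
    refine AnStructure.eq_of_transforms he (f := f * g) (m := m.op.ev)
      (m.exists_smul he (f * g)).choose_spec ?_
    have h1 := (m.exists_smul he g).choose_spec
    have h2 := ((m.exists_smul he g).choose.exists_smul he f).choose_spec
    exact (h1.comp f.isGaugeWord g.isGaugeWord (AnStructure.isAnWord he _)
      (AnStructure.isAnWord he _) h2).congr (f.isGaugeWord.pull g.isGaugeWord)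
      (Gauge.isGaugeWord _) (m.isAnWord he) (AnStructure.isAnWord he _)
      fun w hw => (Gauge.mul_ev f g hw).symm

end GaugeAction

end AInf

namespace AInf

/-! ### The lowest-order term of the gauge action -/

section FirstOrder

variable {R A B : Type*} [CommRing R] [Ring A] [Algebra R A] [AddCommGroup B] [Module R B]

theorem sandwich_idOp_congr {θ : A → A} {c c' : List A → A} {w : List A} {X X' : List A → B}
    (hX : IsMultilin (R := R) X) (hX' : IsMultilin (R := R) X')
    (h : ∀ p v q, p ++ v ++ q = w → v ≠ [] →
      X (p.map θ ++ c v :: q) = X' (p.map θ ++ c' v :: q)) :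
    sandwich θ c idOp w X = sandwich θ c' idOp w X' := by
  induction w generalizing X X' with
  | nil => rfl
  | cons a w ih =>
    rw [sandwich_cons, sandwich_cons]
    congr 1
    · refine splitSum_congr fun v x hvx => ?_
      rw [pull_idOp (hX.tail _), pull_idOp (hX'.tail _)]
      exact h [] (a :: v) x (by simp [hvx]) (by simp)
    · exact ih (hX.tail _) (hX'.tail _) fun p v q hp hv => h (a :: p) v q (by simp [← hp]) hv

/-- If `c` needs at least `q` letters, then at most `|w| - q` letters remain for the blocks of `u`,
and `X` receives one more argument, the value of `c`. -/
theorem sandwich_congr_of_vanish {θ : A → A} {c u u' : List A → A} {w : List A} {q : ℕ}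
    {X X' : List A → B} (hX : IsMultilin (R := R) X) (hX' : IsMultilin (R := R) X')
    (hc : ∀ v : List A, v.length < q → c v = 0)
    (h : ∀ v : List A, v.length + q ≤ w.length + 1 → X v = X' v)
    (hu : ∀ v : List A, v ≠ [] → v.length + q ≤ w.length → u v = u' v) :
    sandwich θ c u w X = sandwich θ c u' w X' := by
  induction w generalizing X X' with
  | nil => rfl
  | cons a w ih =>
    rw [sandwich_cons, sandwich_cons]
    congr 1
    · refine splitSum_congr fun v x hvx => ?_
      subst hvx
      by_cases hq : (a :: v).length < q
      · have h1 := fun t => hX.zero_letter [] t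
        have h2 := fun t => hX'.zero_letter [] t
        simp only [List.nil_append] at h1 h2
        simp only [hc _ hq, h1, h2, pull_zero]
      · refine pull_congr (fun t ht => h _ ?_) fun t ht0 ht => hu t ht0 ?_
        · simp at hq ⊢; omega
        · simp at hq ⊢; omega
    · refine ih (hX.tail _) (hX'.tail _) (fun v hv => h _ ?_) fun v h0 hv => hu v h0 ?_
      · simp; omega
      · simp; omega

variable (𝒜 : ℤ → Submodule R A) [GradedAlgebra 𝒜]

/-- The Hochschild differential `[m₂, φ]` of an even cochain. -/
noncomputable def hochschild (φ : List A → A) (w : List A) : A :=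
  insertSum id (prodOp 𝒜) φ w - insertSum (koszul 𝒜) φ (prodOp 𝒜) w

variable {𝒜}

theorem insertSum_idOp_congr {θ : A → A} {b b' c c' : List A → A} {w : List A}
    (h : ∀ p v q, p ++ v ++ q = w → v ≠ [] →
      b (p.map θ ++ c v :: q) = b' (p.map θ ++ c' v :: q)) :
    insertSum θ b c w = insertSum θ b' c' w := by
  refine Finset.sum_congr rfl fun r hr => Finset.sum_congr rfl fun s hs => ?_
  simp only [Finset.mem_range, Finset.mem_Icc] at hr hs
  refine h _ _ _ ?_ ?_
  · rw [List.append_assoc, ← List.drop_drop, List.take_append_drop, List.take_append_drop]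
  · refine List.ne_nil_of_length_pos ?_
    simp; omega

theorem prodOp_eq_zero {w : List A} (h : w.length ≠ 2) : prodOp 𝒜 w = 0 := by
  match w, h with
  | [], _ => rfl
  | [_], _ => rfl
  | _ :: _ :: _ :: _, _ => rfl
  | [_, _], h => simp at h

theorem idOp_eq_zero {w : List A} (h : w.length ≠ 1) : idOp w = 0 := by
  match w, h with
  | [], _ => rfl
  | _ :: _ :: _, _ => rfl
  | [_], h => simp at h

theorem insertSum_prodOp_congr {θ : A → A} {φ φ' : List A → A} {w : List A}
    (h : ∀ v : List A, v.length + 1 = w.length → φ v = φ' v) :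
    insertSum θ (prodOp 𝒜) φ w = insertSum θ (prodOp 𝒜) φ' w := by
  refine insertSum_idOp_congr fun p v q hw hv => ?_
  subst hw
  by_cases h1 : p.length + q.length = 1
  · rw [h v (by simp; omega)]
  · rw [prodOp_eq_zero, prodOp_eq_zero] <;> (simp; omega)

theorem insertSum_prodOp_congr' {θ : A → A} {φ φ' : List A → A} {w : List A}
    (hφ : IsMultilin (R := R) φ) (hφ' : IsMultilin (R := R) φ')
    (h : ∀ v : List A, v.length + 1 = w.length → φ v = φ' v) :
    insertSum θ φ (prodOp 𝒜) w = insertSum θ φ' (prodOp 𝒜) w := by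
  refine insertSum_idOp_congr fun p v q hw hv => ?_
  subst hw
  by_cases h1 : v.length = 2
  · exact h _ (by simp; omega)
  · rw [prodOp_eq_zero h1, hφ.zero_letter, hφ'.zero_letter]

theorem hochschild_congr {φ φ' : List A → A} {w : List A}
    (hφ : IsMultilin (R := R) φ) (hφ' : IsMultilin (R := R) φ')
    (h : ∀ v : List A, v.length + 1 = w.length → φ v = φ' v) :
    hochschild 𝒜 φ w = hochschild 𝒜 φ' w := by
  rw [hochschild, hochschild, insertSum_prodOp_congr h, insertSum_prodOp_congr' hφ hφ' h]

theorem hochschild_eq_sandwich {φ : List A → A} (hφ : IsMultilin (R := R) φ) (w : List A) :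
    hochschild 𝒜 φ w = sandwich id φ idOp w (prodOp 𝒜) -
      sandwich (koszul 𝒜) (prodOp 𝒜) idOp w φ := by
  rw [hochschild, insertSum_eq_sandwich _ (prodOp_isMultilin 𝒜), insertSum_eq_sandwich _ hφ]

theorem hochschild_zero (w : List A) : hochschild 𝒜 (fun _ => (0 : A)) w = 0 := by
  rw [hochschild_eq_sandwich .zeroFun, sandwich_zero, sub_zero,
    sandwich_idOp_congr (prodOp_isMultilin 𝒜) (X' := fun _ => 0) .zeroFun
      (c' := fun _ => 0) fun p v q _ _ => (prodOp_isMultilin 𝒜).zero_letter _ _, sandwich_zero]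

variable {V : Type*} {e : V → A}

/-- The equation `f * m = m'` in lowest order. -/
theorem first_order {f m m' : List A → A} (hf : IsGaugeWord 𝒜 e f) (hm : IsAnWord 𝒜 e m)
    (hm' : IsAnWord 𝒜 e m') {w : List A}
    (hφ : ∀ v : List A, v.length + 1 < w.length → f v = idOp v)
    (H : sandwich (koszul 𝒜) m idOp w f = pull m' f w) :
    m' w = m w - hochschild 𝒜 (fun v => f v - idOp v) w := by
  have hφm : IsMultilin (R := R) fun v => f v - idOp v := hf.multilin.sub idOp_isMultilin
  have hφ0 : ∀ v : List A, v.length < w.length - 1 → f v - idOp v = 0 := fun v hv => by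
    rw [hφ v (by omega), sub_self]
  -- Since `f - id` vanishes on words shorter than `|w| - 1`, the operation inserted into it has
  -- arity at most two, hence is the product.
  have h1 : sandwich (koszul 𝒜) m idOp w f =
      m w + sandwich (koszul 𝒜) (prodOp 𝒜) idOp w (fun v => f v - idOp v) := by
    rw [← sandwich_idOp_congr (c := m) hφm hφm, sandwich_sub, sandwich_idOp_left _ hm.nil]
    · abel
    · intro p v q hw hv
      subst hw
      by_cases h2 : v.length ≤ 2
      · rw [hm.low v h2]
      · simp only [hφ0 _ (show (p.map (koszul 𝒜) ++ m v :: q).length < _ by simp; omega),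
          hφ0 _ (show (p.map (koszul 𝒜) ++ prodOp 𝒜 v :: q).length < _ by simp; omega)]
  -- A block of at least `|w| - 1` letters leaves a word of length at most two for `m'` and blocks
  -- of at most one letter for `f`.
  have h2 : pull m' f w = m' w + sandwich id (fun v => f v - idOp v) idOp w (prodOp 𝒜) := by
    rw [pull_eq_add_sandwich hm'.multilin hf.nil]
    congr 1
    refine sandwich_congr_of_vanish (q := w.length - 1) hm'.multilin (prodOp_isMultilin 𝒜) hφ0
      (fun v hv => ?_) fun v hv0 hv => ?_
    · rcases le_or_gt v.length 2 with h | h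
      · exact hm'.low v h
      · omega
    · rcases le_or_gt v.length 1 with h | h
      · exact hf.low v h
      · omega
  rw [hochschild_eq_sandwich hφm]
  rw [h1, h2] at H
  rw [← eq_sub_iff_add_eq] at H
  rw [H]; abel

end FirstOrder

/-! ### Straightening gauge transformations by vanishing of `HH^1` -/

section Straighten

variable {R A : Type*} [CommRing R] [Ring A] [Algebra R A] {𝒜 : ℤ → Submodule R A}
  [GradedAlgebra 𝒜] {V : Type*} {e : V → A} (he : ∀ v, e v ∈ 𝒜 0)

/-- The component of arity `q` of a gauge transformation. -/
noncomputable def IsGaugeWord.component {f : List A → A} (hf : IsGaugeWord 𝒜 e f) (q : ℕ) :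
    Ops R A := (Ops.ofWord f hf.multilin).discard (· ≠ q)

theorem IsGaugeWord.component_ev {f : List A → A} (hf : IsGaugeWord 𝒜 e f) {q : ℕ} {w : List A}
    (h : w.length = q) : (hf.component q).ev w = f w :=
  (Ops.discard_ev (· ≠ q) _ (not_not.2 h)).trans (Ops.ofWord_ev f hf.multilin w)

theorem IsGaugeWord.component_ev_zero {f : List A → A} (hf : IsGaugeWord 𝒜 e f) {q : ℕ}
    {w : List A} (h : w.length ≠ q) : (hf.component q).ev w = 0 :=
  Ops.discard_ev_zero (· ≠ q) _ h

theorem IsGaugeWord.component_isCochain {f : List A → A} (hf : IsGaugeWord 𝒜 e f) {q : ℕ}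
    (hq : 2 ≤ q) : IsCochain 𝒜 e 1 1 (hf.component q) := by
  have h : (Ops.ofWord f hf.multilin).ev = f := funext fun w => Ops.ofWord_ev f hf.multilin w
  have h2 : IsCochain 𝒜 e 1 2 (hf.component q) :=
    (isCochain_of_word (by rw [h]; exact hf.degree) (fun v => by rw [h]; exact hf.elinear v)
      (fun v => by rw [h]; exact hf.normalized v)).discard _
  have h0 : ∀ w : List A, w.length < 2 → (hf.component q).ev w = (fun _ => 0) w := fun w hw =>
    hf.component_ev_zero (by omega)
  refine isCochain_of_word (h2.hasDegree h0 fun _ _ _ => Submodule.zero_mem _)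
    (fun v => h2.eLinear h0 v ⟨fun _ _ _ _ => rfl, fun _ _ => by simp, fun _ _ => by simp⟩)
    fun v u w h => ?_
  by_cases h1 : 2 ≤ (u ++ e v :: w).length
  · exact h2.normalized v u w h1
  · exact h0 _ (by omega)

theorem isHomotopyWord_neg {i : ℕ} (hi : 1 ≤ i) {h : Ops R A} (h0 : ∀ p, p ≠ i → h p = 0)
    (hc : IsCochain 𝒜 e 0 1 h) : IsHomotopyWord 𝒜 e fun w => -h.ev w := by
  have hnil : ∀ w : List A, w.length < 1 → h.ev w = (fun _ => 0) w := fun w hw => by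
    rw [Ops.ev, h0 _ (by omega)]; rfl
  have hz : IsMultilin (R := R) fun _ : List A => (0 : A) := .zeroFun
  have hd : HasDegree 𝒜 0 (fun _ : List A => (0 : A)) := fun _ _ _ => Submodule.zero_mem _
  have hl : ∀ v, ELinear (e v) (fun _ : List A => (0 : A)) := fun v =>
    ⟨fun _ _ _ _ => rfl, fun _ _ => by simp, fun _ _ => by simp⟩
  simp only [← zero_sub]
  exact ⟨hz.sub h.isMultilin, by simp [hnil []], hd.sub (hc.hasDegree hnil hd),
    fun v => (hl v).sub (hc.eLinear hnil v (hl v)),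
    fun v u w hq => by rw [hc.normalized v u w hq, sub_zero]⟩

include he

/-- The component of `f` in arity `i + 1` is a cocycle, hence of the form `[m₂, h]`. The homotopy
`-h` gives an automorphism `u` of `m` whose component in that arity is the opposite one, and `f ∘ u`
still carries `m` to `m'`. -/
theorem IsGaugeWord.exists_kill {n i : ℕ} (hi : 1 ≤ i) (hin : i + 3 ≤ n)
    (hHH : HH1Vanishes 𝒜 e i) {f m m' : List A → A} (hf : IsGaugeWord 𝒜 e f)
    (hm : IsAnWord 𝒜 e m) (hm' : IsAnWord 𝒜 e m') (hid : WIdentity 𝒜 n m)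
    (hmm : ∀ w : List A, w.length < n → m w = m' w) (H : WTransforms 𝒜 n f m m')
    (hφ : ∀ w : List A, w.length ≤ i → f w = idOp w) :
    ∃ f', IsGaugeWord 𝒜 e f' ∧ (∀ w : List A, w.length ≤ i + 1 → f' w = idOp w) ∧
      WTransforms 𝒜 n f' m m' := by
  have hclosed : ∀ w, hochschild 𝒜 (hf.component (i + 1)).ev w = 0 := by
    intro w
    by_cases hw : w.length = i + 2
    · have h1 := first_order hf hm hm' (w := w) (fun v hv => hφ v (by omega))
        (H w (Nat.cast_le.2 (by omega)))
      rw [hmm w (by omega)] at h1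
      rw [hochschild_congr (φ' := fun v => f v - idOp v) (Ops.isMultilin _)
        (hf.multilin.sub idOp_isMultilin) fun v hv => ?_]
      · exact sub_eq_self.1 h1.symm
      · rw [hf.component_ev (by omega)]
        rw [idOp_eq_zero (by omega), sub_zero]
    · rw [hochschild_congr (φ' := fun _ => 0) (Ops.isMultilin _) .zeroFun fun v hv =>
        hf.component_ev_zero (by omega), hochschild_zero]
  obtain ⟨h, h0, hc, hh⟩ := hHH (hf.component (i + 1))
    (fun p hp => by simp [IsGaugeWord.component, Ops.discard, hp])
    (hf.component_isCochain (by omega)) hclosed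
  have hhw := isHomotopyWord_neg hi h0 hc
  obtain ⟨u, hu, hfix, hT⟩ := hm.exists_homotopy he hhw
  have hv0 : ∀ v : List A, v.length ≠ i → -h.ev v = 0 := fun v hv => by
    rw [Ops.ev, h0 _ hv]; simp
  -- In arities up to `i + 1` only `m₂` and the linear part of `u` meet `h`, so `u - id` is `[m₂,
  -- -h]`.
  have hu' : ∀ w : List A, w.length ≤ i + 1 → u w - idOp w = -(hf.component (i + 1)).ev w := by
    intro w hw
    have e1 : sandwich (koszul 𝒜) (fun w => -h.ev w) u w m =
        sandwich (koszul 𝒜) (fun w => -h.ev w) idOp w (prodOp 𝒜) :=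
      sandwich_congr_of_vanish (q := i) hm.multilin (prodOp_isMultilin 𝒜)
        (fun v hv => hv0 v (by omega)) (fun v hv => hm.low v (by omega))
        fun v _ hv => hu.low v (by omega)
    have e2 : sandwich (koszul 𝒜) m idOp w (fun w => -h.ev w) =
        sandwich (koszul 𝒜) (prodOp 𝒜) idOp w (fun w => -h.ev w) :=
      sandwich_idOp_congr hhw.multilin hhw.multilin fun p v q hpw hv => by
        subst hpw
        by_cases h2 : v.length ≤ 2
        · rw [hm.low v h2]
        · rw [hv0 _ (by simp at hw ⊢; omega), hv0 _ (by simp at hw ⊢; omega)]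
    have e3 : sandwich (koszul 𝒜) (fun w => -h.ev w) idOp w (prodOp 𝒜) =
        -sandwich (koszul 𝒜) h.ev idOp w (prodOp 𝒜) := by
      rw [← neg_inj, neg_neg]
      refine (map_sandwich (-AddMonoidHom.id A) w _).trans ?_
      refine sandwich_idOp_congr ((prodOp_isMultilin 𝒜).comp (-LinearMap.id : A →ₗ[R] A))
        (prodOp_isMultilin 𝒜) fun p v q _ _ => ?_
      simp [(prodOp_isMultilin 𝒜).neg_letter]
    have e4 : sandwich (koszul 𝒜) (prodOp 𝒜) idOp w (fun w => -h.ev w) =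
        -sandwich (koszul 𝒜) (prodOp 𝒜) idOp w h.ev :=
      (map_sandwich (-AddMonoidHom.id A) w h.ev).symm
    rw [hfix w, add_sub_cancel_left, e1, e2, e3, e4, hh w,
      insertSum_eq_sandwich _ (prodOp_isMultilin 𝒜), insertSum_eq_sandwich _ h.isMultilin]
    abel
  refine ⟨_, hf.pull hu, fun w hw => ?_, WTransforms.comp hf hu hm hm' (hT n hid) H⟩
  have hc1 : ∀ v : List A, v.length < i + 1 → u v - idOp v = 0 := fun v hv => by
    rw [hu' v (by omega), hf.component_ev_zero (by omega), neg_zero]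
  have hu0 : u [] - idOp [] = 0 := by rw [hu.nil]; exact sub_zero _
  rw [pull_eq_add_sandwich hf.multilin hu.nil,
    sandwich_congr_of_vanish (q := i + 1) hf.multilin idOp_isMultilin hc1
      (fun v hv => hf.low v (by omega)) (fun v hv0 hv => rfl : ∀ v : List A, _ → _ → u v = u v),
    sandwich_idOp_left _ hu0, hu' w hw]
  rcases hw.lt_or_eq with h1 | h1
  · rw [hφ w (by omega), hf.component_ev_zero (by omega)]; simp
  · rw [hf.component_ev h1, add_neg_cancel, idOp_eq_zero (by omega)]

/-- If `HH^1` vanishes, then a gauge equivalence between two structures that agree below arity `n`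
can be replaced by one that is the identity below arity `n - 1`. -/
theorem IsGaugeWord.exists_straighten {n : ℕ} (hHH : ∀ i, 1 ≤ i → i + 3 ≤ n → HH1Vanishes 𝒜 e i)
    {f m m' : List A → A} (hf : IsGaugeWord 𝒜 e f)
    (hm : IsAnWord 𝒜 e m) (hm' : IsAnWord 𝒜 e m') (hid : WIdentity 𝒜 n m)
    (hmm : ∀ w : List A, w.length < n → m w = m' w) (H : WTransforms 𝒜 n f m m') :
    ∃ f', IsGaugeWord 𝒜 e f' ∧ ∀ w : List A, w.length = n →
      m' w = m w - hochschild 𝒜 (fun v => f' v - idOp v) w := by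
  have key : ∀ j, j + 2 ≤ n → ∃ f', IsGaugeWord 𝒜 e f' ∧
      (∀ w : List A, w.length ≤ j → f' w = idOp w) ∧ WTransforms 𝒜 n f' m m' := by
    intro j
    induction j with
    | zero => exact fun _ => ⟨f, hf, fun w hw => hf.low w (by omega), H⟩
    | succ j ih =>
      intro hj
      obtain ⟨f', hf', h1, h2⟩ := ih (by omega)
      rcases Nat.eq_zero_or_pos j with rfl | hj0
      · exact ⟨f', hf', fun w hw => hf'.low w (by omega), h2⟩
      · exact hf'.exists_kill he hj0 (by omega) (hHH j hj0 (by omega)) hm hm' hid hmm h2 h1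
  rcases Nat.lt_or_ge n 2 with h2 | h2
  · refine ⟨f, hf, fun w hw => first_order hf hm hm' (fun v hv => ?_) (H w (by rw [hw]))⟩
    exact hf.low v (by omega)
  · obtain ⟨f', hf', h1, h3⟩ := key (n - 2) (by omega)
    exact ⟨f', hf', fun w hw => first_order hf' hm hm' (fun v hv => h1 v (by omega))
      (h3 w (by rw [hw]))⟩

end Straighten

end AInf

namespace AInf

/-! ### Comparison of two transforms of one structure -/

section Difference

variable {R A : Type*} [CommRing R] [Ring A] [Algebra R A] {𝒜 : ℤ → Submodule R A}
  [GradedAlgebra 𝒜] {V : Type*} {e : V → A}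

theorem pull_eq_of_vanish {X f : List A → A} (hX : IsMultilin (R := R) X)
    (hf : IsGaugeWord 𝒜 e f) {w : List A} (h : ∀ v : List A, v.length < w.length → X v = 0) :
    pull X f w = X w := by
  rw [pull_eq_add_sandwich hX hf.nil, sandwich_vanish hX (fun a => by rw [hf.one]; exact sub_self a)
    id f h w le_rfl, add_zero]

theorem IsGaugeWord.exists_inverse' {f : List A → A} (hf : IsGaugeWord 𝒜 e f) :
    ∃ g, IsGaugeWord 𝒜 e g ∧ (∀ w, AInf.pull f g w = idOp w) ∧ ∀ w, AInf.pull g f w = idOp w := by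
  obtain ⟨g, hg, h1⟩ := hf.exists_inverse
  obtain ⟨h, hh, h2⟩ := hg.exists_inverse
  have : f = h := by
    funext w
    rw [← AInf.pull_idOp hf.multilin w, ← funext h2, ← pull_pull hf.multilin hg.nil, funext h1,
      pull_idOp_left hh.nil]
  exact ⟨g, hg, h1, this ▸ h2⟩

variable (he : ∀ v, e v ∈ 𝒜 0)
include he

/-- The composite of `f'` with the inverse of `f` carries `m₁` to `m₂`. It is the identity in low
arities and has leading term `f' - f`, so `first_order` applies. -/
theorem transforms_difference {n : ℕ∞} {f f' m m₁ m₂ : List A → A} (hf : IsGaugeWord 𝒜 e f)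
    (hf' : IsGaugeWord 𝒜 e f') (hm : IsAnWord 𝒜 e m) (hm₁ : IsAnWord 𝒜 e m₁)
    (hm₂ : IsAnWord 𝒜 e m₂) (H₁ : WTransforms 𝒜 n f m m₁) (H₂ : WTransforms 𝒜 n f' m m₂)
    {w : List A} (hw : (w.length : ℕ∞) ≤ n)
    (h : ∀ v : List A, v.length + 1 < w.length → f v = f' v) :
    m₂ w = m₁ w - hochschild 𝒜 (fun v => f' v - f v) w := by
  obtain ⟨g, hg, h1, h2⟩ := hf.exists_inverse'
  obtain ⟨m₀, hm₀, H₀⟩ := hm₁.exists_transform he hg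
  -- The inverse carries `m₁` to some `m₀`, and `m₀` agrees with `m` up to length `n` because the
  -- composite of `g` and `f` is the identity.
  have Hg : WTransforms 𝒜 n g m₁ m := by
    have h3 : WTransforms 𝒜 n idOp m m₀ := by
      have := WTransforms.comp (n := n) hg hf hm₁ hm₀ H₁ (fun w _ => H₀ w)
      rwa [funext h2] at this
    exact WTransforms.congr_right (h3.unique isGaugeWord_idOp hm₀ hm (WTransforms.refl n hm))
      fun w _ => H₀ w
  have hgf := hf'.pull hg
  have key : ∀ v : List A, v.length + 1 ≤ w.length → pull f' g v - idOp v = f' v - f v := by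
    intro v hv
    have h3 : ∀ t : List A, t.length < v.length → (fun t => f' t - f t) t = 0 := fun t ht => by
      simp only [h t (by omega), sub_self]
    rw [← h1 v, ← pull_sub, pull_eq_of_vanish (hf'.multilin.sub hf.multilin) hg h3]
  have := first_order hgf hm₁ hm₂ (w := w) (fun v hv => ?_)
    (WTransforms.comp hf' hg hm hm₂ Hg H₂ w hw)
  · rw [this, hochschild_congr (hgf.multilin.sub idOp_isMultilin) (hf'.multilin.sub hf.multilin)
      fun v hv => key v (by omega)]
  · have h3 := key v (by omega)
    rw [h v hv, sub_self] at h3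
    exact sub_eq_zero.1 h3

end Difference

/-! ### Splittings of the Hochschild complex and normal forms -/

section NormalForm

variable {R A : Type*} [CommRing R] [Ring A] [Algebra R A] {𝒜 : ℤ → Submodule R A}
  [GradedAlgebra 𝒜] {V : Type*} {e : V → A}

theorem hochschild_isMultilin {φ : List A → A} (hφ : IsMultilin (R := R) φ) :
    IsMultilin (R := R) (hochschild 𝒜 φ) :=
  (insertSum_isMultilin (θ := LinearMap.id) (prodOp_isMultilin 𝒜) hφ).sub
    (insertSum_isMultilin hφ (prodOp_isMultilin 𝒜))

variable (𝒜) in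
/-- The Hochschild differential of a family of even cochains. -/
noncomputable def hochschildOps (c : Ops R A) : Ops R A :=
  Ops.ofWord (hochschild 𝒜 c.ev) (hochschild_isMultilin c.isMultilin)

@[simp] theorem hochschildOps_ev (c : Ops R A) (w : List A) :
    (hochschildOps 𝒜 c).ev w = hochschild 𝒜 c.ev w := Ops.ofWord_ev _ _ w

theorem Ops.ev_add (c c' : Ops R A) (w : List A) : (c + c').ev w = c.ev w + c'.ev w := rfl

theorem Ops.ev_sub (c c' : Ops R A) (w : List A) : (c - c').ev w = c.ev w - c'.ev w := by
  simp [Ops.ev]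

theorem Ops.ev_zero (w : List A) : (0 : Ops R A).ev w = 0 := rfl

theorem hochschild_add (φ ψ : List A → A) (w : List A) :
    hochschild 𝒜 (fun v => φ v + ψ v) w = hochschild 𝒜 φ w + hochschild 𝒜 ψ w := by
  have h := (prodOp_isMultilin 𝒜)
  simp only [hochschild, insertSum, h.add, Finset.sum_add_distrib]
  abel

theorem hochschildOps_add (c c' : Ops R A) :
    hochschildOps 𝒜 (c + c') = hochschildOps 𝒜 c + hochschildOps 𝒜 c' :=
  Ops.ext_ev fun w => by
    rw [Ops.ev_add, hochschildOps_ev, hochschildOps_ev, hochschildOps_ev,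
      ← hochschild_add]
    rfl

theorem hochschildOps_local {c c' : Ops R A} {p : ℕ} (h : c p = c' p) :
    hochschildOps 𝒜 c (p + 1) = hochschildOps 𝒜 c' (p + 1) := by
  ext a
  rw [← Ops.ev_ofFn, ← Ops.ev_ofFn, hochschildOps_ev, hochschildOps_ev]
  refine hochschild_congr c.isMultilin c'.isMultilin fun v hv => ?_
  have hv : v.length = p := by simpa using hv
  rw [Ops.ev_eq _ _ hv, Ops.ev_eq _ _ hv, h]

variable (𝒜 e) in
/-- A pseudo-inverse of the Hochschild differential on `CH^1`, in arities at least two. -/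
structure Splitting where
  toHom : Ops R A →+ Ops R A
  localized : ∀ p c c', c (p + 1) = c' (p + 1) → toHom c p = toHom c' p
  low : ∀ p c, p < 2 → toHom c p = 0
  cochain : ∀ c, IsCochain 𝒜 e 1 1 (toHom c)
  left : ∀ c, toHom (hochschildOps 𝒜 (toHom c)) = toHom c
  right : ∀ c, IsCochain 𝒜 e 1 1 c → (∀ p < 2, c p = 0) →
    hochschildOps 𝒜 (toHom (hochschildOps 𝒜 c)) = hochschildOps 𝒜 c

/-- The operations of arity at least two. -/
noncomputable def Ops.higher (c : Ops R A) : Ops R A := c.discard (· < 2)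

theorem Ops.higher_low (c : Ops R A) {p : ℕ} (h : p < 2) : c.higher p = 0 := by
  simp [Ops.higher, Ops.discard, h]

theorem Ops.higher_of_le (c : Ops R A) {p : ℕ} (h : 2 ≤ p) : c.higher p = c p := by
  simp [Ops.higher, Ops.discard, not_lt.2 h]

theorem IsCochain.of_low {d : ℤ} {q : ℕ} {c : Ops R A} (hc : IsCochain 𝒜 e d q c)
    (h : ∀ p < q, c p = 0) (q' : ℕ) : IsCochain 𝒜 e d q' c := by
  have h0 : ∀ w : List A, w.length < q → c.ev w = (fun _ => 0) w := fun w hw => by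
    rw [Ops.ev, h _ hw]; rfl
  refine isCochain_of_word (hc.hasDegree h0 fun _ _ _ => Submodule.zero_mem _)
    (fun v => hc.eLinear h0 v ⟨fun _ _ _ _ => rfl, fun _ _ => by simp, fun _ _ => by simp⟩)
    fun v u w _ => ?_
  by_cases h1 : q ≤ (u ++ e v :: w).length
  · exact hc.normalized v u w h1
  · exact h0 _ (by omega)

variable (𝒜 e) in
/-- The component of a gauge transformation, as a family of operations. -/
structure IsGaugeOps (f : Ops R A) : Prop where
  low : ∀ w : List A, w.length ≤ 1 → f.ev w = idOp w
  cochain : IsCochain 𝒜 e 1 2 f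

theorem IsGaugeOps.isGaugeWord {f : Ops R A} (hf : IsGaugeOps 𝒜 e f) : IsGaugeWord 𝒜 e f.ev where
  multilin := f.isMultilin
  low := hf.low
  degree := hf.cochain.hasDegree (fun w hw => hf.low w (by omega)) hasDegree_idOp
  elinear v := hf.cochain.eLinear (fun w hw => hf.low w (by omega)) v eLinear_idOp
  normalized v u w h := hf.cochain.normalized v u w h

theorem IsGaugeWord.isGaugeOps {f : Ops R A} (hf : IsGaugeWord 𝒜 e f.ev) : IsGaugeOps 𝒜 e f :=
  ⟨hf.low, isCochain_of_word hf.degree hf.elinear hf.normalized⟩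

theorem IsGaugeOps.higher_isCochain {f : Ops R A} (hf : IsGaugeOps 𝒜 e f) :
    IsCochain 𝒜 e 1 1 f.higher :=
  (hf.cochain.discard _).of_low (fun _ hp => f.higher_low hp) 1

theorem higher_ev {f : Ops R A} {w : List A} (h : 2 ≤ w.length) : f.higher.ev w = f.ev w :=
  Ops.discard_ev _ _ (not_lt.2 h)

theorem IsGaugeOps.add {f c : Ops R A} (hf : IsGaugeOps 𝒜 e f) (hc : IsCochain 𝒜 e 1 1 c)
    (h : ∀ p < 2, c p = 0) : IsGaugeOps 𝒜 e (f + c) := by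
  have hg := hf.isGaugeWord
  have h0 : ∀ w : List A, w.length < 2 → c.ev w = 0 := fun w hw => by
    rw [Ops.ev, h _ hw]; rfl
  refine IsGaugeWord.isGaugeOps ⟨Ops.isMultilin _, fun w hw => ?_, ?_, fun v => ?_, fun v u w hq => ?_⟩
  · rw [Ops.ev_add, h0 w (by omega), add_zero, hf.low w hw]
  · exact hg.degree.add (hc.hasDegree (X := fun _ => 0) (fun w hw => h0 w (by omega))
      fun _ _ _ => Submodule.zero_mem _)
  · exact (hg.elinear v).add (hc.eLinear (X := fun _ => 0) (fun w hw => h0 w (by omega)) v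
      ⟨fun _ _ _ _ => rfl, fun _ _ => by simp, fun _ _ => by simp⟩)
  · rw [Ops.ev_add, hg.normalized v u w hq, hc.normalized v u w (by omega), add_zero]

namespace Splitting

variable (S : Splitting 𝒜 e)

/-- A gauge transformation whose higher components lie in the image of the splitting. -/
def Reduced (f : Ops R A) : Prop := S.toHom (hochschildOps 𝒜 f.higher) = f.higher

theorem toHom_ev_congr {c c' : Ops R A} {w : List A}
    (h : ∀ v : List A, v.length = w.length + 1 → c.ev v = c'.ev v) :
    (S.toHom c).ev w = (S.toHom c').ev w := by
  rw [Ops.ev, Ops.ev, S.localized w.length c c']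
  ext a
  rw [← Ops.ev_ofFn, ← Ops.ev_ofFn]
  exact h _ (by simp)

theorem toHom_hochschild_ev {c : Ops R A} {f : Ops R A} {w : List A} (hw : 2 ≤ w.length)
    (h : ∀ v : List A, v.length = w.length → c.ev v = f.ev v) (hf : S.Reduced f) :
    (S.toHom (hochschildOps 𝒜 c)).ev w = f.ev w := by
  rw [← higher_ev (f := f) hw, ← hf]
  refine S.toHom_ev_congr fun v hv => ?_
  rw [hochschildOps_ev, hochschildOps_ev]
  refine hochschild_congr (Ops.isMultilin _) (Ops.isMultilin _) fun t ht => ?_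
  rw [h t (by omega), higher_ev (by omega)]

theorem toHom_low {c : Ops R A} {w : List A} (hw : w.length < 2) : (S.toHom c).ev w = 0 := by
  rw [Ops.ev, S.low _ _ hw]; rfl

variable (he : ∀ v, e v ∈ 𝒜 0)
include he

/-- The inductive step for reduced gauge transformations. -/
theorem step {n : ℕ∞} {f f' m m₁ m₂ : Ops R A} (hf : IsGaugeOps 𝒜 e f)
    (hf' : IsGaugeOps 𝒜 e f') (hr : S.Reduced f) (hr' : S.Reduced f')
    (hm : IsAnWord 𝒜 e m.ev) (hm₁ : IsAnWord 𝒜 e m₁.ev)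
    (hm₂ : IsAnWord 𝒜 e m₂.ev) (H₁ : WTransforms 𝒜 n f.ev m.ev m₁.ev)
    (H₂ : WTransforms 𝒜 n f'.ev m.ev m₂.ev)
    {w : List A} (hw : ((w.length + 1 : ℕ) : ℕ∞) ≤ n)
    (h : ∀ v : List A, v.length < w.length → f.ev v = f'.ev v) :
    f.ev w + (S.toHom m₁).ev w = f'.ev w + (S.toHom m₂).ev w := by
  rcases Nat.lt_or_ge w.length 2 with h2 | h2
  · rw [S.toHom_low h2, S.toHom_low h2, hf.low w (by omega), hf'.low w (by omega)]
  have h3 : (S.toHom m₂).ev w = (S.toHom (m₁ - (hochschildOps 𝒜 (f' - f)))).ev w := by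
    refine S.toHom_ev_congr fun v hv => ?_
    rw [Ops.ev_sub, hochschildOps_ev]
    have : (f' - f).ev = fun v => f'.ev v - f.ev v := funext fun v => Ops.ev_sub _ _ v
    rw [this]
    exact transforms_difference he hf.isGaugeWord hf'.isGaugeWord hm hm₁ hm₂ H₁ H₂
      (by rw [hv]; exact hw) fun t ht => h t (by omega)
  have h4 : hochschildOps 𝒜 (f' - f) = hochschildOps 𝒜 f' - hochschildOps 𝒜 f := by
    rw [eq_sub_iff_add_eq, ← hochschildOps_add, sub_add_cancel]
  -- In this arity the structures differ by `δ (f' - f)`, which the splitting turns into `f' - f`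
  -- because both transformations are reduced. This exactly compensates the difference between `f`
  -- and `f'`.
  rw [h3, map_sub, h4, map_sub, Ops.ev_sub, Ops.ev_sub,
    S.toHom_hochschild_ev h2 (fun _ _ => rfl) hr, S.toHom_hochschild_ev h2 (fun _ _ => rfl) hr']
  abel

/-- When both transforms are normal, the quantity compared in `step` is the value of the gauge
transformation itself; induct on the length. -/
theorem reduced_unique {n : ℕ∞} {f f' m m₁ m₂ : Ops R A} (hf : IsGaugeOps 𝒜 e f)
    (hf' : IsGaugeOps 𝒜 e f') (hr : S.Reduced f) (hr' : S.Reduced f')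
    (hm : IsAnWord 𝒜 e m.ev) (hm₁ : IsAnWord 𝒜 e m₁.ev)
    (hm₂ : IsAnWord 𝒜 e m₂.ev) (H₁ : WTransforms 𝒜 n f.ev m.ev m₁.ev)
    (H₂ : WTransforms 𝒜 n f'.ev m.ev m₂.ev) (h₁ : S.toHom m₁ = 0) (h₂ : S.toHom m₂ = 0)
    (w : List A) (hw : (w.length : ℕ∞) < n) : f.ev w = f'.ev w := by
  induction w using length_induction with
  | h w ih =>
    have := S.step he hf hf' hr hr' hm hm₁ hm₂ H₁ H₂ (w := w)
      (by push_cast; exact Order.add_one_le_of_lt hw) fun v hv => ih v hv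
        ((Nat.cast_lt.2 hv).trans hw)
    simpa [h₁, h₂, Ops.ev_zero] using this

/-- Iterate `f ↦ f + s (f * m)`, where `s` is the splitting. It preserves reduced transformations
since `s δ s = s`, it is contracting by `step`, and at a fixed point `s (f * m) = 0`. -/
theorem exists_normalizer {m : Ops R A} (hm : IsAnWord 𝒜 e m.ev) :
    ∃ f m' : Ops R A, IsGaugeOps 𝒜 e f ∧ S.Reduced f ∧ IsAnWord 𝒜 e m'.ev ∧
      WTransforms 𝒜 ⊤ f.ev m.ev m'.ev ∧ S.toHom m' = 0 := by
  -- The iteration must be defined on all functions of words. Hence the transform `t` and the family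
  -- `op` are chosen totally, with value zero outside their domain.
  have ht : ∀ f : Ops R A, ∃ m' : Ops R A, IsGaugeOps 𝒜 e f → IsAnWord 𝒜 e m'.ev ∧
      WTransforms 𝒜 ⊤ f.ev m.ev m'.ev := by
    intro f
    by_cases hf : IsGaugeOps 𝒜 e f
    · obtain ⟨m', hm', H⟩ := hm.exists_transform he hf.isGaugeWord
      have h : (Ops.ofWord m' hm'.multilin).ev = m' := funext fun w => Ops.ofWord_ev m' _ w
      exact ⟨.ofWord m' hm'.multilin, fun _ => by rw [h]; exact ⟨hm', fun w _ => H w⟩⟩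
    · exact ⟨0, fun h => absurd h hf⟩
  choose t ht using ht
  have hop : ∀ F : List A → A, ∃ f : Ops R A, IsMultilin (R := R) F → f.ev = F := fun F => by
    by_cases hF : IsMultilin (R := R) F
    · exact ⟨.ofWord F hF, fun _ => funext fun w => Ops.ofWord_ev F hF w⟩
    · exact ⟨0, fun h => absurd h hF⟩
  choose op hop using hop
  obtain ⟨F, ⟨f, rfl, hf, hr⟩, hfix⟩ := exists_fixed_word
    (P := fun F : List A → A => ∃ f : Ops R A, f.ev = F ∧ IsGaugeOps 𝒜 e f ∧ S.Reduced f)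
    (Φ := fun F w => F w + (S.toHom (t (op F))).ev w)
    (f₀ := (op idOp).ev)
    (by
      rintro _ _ w ⟨f, rfl, hf, hr⟩ ⟨f', rfl, hf', hr'⟩ h
      have e1 : op f.ev = f := Ops.ext_ev fun w => by rw [hop _ f.isMultilin]
      have e2 : op f'.ev = f' := Ops.ext_ev fun w => by rw [hop _ f'.isMultilin]
      simp only [e1, e2]
      exact S.step he hf hf' hr hr' hm (ht f hf).1 (ht f' hf').1 (ht f hf).2 (ht f' hf').2 le_top h)
    (by
      rintro _ ⟨f, rfl, hf, hr⟩
      have e1 : op f.ev = f := Ops.ext_ev fun w => by rw [hop _ f.isMultilin]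
      refine ⟨f + S.toHom (t f), funext fun w => by simp only [e1]; rfl,
        hf.add (S.cochain _) fun p hp => S.low p _ hp, ?_⟩
      have e2 : (f + S.toHom (t f)).higher = f.higher + S.toHom (t f) := by
        funext p
        rcases Nat.lt_or_ge p 2 with h | h
        · simp [Ops.higher_low _ h, S.low p _ h]
        · simp [Ops.higher_of_le _ h]
      rw [Reduced, e2, hochschildOps_add, map_add, S.left, hr])
    (by
      intro F h
      have hF : IsGaugeWord 𝒜 e F := .of_local fun N => by
        obtain ⟨_, ⟨f, rfl, hf, -⟩, h⟩ := h N
        exact ⟨f.ev, hf.isGaugeWord, h⟩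
      have e1 := hop F hF.multilin
      refine ⟨op F, e1, IsGaugeWord.isGaugeOps (by rw [e1]; exact hF), Ops.ext_ev fun w => ?_⟩
      rcases Nat.lt_or_ge w.length 2 with h2 | h2
      · rw [S.toHom_low h2, Ops.ev, Ops.higher_low _ h2]; rfl
      · obtain ⟨_, ⟨f, rfl, hf, hr⟩, h⟩ := h (w.length + 1)
        rw [higher_ev h2, e1, h w (by omega)]
        exact S.toHom_hochschild_ev h2 (fun v hv => by
          rw [higher_ev (by omega), e1, h v (by omega)]) hr)
    (by
      have e1 : (op idOp).ev = idOp (A := A) := hop idOp idOp_isMultilin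
      refine ⟨op idOp, rfl, IsGaugeWord.isGaugeOps (by rw [e1]; exact isGaugeWord_idOp), ?_⟩
      have e2 : (op idOp).higher = (0 : Ops R A) := Ops.ext_ev fun w => by
        rcases Nat.lt_or_ge w.length 2 with h2 | h2
        · rw [Ops.ev, Ops.higher_low _ h2]; rfl
        · rw [higher_ev h2, e1, idOp_eq_zero (by omega)]; rfl
      have e3 : hochschildOps 𝒜 (0 : Ops R A) = 0 := by
        have := hochschildOps_add (𝒜 := 𝒜) (0 : Ops R A) 0
        simpa using this
      rw [Reduced, e2, e3, map_zero])
  have e1 : op f.ev = f := Ops.ext_ev fun w => by rw [hop _ f.isMultilin]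
  refine ⟨f, t f, hf, hr, (ht f hf).1, (ht f hf).2, Ops.ext_ev fun w => ?_⟩
  have := hfix w
  simp only [e1, add_eq_left] at this
  exact this

/-- Induction on the arity `N`. By straightening, the structures differ in arity `N` by `δ φ`. The
splitting kills both structures, so `s δ φ = 0` in arity `N - 1` and `δ φ = δ s δ φ = 0` in arity
`N`. -/
theorem orbit_unique {n : ℕ∞}
    (hHH : ∀ i : ℕ, 1 ≤ i → ((i + 3 : ℕ) : ℕ∞) ≤ n → HH1Vanishes 𝒜 e i) {m m' : Ops R A}
    {f : List A → A} (hf : IsGaugeWord 𝒜 e f) (hm : IsAnWord 𝒜 e m.ev) (hm' : IsAnWord 𝒜 e m'.ev)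
    (hid : WIdentity 𝒜 n m.ev) (H : WTransforms 𝒜 n f m.ev m'.ev) (h₁ : S.toHom m = 0)
    (h₂ : S.toHom m' = 0) (w : List A) (hw : (w.length : ℕ∞) ≤ n) : m.ev w = m'.ev w := by
  generalize hN : w.length = N
  induction N using Nat.strong_induction_on generalizing w with
  | _ N ih =>
  rcases Nat.lt_or_ge N 3 with h3 | h3
  · rw [hm.low w (by omega), hm'.low w (by omega)]
  have hNn : (N : ℕ∞) ≤ n := hN ▸ hw
  obtain ⟨f', hf', h⟩ := hf.exists_straighten he (n := N)
    (fun i hi hiN => hHH i hi ((Nat.cast_le.2 hiN).trans hNn)) hm hm'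
    (fun v hv => hid v (hv.trans hNn))
    (fun v hv => ih _ hv v ((Nat.cast_le.2 hv.le).trans hNn) rfl) fun v hv => H v (hv.trans hNn)
  have hop : (Ops.ofWord f' hf'.multilin).ev = f' := funext fun w => Ops.ofWord_ev f' _ w
  have hg : IsGaugeOps 𝒜 e (Ops.ofWord f' hf'.multilin) := IsGaugeWord.isGaugeOps (by rw [hop]; exact hf')
  set φ := (Ops.ofWord f' hf'.multilin).higher with hφ
  have hφ' : ∀ v : List A, v.length = N → m'.ev v = m.ev v - (hochschildOps 𝒜 φ).ev v := by
    intro v hv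
    rw [h v hv, hochschildOps_ev]
    congr 1
    refine hochschild_congr (hf'.multilin.sub idOp_isMultilin) (Ops.isMultilin _) fun t ht => ?_
    rw [higher_ev (by omega), hop, idOp_eq_zero (by omega), sub_zero]
  have h4 : S.toHom (hochschildOps 𝒜 φ) (N - 1) = 0 := by
    have h5 : (m - m') (N - 1 + 1) = hochschildOps 𝒜 φ (N - 1 + 1) := by
      ext a
      have h6 := hφ' (List.ofFn a) (by simp; omega)
      have h7 := Ops.ev_sub m m' (List.ofFn a)
      rw [h6, sub_sub_cancel] at h7
      rwa [Ops.ev_ofFn, Ops.ev_ofFn] at h7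
    rw [← S.localized _ _ _ h5, map_sub, h₁, h₂, sub_zero]
    rfl
  have h8 : hochschildOps 𝒜 φ (N - 1 + 1) = 0 := by
    rw [← S.right φ hg.higher_isCochain fun p hp => Ops.higher_low _ hp]
    rw [hochschildOps_local (c' := 0) h4]
    have := hochschildOps_add (𝒜 := 𝒜) (0 : Ops R A) 0
    rw [add_zero, left_eq_add] at this
    rw [this]; rfl
  rw [hφ' w hN, Ops.ev_eq (hochschildOps 𝒜 φ) w (p := N - 1 + 1) (by omega), h8]
  simp

end Splitting

end NormalForm

end AInf

namespace AInf

/-! ### Slices of operations over an extension of scalars -/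

section Slices

variable {k E : Type*} [Field k] [Ring E] [Algebra k E]
  {R : Type*} [CommRing R] [Algebra k R]

/-- The map `λ ⊗ id : R ⊗ E → E` given by a linear form `λ` on `R`. -/
noncomputable def slice (E : Type*) [Ring E] [Algebra k E] (l : R →ₗ[k] k) : R ⊗[k] E →ₗ[k] E :=
  (TensorProduct.lid k E).toLinearMap ∘ₗ LinearMap.rTensor E l

@[simp] theorem slice_tmul (l : R →ₗ[k] k) (r : R) (x : E) : slice E l (r ⊗ₜ x) = l r • x := by
  simp [slice]

theorem slice_mul_pure (l : R →ₗ[k] k) (a : R ⊗[k] E) (y : E) :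
    slice E l (a * 1 ⊗ₜ y) = slice E l a * y := by
  induction a with
  | zero => simp
  | add a b ha hb => rw [add_mul, map_add, ha, hb, map_add, add_mul]
  | tmul r x => simp

theorem slice_pure_mul (l : R →ₗ[k] k) (a : R ⊗[k] E) (y : E) :
    slice E l (1 ⊗ₜ y * a) = y * slice E l a := by
  induction a with
  | zero => simp
  | add a b ha hb => rw [mul_add, map_add, ha, hb, map_add, mul_add]
  | tmul r x => simp

theorem slice_map (l : R →ₗ[k] k) (f : E →ₗ[k] E) (a : R ⊗[k] E) :
    slice E l (f.baseChange R a) = f (slice E l a) := by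
  induction a with
  | zero => simp
  | add a b ha hb => rw [map_add, map_add, ha, hb, map_add, map_add]
  | tmul r x => simp

theorem slice_coeffMap {R' : Type*} [CommRing R'] [Algebra k R'] (φ : R →ₐ[k] R') (l : R' →ₗ[k] k)
    (a : R ⊗[k] E) : slice E l (coeffMap E φ a) = slice E (l ∘ₗ φ.toLinearMap) a := by
  induction a with
  | zero => simp
  | add a b ha hb => rw [map_add, map_add, ha, hb, map_add]
  | tmul r x => simp

theorem repr_slice {ι : Type*} (b : Module.Basis ι k E) (l : R →ₗ[k] k) (a : R ⊗[k] E) (j : ι) :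
    b.repr (slice E l a) j = l ((b.baseChange R).repr a j) := by
  induction a with
  | zero => simp
  | add a b ha hb => simp only [map_add, Finsupp.add_apply, ha, hb]
  | tmul r x => simp [Module.Basis.baseChange_repr_tmul, mul_comm]

theorem repr_coeffMap {ι : Type*} (b : Module.Basis ι k E) {R' : Type*} [CommRing R'] [Algebra k R']
    (φ : R →ₐ[k] R') (a : R ⊗[k] E) (j : ι) :
    (b.baseChange R').repr (coeffMap E φ a) j = φ ((b.baseChange R).repr a j) := by
  induction a with
  | zero => simp
  | add a b ha hb => simp only [map_add, Finsupp.add_apply, ha, hb]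
  | tmul r x => simp [Module.Basis.baseChange_repr_tmul]

/-- The coordinates in a basis of `E` lie in `R`, and linear forms separate the elements of the
vector space `R`. -/
theorem eq_of_slice {a a' : R ⊗[k] E} (h : ∀ l : R →ₗ[k] k, slice E l a = slice E l a') :
    a = a' := by
  let b := Module.Basis.ofVectorSpace k E
  refine (b.baseChange R).repr.injective (Finsupp.ext fun j => ?_)
  rw [← sub_eq_zero]
  refine (Module.forall_dual_apply_eq_zero_iff k _).1 fun l => ?_
  rw [map_sub]
  rw [← repr_slice, ← repr_slice, h, sub_self]

theorem slice_smul (l : R →ₗ[k] k) (r : R) (a : R ⊗[k] E) :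
    slice E l (r • a) = slice E (l ∘ₗ LinearMap.mulLeft k r) a := by
  induction a with
  | zero => simp
  | add x y h h' => rw [smul_add, map_add, map_add, h, h']
  | tmul s y => simp [TensorProduct.smul_tmul']

theorem slice_mem {N : Submodule k E} {a : R ⊗[k] E} (ha : a ∈ N.baseChange R) (l : R →ₗ[k] k) :
    slice E l a ∈ N := by
  rw [Submodule.baseChange_eq_span] at ha
  induction ha using Submodule.span_induction generalizing l with
  | mem a ha =>
    obtain ⟨x, hx, rfl⟩ := ha
    simpa using N.smul_mem _ hx
  | zero => simp
  | add x y _ _ hx hy => rw [map_add]; exact N.add_mem (hx l) (hy l)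
  | smul r x _ hx =>
    rw [slice_smul]
    exact hx _

/-- A projection of `E` onto `N`, extended to `R ⊗ E`, fixes every slice of `a`, hence fixes `a`. -/
theorem mem_baseChange_of_slice {N : Submodule k E} {a : R ⊗[k] E}
    (h : ∀ l : R →ₗ[k] k, slice E l a ∈ N) : a ∈ N.baseChange R := by
  obtain ⟨P, hP⟩ := LinearMap.exists_extend (LinearMap.id : N →ₗ[k] N)
  have h1 : (N.subtype ∘ₗ P).baseChange R a = a := eq_of_slice fun l => by
    rw [slice_map]
    exact congrArg Subtype.val (LinearMap.congr_fun hP ⟨_, h l⟩)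
  rw [← h1]
  clear h h1
  induction a with
  | zero => simp
  | add x y hx hy => rw [map_add]; exact Submodule.add_mem _ hx hy
  | tmul r x =>
    rw [LinearMap.baseChange_tmul]
    exact Submodule.tmul_mem_baseChange_of_mem _ (P x).2

theorem slice_koszul (𝒜 : ℤ → Submodule k E) [GradedAlgebra 𝒜] (l : R →ₗ[k] k) (a : R ⊗[k] E) :
    slice E l (koszul (fun i => (𝒜 i).baseChange R) a) = koszul 𝒜 (slice E l a) := by
  induction a with
  | zero => simp
  | add x y hx hy => simp only [map_add, hx, hy]
  | tmul r x =>
    induction x using DirectSum.Decomposition.inductionOn 𝒜 with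
    | zero => simp
    | add x y hx hy => simp only [tmul_add, map_add, hx, hy]
    | @homogeneous d x =>
      rw [koszul_of_mem (fun i => (𝒜 i).baseChange R) (d := d)
          (Submodule.tmul_mem_baseChange_of_mem _ x.2), map_zsmul, slice_tmul, map_smul,
          koszul_of_mem 𝒜 x.2, smul_comm]

theorem koszul_pure (𝒜 : ℤ → Submodule k E) [GradedAlgebra 𝒜] (x : E) :
    koszul (fun i => (𝒜 i).baseChange R) ((1 : R) ⊗ₜ[k] x) = 1 ⊗ₜ koszul 𝒜 x :=
  eq_of_slice fun l => by rw [slice_koszul, slice_tmul, slice_tmul, map_smul]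

/-- A word over `E`, regarded as a word over `R ⊗ E`. -/
def pureWord (R : Type*) [CommRing R] [Algebra k R] (x : List E) : List (R ⊗[k] E) :=
  x.map fun a => 1 ⊗ₜ a

/-- The slice of a family of operations. -/
noncomputable def Ops.slice (l : R →ₗ[k] k) (c : Ops R (R ⊗[k] E)) : Ops k E := fun p =>
  (((AInf.slice E l).compMultilinearMap ((c p).restrictScalars k)).compLinearMap
      fun _ => (Algebra.TensorProduct.includeRight : E →ₐ[k] R ⊗[k] E).toLinearMap)

theorem Ops.slice_ev (l : R →ₗ[k] k) (c : Ops R (R ⊗[k] E)) (x : List E) :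
    (c.slice l).ev x = AInf.slice E l (c.ev (pureWord R x)) := by
  rw [Ops.ev_eq c (p := x.length) _ (by simp [pureWord])]
  simp only [Ops.ev, Ops.slice, LinearMap.compMultilinearMap_apply,
    MultilinearMap.compLinearMap_apply, MultilinearMap.coe_restrictScalars]
  congr 2; funext i
  simp [pureWord]
  rfl

theorem eq_zero_of_pureWord {B : Type*} [AddCommGroup B] [Module R B]
    {F : List (R ⊗[k] E) → B} (hF : IsMultilin (R := R) F) (n : ℕ)
    (h : ∀ x : List E, x.length = n → F (pureWord R x) = 0) (w : List (R ⊗[k] E))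
    (hw : w.length = n) : F w = 0 := by
  refine hF.eq_zero (span_pure R) n (fun w hn hw => ?_) w hw
  obtain ⟨x, rfl⟩ := exists_pure_word hw
  exact h x (by simpa using hn)

theorem Ops.eq_of_pureWord {c c' : Ops R (R ⊗[k] E)}
    (h : ∀ x : List E, c.ev (pureWord R x) = c'.ev (pureWord R x)) : c = c' :=
  Ops.ext_ev fun w => sub_eq_zero.1 (eq_zero_of_pureWord (c.isMultilin.sub c'.isMultilin) _
    (fun x _ => sub_eq_zero.2 (h x)) w rfl)

theorem Ops.eq_of_slice {c c' : Ops R (R ⊗[k] E)} (h : ∀ l : R →ₗ[k] k, c.slice l = c'.slice l) :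
    c = c' :=
  Ops.eq_of_pureWord fun x => AInf.eq_of_slice fun l => by
    rw [← Ops.slice_ev, ← Ops.slice_ev, h]

theorem Ops.slice_coeff {R' : Type*} [CommRing R'] [Algebra k R'] (φ : R →ₐ[k] R')
    (l : R' →ₗ[k] k) (c : Ops R (R ⊗[k] E)) :
    (c.map φ).slice l = c.slice (l ∘ₗ φ.toLinearMap) :=
  Ops.ext_ev fun x => by
    rw [Ops.slice_ev, Ops.slice_ev, pureWord, Ops.ev_map_pure, slice_coeffMap]; rfl

section Insert

variable (𝒜 : ℤ → Submodule k E) [GradedAlgebra 𝒜]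

theorem slice_prodOp (l : R →ₗ[k] k) (p q : List E) (a : R ⊗[k] E) :
    slice E l (prodOp (fun i => (𝒜 i).baseChange R) (pureWord R p ++ a :: pureWord R q)) =
      prodOp 𝒜 (p ++ slice E l a :: q) := by
  match p, q with
  | [], [] => simp [pureWord, prodOp]
  | [], [y] =>
    simp only [pureWord, prodOp, List.map_nil, List.nil_append, List.map_cons, neg_mul, map_neg,
      slice_mul_pure, slice_koszul]
  | [x], [] =>
    simp only [pureWord, prodOp, List.map_nil, List.nil_append, List.cons_append, List.map_cons,
      neg_mul, map_neg, koszul_pure, slice_pure_mul]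
  | [_], _ :: _ => simp [pureWord, prodOp]
  | [], _ :: _ :: _ => simp [pureWord, prodOp]
  | _ :: _ :: _, _ => simp [pureWord, prodOp]

theorem prodOp_pure (x : List E) : prodOp (fun i => (𝒜 i).baseChange R) (pureWord R x) =
    1 ⊗ₜ prodOp 𝒜 x := by
  match x with
  | [] => simp [pureWord, prodOp]
  | [_] => simp [pureWord, prodOp]
  | [x, y] => simp [pureWord, prodOp, koszul_pure, tmul_neg]
  | _ :: _ :: _ :: _ => simp [pureWord, prodOp]

variable {θ : E → E} {θ' : R ⊗[k] E → R ⊗[k] E} (hθ : ∀ x, θ' (1 ⊗ₜ x) = 1 ⊗ₜ θ x)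
include hθ

theorem slice_insert_prodOp_left (l : R →ₗ[k] k) (c : Ops R (R ⊗[k] E)) (x : List E) :
    slice E l (insertSum θ' (prodOp fun i => (𝒜 i).baseChange R) c.ev (pureWord R x)) =
      insertSum θ (prodOp 𝒜) (c.slice l).ev x := by
  simp only [insertSum, map_sum, pureWord, List.length_map]
  refine Finset.sum_congr rfl fun r _ => Finset.sum_congr rfl fun s _ => ?_
  rw [Ops.slice_ev, ← slice_prodOp]
  simp only [pureWord, List.map_take, List.map_drop, List.map_map]
  congr 5
  funext a
  exact hθ a

theorem slice_insert_prodOp_right (l : R →ₗ[k] k) (c : Ops R (R ⊗[k] E)) (x : List E) :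
    slice E l (insertSum θ' c.ev (prodOp fun i => (𝒜 i).baseChange R) (pureWord R x)) =
      insertSum θ (c.slice l).ev (prodOp 𝒜) x := by
  simp only [insertSum, map_sum, pureWord, List.length_map]
  refine Finset.sum_congr rfl fun r _ => Finset.sum_congr rfl fun s _ => ?_
  rw [Ops.slice_ev, ← List.map_drop, ← List.map_take, ← List.map_take, ← List.map_drop]
  have := prodOp_pure (R := R) 𝒜 ((x.drop r).take s)
  rw [pureWord] at this
  rw [this]
  simp only [pureWord, List.map_append, List.map_cons, List.map_take, List.map_drop, List.map_map]
  congr 5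
  funext a
  exact hθ a

end Insert

theorem slice_hochschildOps (𝒜 : ℤ → Submodule k E) [GradedAlgebra 𝒜] (l : R →ₗ[k] k)
    (c : Ops R (R ⊗[k] E)) : (hochschildOps (fun i => (𝒜 i).baseChange R) c).slice l =
      hochschildOps 𝒜 (c.slice l) :=
  Ops.ext_ev fun x => by
    rw [Ops.slice_ev, hochschildOps_ev, hochschildOps_ev, hochschild, map_sub,
      slice_insert_prodOp_left 𝒜 (θ := id) (fun _ => rfl),
      slice_insert_prodOp_right 𝒜 (koszul_pure 𝒜)]
    rfl

end Slices

/-! ### Cochains over `R` and their slices -/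

section SliceCochain

variable {k E : Type*} [Field k] [Ring E] [Algebra k E]
  {R : Type*} [CommRing R] [Algebra k R] {𝒜 : ℤ → Submodule k E} [GradedAlgebra 𝒜]
  {V : Type*} {e : V → E}

theorem IsCochain.slice {d : ℤ} {q : ℕ} {c : Ops R (R ⊗[k] E)}
    (hc : IsCochain (fun i => (𝒜 i).baseChange R) (fun v => (1 : R) ⊗ₜ[k] e v) d q c)
    (l : R →ₗ[k] k) : IsCochain 𝒜 e d q (c.slice l) where
  degree w ds hq hw := by
    rw [Ops.slice_ev]
    have := hc.degree (pureWord R w) ds (by simpa [pureWord] using hq)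
      (List.forall₂_map_left_iff.2 (hw.imp fun a i h => Submodule.tmul_mem_baseChange_of_mem _ h))
    simp only [pureWord, List.length_map] at this
    exact slice_mem this l
  balanced v u x y w hq := by
    have := hc.balanced v (pureWord R u) (1 ⊗ₜ x) (1 ⊗ₜ y) (pureWord R w)
      (by simpa [pureWord] using hq)
    rw [Ops.slice_ev, Ops.slice_ev]
    simpa [pureWord] using congrArg (AInf.slice E l) this
  left v x w hq := by
    have := hc.left v (1 ⊗ₜ x) (pureWord R w) (by simpa [pureWord] using hq)
    rw [Ops.slice_ev, Ops.slice_ev, ← slice_pure_mul]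
    simpa [pureWord] using congrArg (AInf.slice E l) this
  right v u x hq := by
    have := hc.right v (pureWord R u) (1 ⊗ₜ x) (by simpa [pureWord] using hq)
    rw [Ops.slice_ev, Ops.slice_ev, ← slice_mul_pure]
    simpa [pureWord] using congrArg (AInf.slice E l) this
  normalized v u w hq := by
    have := hc.normalized v (pureWord R u) (pureWord R w) (by simpa [pureWord] using hq)
    rw [Ops.slice_ev]
    simpa [pureWord] using congrArg (AInf.slice E l) this

theorem slot_eq_zero_of_pureWord {B : Type*} [AddCommGroup B] [Module R B]
    {G : List (R ⊗[k] E) → List (R ⊗[k] E) → B}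
    (h1 : ∀ w, IsMultilin (R := R) (fun u => G u w)) (h2 : ∀ u, IsMultilin (R := R) (G u))
    {n n' : ℕ} (h : ∀ x y : List E, x.length = n → y.length = n' →
      G (pureWord R x) (pureWord R y) = 0) (u w : List (R ⊗[k] E)) (hu : u.length = n)
    (hw : w.length = n') : G u w = 0 :=
  eq_zero_of_pureWord (h1 w) n (fun x hx => eq_zero_of_pureWord (h2 _) n'
    (fun y hy => h x y hx hy) w hw) u hu

/-- The conditions are multilinear, so words of pure tensors suffice, and there slices detect them.
With `IsCochain.slice` this reduces linear statements over `R` to the field `k`. -/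
theorem IsCochain.of_slice {d : ℤ} {q : ℕ} {c : Ops R (R ⊗[k] E)}
    (h : ∀ l : R →ₗ[k] k, IsCochain 𝒜 e d q (c.slice l)) :
    IsCochain (fun i => (𝒜 i).baseChange R) (fun v => (1 : R) ⊗ₜ[k] e v) d q c := by
  have hm := c.isMultilin
  constructor
  · intro w ds hq hw
    have hl := hw.length_eq
    refine hm.mem_of_span ((fun i => (𝒜 i).baseChange R) (ds.sum + d - w.length))
      (ds.map fun i => (fun x : E => (1 : R) ⊗ₜ[k] x) '' (𝒜 i : Set E)) (fun y hy => ?_) w ?_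
    · rw [List.forall₂_map_right_iff] at hy
      obtain ⟨x, rfl, hx⟩ := forall₂_image (fun x : E => (1 : R) ⊗ₜ[k] x)
          (fun i => (𝒜 i : Set E)) hy
      have hxl := hx.length_eq
      refine mem_baseChange_of_slice fun l => ?_
      have := (h l).degree x ds (by omega) hx
      rwa [Ops.slice_ev, hxl, ← hl] at this
    · rw [List.forall₂_map_right_iff]
      refine hw.imp fun a i ha => ?_
      rw [Submodule.baseChange_eq_span] at ha
      exact ha
  · intro v u x y w hq
    rw [← sub_eq_zero]
    refine slot_eq_zero_of_pureWord (G := fun u w => c.ev (u ++ (x * 1 ⊗ₜ[k] e v) :: y :: w) -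
      c.ev (u ++ x :: (1 ⊗ₜ[k] e v * y) :: w)) (fun w => (hm.append _).sub (hm.append _))
      (fun u => IsMultilin.sub (by simpa using hm.prepend (u ++ [x * 1 ⊗ₜ[k] e v, y]))
        (by simpa using hm.prepend (u ++ [x, 1 ⊗ₜ[k] e v * y]))) (fun u' w' hu hw => ?_) u w rfl rfl
    set U : List (R ⊗[k] E) := pureWord R u' with hU
    set W : List (R ⊗[k] E) := pureWord R w' with hW
    refine eq_zero_of_pure ((hm.slot U (y :: W)).comp (LinearMap.mulRight R (1 ⊗ₜ[k] e v)) -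
      hm.slot U ((1 ⊗ₜ[k] e v * y) :: W)) (fun x => ?_) x
    have key := fun hyp => eq_zero_of_pure
      ((hm.slot (U ++ [(1 ⊗ₜ[k] x : R ⊗[k] E) * 1 ⊗ₜ[k] e v]) W) -
      (hm.slot (U ++ [(1 ⊗ₜ[k] x : R ⊗[k] E)]) W).comp (LinearMap.mulLeft R (1 ⊗ₜ[k] e v)))
      hyp y
    have h := key fun y => by
      have : c.ev (pureWord R (u' ++ (x * e v) :: y :: w')) =
          c.ev (pureWord R (u' ++ x :: (e v * y) :: w')) := eq_of_slice fun l => by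
        rw [← Ops.slice_ev, ← Ops.slice_ev]
        exact (h l).balanced v u' x y w' (by simp at hq ⊢; omega)
      simpa [IsMultilin.slot, hU, hW, sub_eq_zero, pureWord] using this
    simpa [IsMultilin.slot, sub_eq_zero] using h
  · intro v x w hq
    rw [← sub_eq_zero]
    refine eq_zero_of_pureWord (F := fun w => c.ev ((1 ⊗ₜ[k] e v * x) :: w) -
      LinearMap.mulLeft R (1 ⊗ₜ[k] e v) (c.ev (x :: w)))
      (IsMultilin.sub (hm.prepend [_]) ((hm.prepend [x]).comp _)) w.length (fun w' hw => ?_) w rfl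
    set W : List (R ⊗[k] E) := pureWord R w' with hW
    refine eq_zero_of_pure ((hm.slot [] W).comp (LinearMap.mulLeft R (1 ⊗ₜ[k] e v)) -
      (LinearMap.mulLeft R (1 ⊗ₜ[k] e v)).comp (hm.slot [] W)) (fun x => ?_) x
    have : c.ev (pureWord R ((e v * x) :: w')) = 1 ⊗ₜ e v * c.ev (pureWord R (x :: w')) :=
      eq_of_slice fun l => by
        rw [slice_pure_mul, ← Ops.slice_ev, ← Ops.slice_ev]
        exact (h l).left v x w' (by simp at hq ⊢; omega)
    simpa [IsMultilin.slot, hW, sub_eq_zero, pureWord] using this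
  · intro v u x hq
    rw [← sub_eq_zero]
    refine eq_zero_of_pureWord (F := fun u => c.ev (u ++ [x * 1 ⊗ₜ[k] e v]) -
      LinearMap.mulRight R (1 ⊗ₜ[k] e v) (c.ev (u ++ [x])))
      (IsMultilin.sub (hm.append [_]) ((hm.append [x]).comp _)) u.length (fun u' hu => ?_) u rfl
    set U : List (R ⊗[k] E) := pureWord R u' with hU
    refine eq_zero_of_pure ((hm.slot U []).comp (LinearMap.mulRight R (1 ⊗ₜ[k] e v)) -
      (LinearMap.mulRight R (1 ⊗ₜ[k] e v)).comp (hm.slot U [])) (fun x => ?_) x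
    have : c.ev (pureWord R (u' ++ [x * e v])) = c.ev (pureWord R (u' ++ [x])) * 1 ⊗ₜ e v :=
      eq_of_slice fun l => by
        rw [slice_mul_pure, ← Ops.slice_ev, ← Ops.slice_ev]
        exact (h l).right v u' x (by simp at hq ⊢; omega)
    simpa [IsMultilin.slot, hU, sub_eq_zero, pureWord] using this
  · intro v u w hq
    refine slot_eq_zero_of_pureWord (G := fun u w => c.ev (u ++ (1 ⊗ₜ[k] e v) :: w))
      (fun w => hm.append _) (fun u => (hm.prepend u).tail _)
      (fun u' w' hu hw => ?_) u w rfl rfl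
    have : c.ev (pureWord R (u' ++ e v :: w')) = 0 := eq_of_slice fun l => by
        rw [← Ops.slice_ev, map_zero]
        exact (h l).normalized v u' w' (by simp at hq ⊢; omega)
    simpa [pureWord] using this

end SliceCochain

end AInf

namespace AInf

/-! ### Coordinates of operations over an extension of scalars -/

section Coordinates

variable {k E : Type*} [Field k] [Ring E] [Algebra k E]
  {R : Type*} [CommRing R] [Algebra k R] {ι : Type*} [Fintype ι] [DecidableEq ι]

/-- The extension of a multilinear map on `E` to `R ⊗ E`. -/
noncomputable def scalarExt (R : Type*) [CommRing R] [Algebra k R] {p : ℕ}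
    (y : MultilinearMap k (fun _ : Fin p => E) E) :
    MultilinearMap R (fun _ : Fin p => R ⊗[k] E) (R ⊗[k] E) :=
  extendScalars p
    ((Algebra.TensorProduct.includeRight : E →ₐ[k] R ⊗[k] E).toLinearMap.compMultilinearMap y)

theorem scalarExt_apply {p : ℕ} (y : MultilinearMap k (fun _ : Fin p => E) E) (a : Fin p → E) :
    scalarExt R y (fun i => 1 ⊗ₜ a i) = 1 ⊗ₜ y a := extendScalars_apply _ _ _

/-- The multilinear map that sends one word in the basis to a given basis element, and the other
words in the basis to zero. -/
noncomputable def elementary (b : Module.Basis ι k E) {p : ℕ} (I : Fin p → ι) (j : ι) :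
    MultilinearMap k (fun _ : Fin p => E) E :=
  (MultilinearMap.mkPiRing k (Fin p) (b j)).compLinearMap fun i => b.coord (I i)

theorem elementary_apply (b : Module.Basis ι k E) {p : ℕ} (I J : Fin p → ι) (j : ι) :
    elementary b I j (fun i => b (J i)) = if I = J then b j else 0 := by
  simp only [elementary, MultilinearMap.compLinearMap_apply, MultilinearMap.mkPiRing_apply,
    Module.Basis.coord_apply, Module.Basis.repr_self, Finsupp.single_apply]
  split_ifs with h
  · simp [h]
  · obtain ⟨i, hi⟩ := Function.ne_iff.1 h
    rw [Finset.prod_eq_zero (Finset.mem_univ i) (if_neg fun h' => hi h'.symm), zero_smul]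

/-- The coordinates of a family of operations on `R ⊗ E`. -/
noncomputable def Ops.coord (b : Module.Basis ι k E) (c : Ops R (R ⊗[k] E)) :
    (Σ p : ℕ, (Fin p → ι) × ι) → R := fun x =>
  (b.baseChange R).repr (c x.1 fun i => 1 ⊗ₜ b (x.2.1 i)) x.2.2

/-- The family of operations with given coordinates. -/
noncomputable def Ops.ofCoord (b : Module.Basis ι k E) (x : (Σ p : ℕ, (Fin p → ι) × ι) → R) :
    Ops R (R ⊗[k] E) := fun p =>
  ∑ I : Fin p → ι, ∑ j, x ⟨p, I, j⟩ • scalarExt R (elementary b I j)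

theorem Ops.ofCoord_apply (b : Module.Basis ι k E) (x : (Σ p : ℕ, (Fin p → ι) × ι) → R) {p : ℕ}
    (I : Fin p → ι) : Ops.ofCoord b x p (fun i => 1 ⊗ₜ b (I i)) =
      ∑ j, x ⟨p, I, j⟩ • b.baseChange R j := by
  simp only [Ops.ofCoord, sum_apply, smul_apply, scalarExt_apply,
    elementary_apply]
  rw [Finset.sum_eq_single I]
  · simp [Module.Basis.baseChange_apply]
  · intro J _ hJ
    simp [hJ]
  · simp

theorem Ops.coord_ofCoord (b : Module.Basis ι k E) (x : (Σ p : ℕ, (Fin p → ι) × ι) → R) :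
    (Ops.ofCoord b x).coord b = x := by
  funext ⟨p, I, j⟩
  simp only [Ops.coord, Ops.ofCoord_apply]
  rw [Module.Basis.repr_sum_self]

theorem Ops.ofCoord_coord (b : Module.Basis ι k E) (c : Ops R (R ⊗[k] E)) :
    Ops.ofCoord b (c.coord b) = c := by
  funext p
  refine Module.Basis.ext_multilinear (fun _ => b.baseChange R) fun I => ?_
  simp only [Module.Basis.baseChange_apply, Ops.ofCoord_apply, Ops.coord]
  simpa only [Module.Basis.baseChange_apply] using
    (b.baseChange R).sum_repr (c p fun i => 1 ⊗ₜ b (I i))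

theorem Ops.coord_map {R' : Type*} [CommRing R'] [Algebra k R'] (b : Module.Basis ι k E)
    (φ : R →ₐ[k] R') (c : Ops R (R ⊗[k] E)) (x : Σ p : ℕ, (Fin p → ι) × ι) :
    (c.map φ).coord b x = φ (c.coord b x) := by
  obtain ⟨p, I, j⟩ := x
  simp only [Ops.coord]
  rw [← repr_coeffMap]
  congr 2
  exact extendScalars_apply _ _ _

theorem slice_sum_scalarExt {p : ℕ} {α : Type*} (s : Finset α) (l : R →ₗ[k] k) (r : α → R)
    (y : α → MultilinearMap k (fun _ : Fin p => E) E) (a : Fin p → E) :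
    slice E l ((∑ t ∈ s, r t • scalarExt R (y t)) fun i => 1 ⊗ₜ a i) =
      (∑ t ∈ s, l (r t) • y t) a := by
  simp only [sum_apply, smul_apply, scalarExt_apply, map_sum]
  refine Finset.sum_congr rfl fun t _ => ?_
  simp [TensorProduct.smul_tmul']

theorem Ops.slice_eq_sum (b : Module.Basis ι k E) (l : R →ₗ[k] k) (c : Ops R (R ⊗[k] E)) (p : ℕ) :
    c.slice l p = ∑ t : (Fin p → ι) × ι, l (c.coord b ⟨p, t⟩) • elementary b t.1 t.2 := by
  ext a
  rw [← slice_sum_scalarExt]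
  conv_lhs => rw [← Ops.ofCoord_coord b c]
  simp only [Fintype.sum_prod_type]
  rfl

/-- Lower the arity of operations by linear maps `T`. -/
def Ops.lower (T : ∀ p : ℕ, MultilinearMap k (fun _ : Fin (p + 1) => E) E →ₗ[k]
    MultilinearMap k (fun _ : Fin p => E) E) (c : Ops k E) : Ops k E := fun p => T p (c (p + 1))

/-- The extension of `Ops.lower` to `R ⊗ E`. -/
noncomputable def Ops.lowerExt (b : Module.Basis ι k E)
    (T : ∀ p : ℕ, MultilinearMap k (fun _ : Fin (p + 1) => E) E →ₗ[k]
      MultilinearMap k (fun _ : Fin p => E) E) (c : Ops R (R ⊗[k] E)) : Ops R (R ⊗[k] E) := fun p =>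
  ∑ t : (Fin (p + 1) → ι) × ι, c.coord b ⟨p + 1, t⟩ • scalarExt R (T p (elementary b t.1 t.2))

/-- Slices determine the extension, which is therefore independent of the basis and natural in `R`.
Identities for `T` over `k` pass to `R` in the same way. -/
theorem Ops.slice_lowerExt (b : Module.Basis ι k E)
    (T : ∀ p : ℕ, MultilinearMap k (fun _ : Fin (p + 1) => E) E →ₗ[k]
      MultilinearMap k (fun _ : Fin p => E) E) (c : Ops R (R ⊗[k] E)) (l : R →ₗ[k] k) :
    (Ops.lowerExt b T c).slice l = Ops.lower T (c.slice l) := by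
  funext p
  ext a
  rw [Ops.lower, Ops.slice_eq_sum b l c (p + 1), map_sum]
  simp only [map_smul]
  exact slice_sum_scalarExt _ l _ _ a

end Coordinates

/-! ### Pseudo-inverses over the ground field -/

section PseudoInverse

/-- Compose a projection onto the range of `D` with a linear section of `D` over its range. -/
theorem exists_pseudoInverse {k U W : Type*} [Field k] [AddCommGroup U] [Module k U]
    [AddCommGroup W] [Module k W] (D : U →ₗ[k] W) :
    ∃ s : W →ₗ[k] U, (∀ x, D (s (D x)) = D x) ∧ ∀ y, s (D (s y)) = s y := by
  obtain ⟨r, hr⟩ := LinearMap.exists_rightInverse_of_surjective D.rangeRestrict D.range_rangeRestrict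
  obtain ⟨P, hP⟩ := LinearMap.exists_extend (LinearMap.id : D.range →ₗ[k] D.range)
  have hr' : ∀ z : D.range, D (r z) = z := fun z => congrArg Subtype.val (LinearMap.congr_fun hr z)
  have hP' : ∀ z : D.range, P z = z := fun z => LinearMap.congr_fun hP z
  refine ⟨r ∘ₗ P, fun x => ?_, fun y => ?_⟩
  · have := hP' ⟨D x, x, rfl⟩
    simp only [LinearMap.comp_apply]
    rw [this, hr']
  · simp only [LinearMap.comp_apply]
    rw [hr', hP']

variable {k E : Type*} [Field k] [Ring E] [Algebra k E] {𝒜 : ℤ → Submodule k E}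
  [GradedAlgebra 𝒜] {V : Type*} {e : V → E}

theorem Ops.ev_congr {R A : Type*} [CommRing R] [Ring A] [Algebra R A] {c c' : Ops R A}
    {w : List A} (h : c w.length = c' w.length) : c.ev w = c'.ev w := by
  rw [Ops.ev, Ops.ev, h]

theorem isCochain_of_single {d : ℤ} {q : ℕ} {c : Ops k E}
    (h : ∀ p, IsCochain 𝒜 e d q (Pi.single p (c p))) : IsCochain 𝒜 e d q c := by
  have h1 : ∀ (p : ℕ) (w : List E), w.length = p → c.ev w =
      Ops.ev (Pi.single p (c p) : Ops k E) w := by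
    rintro _ w rfl
    exact Ops.ev_congr (by simp)
  constructor
  · intro w ds hq hw
    rw [h1 _ w rfl]
    exact (h _).degree w ds hq hw
  · intro v u x y w hq
    rw [h1 (u ++ x :: y :: w).length _ (by simp), h1 (u ++ x :: y :: w).length _ (by simp)]
    exact (h _).balanced v u x y w hq
  · intro v x w hq
    rw [h1 (x :: w).length _ (by simp), h1 (x :: w).length _ (by simp)]
    exact (h _).left v x w hq
  · intro v u x hq
    rw [h1 (u ++ [x]).length _ (by simp), h1 (u ++ [x]).length _ (by simp)]
    exact (h _).right v u x hq
  · intro v u w hq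
    rw [h1 _ _ rfl]
    exact (h _).normalized v u w hq

theorem IsCochain.single {d : ℤ} {q : ℕ} {c : Ops k E} (hc : IsCochain 𝒜 e d q c) (p : ℕ) :
    IsCochain 𝒜 e d q (Pi.single p (c p)) := by
  have : (Pi.single p (c p) : Ops k E) = c.discard (· ≠ p) := by
    funext i
    by_cases h : i = p
    · subst h; simp [Ops.discard]
    · simp [Ops.discard, h]
  rw [this]
  exact hc.discard _

theorem IsCochain.zero {d : ℤ} {q : ℕ} : IsCochain 𝒜 e d q (0 : Ops k E) where
  degree _ _ _ _ := Submodule.zero_mem _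
  balanced _ _ _ _ _ _ := rfl
  left _ _ _ _ := (mul_zero _).symm
  right _ _ _ _ := (zero_mul _).symm
  normalized _ _ _ _ := rfl

theorem IsCochain.add {d : ℤ} {q : ℕ} {c c' : Ops k E} (hc : IsCochain 𝒜 e d q c)
    (hc' : IsCochain 𝒜 e d q c') : IsCochain 𝒜 e d q (c + c') where
  degree w ds h h' := Submodule.add_mem _ (hc.degree w ds h h') (hc'.degree w ds h h')
  balanced v u x y w h := by
    rw [Ops.ev_add, Ops.ev_add, hc.balanced v u x y w h, hc'.balanced v u x y w h]
  left v x w h := by rw [Ops.ev_add, Ops.ev_add, hc.left v x w h, hc'.left v x w h, mul_add]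
  right v u x h := by rw [Ops.ev_add, Ops.ev_add, hc.right v u x h, hc'.right v u x h, add_mul]
  normalized v u w h := by
    rw [Ops.ev_add, hc.normalized v u w h, hc'.normalized v u w h, add_zero]

theorem Ops.ev_smul (r : k) (c : Ops k E) (w : List E) : (r • c).ev w = r • c.ev w := rfl

theorem IsCochain.smul {d : ℤ} {q : ℕ} {c : Ops k E} (hc : IsCochain 𝒜 e d q c) (r : k) :
    IsCochain 𝒜 e d q (r • c) where
  degree w ds h h' := Submodule.smul_mem _ r (hc.degree w ds h h')
  balanced v u x y w h := by rw [Ops.ev_smul, Ops.ev_smul, hc.balanced v u x y w h]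
  left v x w h := by rw [Ops.ev_smul, Ops.ev_smul, hc.left v x w h, mul_smul_comm]
  right v u x h := by rw [Ops.ev_smul, Ops.ev_smul, hc.right v u x h, smul_mul_assoc]
  normalized v u w h := by rw [Ops.ev_smul, hc.normalized v u w h, smul_zero]

variable (𝒜 e) in
/-- The cochains of arity `p` (all multilinear maps if `p < q`). -/
def cochainSubmodule (d : ℤ) (q p : ℕ) : Submodule k (MultilinearMap k (fun _ : Fin p => E) E) where
  carrier := {x | IsCochain 𝒜 e d q (Pi.single p x)}
  add_mem' {x y} hx hy := by
    have := IsCochain.add hx hy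
    rwa [← Pi.single_add] at this
  zero_mem' := by
    have := IsCochain.zero (𝒜 := 𝒜) (e := e) (d := d) (q := q)
    rwa [← Pi.single_zero p] at this
  smul_mem' r x hx := by
    have := IsCochain.smul hx r
    rwa [← Pi.single_smul] at this

/-- A linear operator that raises the arity of cochains by one has a pseudo-inverse that lowers the
arity by one. -/
theorem exists_lower (D : Ops k E →ₗ[k] Ops k E)
    (hD : ∀ p c c', c p = c' p → D c (p + 1) = D c' (p + 1)) (hD0 : ∀ c, D c 0 = 0) (d : ℤ)
    (q : ℕ) : ∃ T : ∀ p : ℕ, MultilinearMap k (fun _ : Fin (p + 1) => E) E →ₗ[k]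
      MultilinearMap k (fun _ : Fin p => E) E, (∀ p < q, T p = 0) ∧
        (∀ c, IsCochain 𝒜 e d 1 (Ops.lower T c)) ∧
        (∀ c, IsCochain 𝒜 e d 1 c → (∀ p < q, c p = 0) → D (Ops.lower T (D c)) = D c) ∧
        ∀ c, Ops.lower T (D (Ops.lower T c)) = Ops.lower T c := by
  -- The operator is restricted to cochains of one arity, so that its pseudo-inverse takes values in
  -- cochains.
  let Dp (p : ℕ) : cochainSubmodule 𝒜 e d 1 p →ₗ[k] MultilinearMap k (fun _ : Fin (p + 1) => E) E :=
    LinearMap.proj (p + 1) ∘ₗ D ∘ₗ LinearMap.single k _ p ∘ₗ (cochainSubmodule 𝒜 e d 1 p).subtype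
  have hDp : ∀ p c (h : c p ∈ cochainSubmodule 𝒜 e d 1 p), Dp p ⟨c p, h⟩ = D c (p + 1) :=
    fun p c h => hD p _ _ (by simp)
  choose s hs1 hs2 using fun p => exists_pseudoInverse (k := k)
    (U := cochainSubmodule 𝒜 e d 1 p) (W := MultilinearMap k (fun _ : Fin (p + 1) => E) E) (Dp p)
  let T (p : ℕ) : MultilinearMap k (fun _ : Fin (p + 1) => E) E →ₗ[k]
      MultilinearMap k (fun _ : Fin p => E) E :=
    if p < q then 0 else (cochainSubmodule 𝒜 e d 1 p).subtype ∘ₗ s p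
  have hT0 : ∀ p < q, T p = 0 := fun p hp => if_pos hp
  have hT1 : ∀ p, ¬ p < q → ∀ x, T p x = s p x := fun p hp x => by
    simp only [T, if_neg hp]; rfl
  have hTc : ∀ p x, T p x ∈ cochainSubmodule 𝒜 e d 1 p := fun p x => by
    by_cases hp : p < q
    · rw [hT0 p hp]; exact Submodule.zero_mem _
    · rw [hT1 p hp]; exact (s p x).2
  have hTl : ∀ p c, Ops.lower T c p ∈ cochainSubmodule 𝒜 e d 1 p := fun p c => hTc p _
  refine ⟨T, hT0, fun c => isCochain_of_single fun p => hTc p _, fun c hc hcq => ?_, fun c => ?_⟩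
  · funext p
    cases p with
    | zero => rw [hD0, hD0]
    | succ p =>
      by_cases hp : p < q
      · refine hD p _ _ ?_
        rw [Ops.lower, hT0 p hp, hcq p hp]; rfl
      · rw [← hDp p _ (hTl p _)]
        have : (⟨Ops.lower T (D c) p, hTl p _⟩ : cochainSubmodule 𝒜 e d 1 p) =
            s p (Dp p ⟨c p, hc.single p⟩) := by
          rw [hDp p c (hc.single p)]
          exact Subtype.ext (hT1 p hp _)
        rw [this, hs1]
        exact hDp p c (hc.single p)
  · funext p
    change T p (D (Ops.lower T c) (p + 1)) = T p (c (p + 1))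
    rw [← hDp p _ (hTl p _)]
    by_cases hp : p < q
    · rw [hT0 p hp]; rfl
    · have : (⟨Ops.lower T c p, hTl p _⟩ : cochainSubmodule 𝒜 e d 1 p) = s p (c (p + 1)) :=
        Subtype.ext (hT1 p hp _)
      rw [this, hT1 p hp, hT1 p hp, hs2]

end PseudoInverse

/-! ### Natural splittings and base change of `HH^1` -/

section Extension

variable {k E : Type*} [Field k] [Ring E] [Algebra k E] [FiniteDimensional k E]
  (𝒜 : ℤ → Submodule k E) [GradedAlgebra 𝒜] {V : Type*} (e : V → E)

theorem hochschildOps_zero_arity {R A : Type*} [CommRing R] [Ring A] [Algebra R A]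
    (𝒜 : ℤ → Submodule R A) [GradedAlgebra 𝒜] (c : Ops R A) : hochschildOps 𝒜 c 0 = 0 := by
  ext a
  rw [← Ops.ev_ofFn, hochschildOps_ev]
  simp [hochschild, insertSum]

theorem insertSum_smul_right {R A : Type*} [CommRing R] [Ring A] [Algebra R A] (θ : A → A)
    {b : List A → A} (hb : IsMultilin (R := R) b) (r : R) (c : List A → A) (w : List A) :
    insertSum θ b (fun v => r • c v) w = r • insertSum θ b c w := by
  simp only [insertSum, hb.smul, Finset.smul_sum]

theorem insertSum_smul_left {R A : Type*} [CommRing R] [Ring A] [Algebra R A] (θ : A → A)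
    (b : List A → A) (r : R) (c : List A → A) (w : List A) :
    insertSum θ (fun v => r • b v) c w = r • insertSum θ b c w := by
  simp only [insertSum, Finset.smul_sum]

theorem insertSum_add_right {R A : Type*} [CommRing R] [Ring A] [Algebra R A] (θ : A → A)
    {b : List A → A} (hb : IsMultilin (R := R) b) (c c' : List A → A) (w : List A) :
    insertSum θ b (fun v => c v + c' v) w = insertSum θ b c w + insertSum θ b c' w := by
  simp only [insertSum, hb.add, Finset.sum_add_distrib]

theorem insertSum_add_left {A : Type*} [Ring A] (θ : A → A)
    (b b' : List A → A) (c : List A → A) (w : List A) :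
    insertSum θ (fun v => b v + b' v) c w = insertSum θ b c w + insertSum θ b' c w := by
  simp only [insertSum, Finset.sum_add_distrib]

/-- The Hochschild differential on even cochains over the ground field, as a linear map. -/
noncomputable def hochschildLinear : Ops k E →ₗ[k] Ops k E where
  toFun := hochschildOps 𝒜
  map_add' := hochschildOps_add
  map_smul' r c := Ops.ext_ev fun w => by
    have h : (r • c).ev = fun v => r • c.ev v := rfl
    rw [RingHom.id_apply, Ops.ev_smul, hochschildOps_ev, hochschildOps_ev, hochschild, h,
      insertSum_smul_right _ (prodOp_isMultilin 𝒜), insertSum_smul_left, hochschild, smul_sub]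

/-- The Hochschild differential `[m₂, h]` of odd cochains. -/
noncomputable def hochschildOdd {R A : Type*} [CommRing R] [Ring A] [Algebra R A]
    (𝒜 : ℤ → Submodule R A) [GradedAlgebra 𝒜] (h : Ops R A) : Ops R A :=
  Ops.ofWord (fun w => insertSum (koszul 𝒜) (prodOp 𝒜) h.ev w +
    insertSum (koszul 𝒜) h.ev (prodOp 𝒜) w)
    ((insertSum_isMultilin (prodOp_isMultilin 𝒜) h.isMultilin).addFun
      (insertSum_isMultilin h.isMultilin (prodOp_isMultilin 𝒜)))

theorem hochschildOdd_ev {R A : Type*} [CommRing R] [Ring A] [Algebra R A]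
    (𝒜 : ℤ → Submodule R A) [GradedAlgebra 𝒜] (h : Ops R A) (w : List A) :
    (hochschildOdd 𝒜 h).ev w = insertSum (koszul 𝒜) (prodOp 𝒜) h.ev w +
      insertSum (koszul 𝒜) h.ev (prodOp 𝒜) w := Ops.ofWord_ev _ _ w

/-- The Hochschild differential on odd cochains over the ground field, as a linear map. -/
noncomputable def hochschildOddLinear : Ops k E →ₗ[k] Ops k E where
  toFun := hochschildOdd 𝒜
  map_add' c c' := Ops.ext_ev fun w => by
    have h : (c + c').ev = fun v => c.ev v + c'.ev v := rfl
    rw [Ops.ev_add, hochschildOdd_ev, hochschildOdd_ev, hochschildOdd_ev, h,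
      insertSum_add_right _ (prodOp_isMultilin 𝒜), insertSum_add_left]
    abel
  map_smul' r c := Ops.ext_ev fun w => by
    have h : (r • c).ev = fun v => r • c.ev v := rfl
    rw [RingHom.id_apply, Ops.ev_smul, hochschildOdd_ev, hochschildOdd_ev, h,
      insertSum_smul_right _ (prodOp_isMultilin 𝒜), insertSum_smul_left, smul_add]

theorem slice_hochschildOdd {R : Type*} [CommRing R] [Algebra k R] (l : R →ₗ[k] k)
    (c : Ops R (R ⊗[k] E)) : (hochschildOdd (fun i => (𝒜 i).baseChange R) c).slice l =
      hochschildOdd 𝒜 (c.slice l) :=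
  Ops.ext_ev fun x => by
    rw [Ops.slice_ev, hochschildOdd_ev, hochschildOdd_ev, map_add,
      slice_insert_prodOp_left 𝒜 (θ := koszul 𝒜) (koszul_pure 𝒜),
      slice_insert_prodOp_right 𝒜 (θ := koszul 𝒜) (koszul_pure 𝒜)]

theorem Ops.slice_add {R : Type*} [CommRing R] [Algebra k R] (l : R →ₗ[k] k)
    (c c' : Ops R (R ⊗[k] E)) : (c + c').slice l = c.slice l + c'.slice l :=
  Ops.ext_ev fun x => by
    rw [Ops.slice_ev, Ops.ev_add, Ops.ev_add, map_add, Ops.slice_ev, Ops.slice_ev]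

/-- The splittings of the Hochschild complexes over all commutative `k`-algebras that extend a
splitting over `k`. -/
theorem exists_splitting : ∃ S : ∀ (R : Type u) [CommRing R] [Algebra k R],
    Splitting (fun i => (𝒜 i).baseChange R) (fun v => (1 : R) ⊗ₜ[k] e v),
    ∀ (R R' : Type u) [CommRing R] [Algebra k R] [CommRing R'] [Algebra k R'] (φ : R →ₐ[k] R')
      (c : Ops R (R ⊗[k] E)), (S R').toHom (c.map φ) = ((S R).toHom c).map φ := by
  classical
  -- One choice over `k` serves all `R`, which makes the splittings natural. The bound is two
  -- because gauge transformations are the identity in arity one.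
  obtain ⟨T, h1, h2, h3, h4⟩ := exists_lower (𝒜 := 𝒜) (e := e) (hochschildLinear 𝒜)
    (fun p c c' h => hochschildOps_local h) (hochschildOps_zero_arity 𝒜) 1 2
  let b := Module.finBasis k E
  refine ⟨fun R _ _ =>
    { toHom := AddMonoidHom.mk' (Ops.lowerExt b T) fun c c' => Ops.eq_of_slice fun l => ?_
      localized := fun p c c' h => ?_
      low := fun p c hp => ?_
      cochain := fun c => .of_slice fun l => ?_
      left := fun c => Ops.eq_of_slice fun l => ?_
      right := fun c hc hc0 => Ops.eq_of_slice fun l => ?_ }, fun R R' _ _ _ _ φ c => ?_⟩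
  · rw [Ops.slice_lowerExt, Ops.slice_add, Ops.slice_add, Ops.slice_lowerExt, Ops.slice_lowerExt]
    funext p
    exact map_add (T p) _ _
  · change Ops.lowerExt b T c p = Ops.lowerExt b T c' p
    simp only [Ops.lowerExt, Ops.coord, h]
  · change Ops.lowerExt b T c p = 0
    rw [Ops.lowerExt, h1 p hp]
    refine Finset.sum_eq_zero fun t _ => ?_
    have : (c.coord b ⟨p + 1, t⟩ • scalarExt R (0 : MultilinearMap k (fun _ : Fin p => E) E)) =
        0 := by
      simp only [scalarExt, LinearMap.compMultilinearMap_zero, map_zero, smul_zero]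
    exact this
  · change IsCochain 𝒜 e 1 1 (Ops.slice l (Ops.lowerExt b T c))
    rw [Ops.slice_lowerExt]
    exact h2 _
  · change Ops.slice l (Ops.lowerExt b T (hochschildOps _ (Ops.lowerExt b T c))) =
      Ops.slice l (Ops.lowerExt b T c)
    rw [Ops.slice_lowerExt, slice_hochschildOps, Ops.slice_lowerExt]
    exact h4 _
  · change Ops.slice l (hochschildOps _ (Ops.lowerExt b T (hochschildOps _ c))) = _
    rw [slice_hochschildOps, Ops.slice_lowerExt, slice_hochschildOps]
    refine h3 _ (hc.slice l) fun p hp => ?_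
    ext a
    simp [Ops.slice, hc0 p hp]
  · refine Ops.eq_of_slice fun l => ?_
    change Ops.slice l (Ops.lowerExt b T (c.map φ)) = Ops.slice l ((Ops.lowerExt b T c).map φ)
    rw [Ops.slice_lowerExt, Ops.slice_coeff, Ops.slice_coeff, Ops.slice_lowerExt]

variable {𝒜 e}

theorem hochschildOdd_local {R A : Type*} [CommRing R] [Ring A] [Algebra R A]
    {𝒜 : ℤ → Submodule R A} [GradedAlgebra 𝒜] {c c' : Ops R A} {p : ℕ} (h : c p = c' p) :
    hochschildOdd 𝒜 c (p + 1) = hochschildOdd 𝒜 c' (p + 1) := by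
  ext a
  rw [← Ops.ev_ofFn, ← Ops.ev_ofFn, hochschildOdd_ev, hochschildOdd_ev]
  have h' : ∀ v : List A, v.length + 1 = (List.ofFn a).length → c.ev v = c'.ev v := fun v hv => by
    have hv : v.length = p := by simpa using hv
    rw [Ops.ev_eq _ _ hv, Ops.ev_eq _ _ hv, h]
  rw [insertSum_prodOp_congr h', insertSum_prodOp_congr' c.isMultilin c'.isMultilin h']

/-- The vanishing of `HH^1` is inherited by extensions of scalars. -/
theorem HH1Vanishes.baseChange {i : ℕ} (h : HH1Vanishes 𝒜 e i) (R : Type*) [CommRing R]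
    [Algebra k R] : HH1Vanishes (fun i => (𝒜 i).baseChange R) (fun v => (1 : R) ⊗ₜ[k] e v) i := by
  classical
  obtain ⟨T, -, h2, h3, -⟩ := exists_lower (𝒜 := 𝒜) (e := e) (hochschildOddLinear 𝒜)
    (fun p c c' h => hochschildOdd_local h) (fun c => by
      ext a
      change hochschildOdd 𝒜 c 0 a = 0
      rw [← Ops.ev_ofFn, hochschildOdd_ev]
      simp [insertSum]) 0 0
  let b := Module.finBasis k E
  intro f hf0 hfc hcl
  -- Each slice of `f` is a coboundary, but these primitives need not be linear in `l`. The
  -- pseudo-inverse provides linear ones, which assemble to a cochain over `R`.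
  have key : ∀ l : R →ₗ[k] k, ∃ g : Ops k E, IsCochain 𝒜 e 0 1 g ∧ f.slice l = hochschildOdd 𝒜 g := by
    intro l
    obtain ⟨g, -, hg, hfg⟩ := h (f.slice l) (fun p hp => by ext a; simp [Ops.slice, hf0 p hp])
      (hfc.slice l) (fun w => by
        have h5 : (hochschildOps (fun i => (𝒜 i).baseChange R) f).slice l =
            (0 : Ops R (R ⊗[k] E)).slice l := by
          congr 1
          exact Ops.ext_ev fun w => by rw [hochschildOps_ev]; exact hcl w
        rw [slice_hochschildOps] at h5
        have h6 := congrArg (fun c => Ops.ev c w) h5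
        simp only [hochschildOps_ev] at h6
        refine h6.trans ?_
        rw [Ops.slice_ev, Ops.ev_zero, map_zero])
    exact ⟨g, hg, Ops.ext_ev fun w => by rw [hochschildOdd_ev, hfg]⟩
  refine ⟨Ops.lowerExt b T f, fun p hp => ?_, .of_slice fun l => ?_, fun w => ?_⟩
  · have : f (p + 1) = 0 := hf0 _ (by omega)
    simp [Ops.lowerExt, Ops.coord, this]
  · rw [Ops.slice_lowerExt]
    exact h2 _
  · rw [← hochschildOdd_ev]
    congr 1
    refine Ops.eq_of_slice fun l => ?_
    obtain ⟨g, hg, hfg⟩ := key l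
    rw [slice_hochschildOdd, Ops.slice_lowerExt, hfg]
    exact (h3 g hg fun p hp => by omega).symm

end Extension

end AInf

namespace AInf

/-! ### Corepresentability -/

section ClosedSubfunctors

variable {k : Type u} [Field k]

/-- A closed subfunctor of a corepresentable functor is corepresentable. -/
theorem isCorepresentable_of_closed {F G : CommAlgCat.{u} k ⥤ Type u} (i : G ⟶ F)
    (hi : ∀ R, Function.Injective (i.app R)) (hF : F.IsCorepresentable)
    (hcl : ∀ (R : CommAlgCat.{u} k) (x : F.obj R), ∃ I : Ideal R, ∀ (R' : CommAlgCat.{u} k)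
      (φ : R ⟶ R'), (∃ y, i.app R' y = F.map φ x) ↔ ∀ a ∈ I, φ.hom a = 0) :
    G.IsCorepresentable := by
  obtain ⟨X, ⟨h⟩⟩ := hF.has_corepresentation
  -- The ideal attached to the universal point defines the quotient of `X` that corepresents `G`.
  obtain ⟨I, hI⟩ := hcl X (h.homEquiv (𝟙 X))
  let π : X ⟶ CommAlgCat.of k (X ⧸ I) := CommAlgCat.ofHom (Ideal.Quotient.mkₐ k I)
  have hπ : ∀ a ∈ I, π.hom a = 0 := fun a ha => Ideal.Quotient.eq_zero_iff_mem.2 ha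
  have huniv : ∀ {R : CommAlgCat.{u} k} (φ : X ⟶ R), F.map φ (h.homEquiv (𝟙 X)) = h.homEquiv φ :=
    fun φ => by rw [← h.homEquiv_comp, Category.id_comp]
  have hex : ∀ {R : CommAlgCat.{u} k} (f : CommAlgCat.of k (X ⧸ I) ⟶ R),
      ∃ y, i.app R y = h.homEquiv (π ≫ f) := fun f => by
    rw [← huniv]
    refine (hI _ _).2 fun a ha => ?_
    rw [CommAlgCat.hom_comp, AlgHom.comp_apply, hπ a ha, map_zero]
  choose t ht using @hex
  refine ⟨_, ⟨{ homEquiv := fun {R} => Equiv.ofBijective (fun f => t f) ⟨fun f g hfg => ?_, fun y => ?_⟩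
                homEquiv_comp := fun {R R'} g f => hi R' ?_ }⟩⟩
  · have h1 := (ht f).symm.trans ((congrArg (i.app R) hfg).trans (ht g))
    have h2 := h.homEquiv.injective h1
    refine CommAlgCat.hom_ext (Ideal.Quotient.algHom_ext k ?_)
    exact congrArg CommAlgCat.Hom.hom h2
  · obtain ⟨φ, hφ⟩ := h.homEquiv.surjective (i.app R y)
    have h1 : ∀ a ∈ I, φ.hom a = 0 := (hI R φ).1 ⟨y, by rw [huniv, hφ]⟩
    refine ⟨CommAlgCat.ofHom (Ideal.Quotient.liftₐ I φ.hom h1), hi R ?_⟩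
    rw [ht, ← hφ]
    congr 1
  · change i.app R' (t (f ≫ g)) = i.app R' (G.map g (t f))
    rw [ht, NatTrans.naturality_apply, ht, ← h.homEquiv_comp, Category.assoc]

end ClosedSubfunctors

section OpsFunctor

variable {k : Type u} [Field k] (E : Type u) [Ring E] [Algebra k E]

/-- The functor of families of multilinear operations on extensions of scalars of `E`. -/
noncomputable def opsFunctor : CommAlgCat.{u} k ⥤ Type u where
  obj R := Ops R (R ⊗[k] E)
  map φ := ↾fun c => Ops.map φ.hom c
  map_id R := by
    ext c : 3
    exact Ops.map_id c
  map_comp φ ψ := by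
    ext c : 3
    exact Ops.map_comp φ.hom ψ.hom c

variable {E} in
theorem Ops.ofCoord_map {κ : Type*} [Fintype κ] [DecidableEq κ] (b : Module.Basis κ k E)
    {R R' : Type u} [CommRing R] [Algebra k R] [CommRing R'] [Algebra k R'] (φ : R →ₐ[k] R')
    (x : (Σ p : ℕ, (Fin p → κ) × κ) → R) :
    (Ops.ofCoord b x).map φ = Ops.ofCoord b (fun i => φ (x i)) := by
  rw [← Ops.ofCoord_coord b ((Ops.ofCoord b x).map φ)]
  congr 1
  funext i
  rw [Ops.coord_map, Ops.coord_ofCoord]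

/-- The coordinates in a basis of `E` are arbitrary elements of `R`, so the functor is an affine
space with countably many coordinates. -/
theorem opsFunctor_isCorepresentable [FiniteDimensional k E] :
    (opsFunctor (k := k) E).IsCorepresentable := by
  classical
  let b := Module.finBasis k E
  let σ : Type := Σ p : ℕ, (Fin p → Fin (Module.finrank k E)) × Fin (Module.finrank k E)
  let F : ∀ R : CommAlgCat.{u} k, (CommAlgCat.of k (MvPolynomial σ k) ⟶ R) → Ops R (R ⊗[k] E) :=
    fun R f => Ops.ofCoord b (fun x => f.hom (MvPolynomial.X x))
  have hF : ∀ R, Function.Bijective (F R) := by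
    refine fun R => ⟨fun f g hfg => ?_, fun c => ?_⟩
    · have h1 := congrArg (Ops.coord b) hfg
      rw [Ops.coord_ofCoord, Ops.coord_ofCoord] at h1
      exact CommAlgCat.hom_ext (MvPolynomial.algHom_ext fun x => congrFun h1 x)
    · refine ⟨CommAlgCat.ofHom (MvPolynomial.aeval (Ops.coord b c)), ?_⟩
      refine Eq.trans ?_ (Ops.ofCoord_coord b c)
      refine congrArg (Ops.ofCoord b) (funext fun x => ?_)
      exact MvPolynomial.aeval_X _ x
  refine ⟨CommAlgCat.of k (MvPolynomial σ k), ⟨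
    { homEquiv := fun {R} => Equiv.ofBijective (F R) (hF R)
      homEquiv_comp := fun {R R'} g f => ?_ }⟩⟩
  exact (Ops.ofCoord_map b g.hom fun x => f.hom (MvPolynomial.X x)).symm

variable {E}

/-- A condition on families of operations that defines a closed subfunctor. -/
def IsClosedCondition (P : ∀ R : CommAlgCat.{u} k, Ops R (R ⊗[k] E) → Prop) : Prop :=
  ∀ (R : CommAlgCat.{u} k) (c : Ops R (R ⊗[k] E)), ∃ I : Ideal R,
    ∀ (R' : CommAlgCat.{u} k) (φ : R ⟶ R'), P R' (c.map φ.hom) ↔ ∀ a ∈ I, φ.hom a = 0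

theorem IsClosedCondition.and {P Q : ∀ R : CommAlgCat.{u} k, Ops R (R ⊗[k] E) → Prop}
    (hP : IsClosedCondition P) (hQ : IsClosedCondition Q) :
    IsClosedCondition fun R c => P R c ∧ Q R c := by
  intro R c
  obtain ⟨I, hI⟩ := hP R c
  obtain ⟨J, hJ⟩ := hQ R c
  refine ⟨I ⊔ J, fun R' φ => ?_⟩
  change P R' (c.map φ.hom) ∧ Q R' (c.map φ.hom) ↔ _
  rw [hI, hJ]
  exact (sup_le_iff (a := I) (b := J) (c := RingHom.ker φ.hom)).symm

/-- The scalars `Z` generate the ideal; naturality says that they also describe the condition after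
base change. -/
theorem IsClosedCondition.of_scalars {J : Type*}
    {P : ∀ R : CommAlgCat.{u} k, Ops R (R ⊗[k] E) → Prop}
    (Z : J → ∀ R : CommAlgCat.{u} k, Ops R (R ⊗[k] E) → R)
    (hZ : ∀ j (R R' : CommAlgCat.{u} k) (φ : R ⟶ R') (c : Ops R (R ⊗[k] E)),
      Z j R' (c.map φ.hom) = φ.hom (Z j R c))
    (hP : ∀ R c, P R c ↔ ∀ j, Z j R c = 0) : IsClosedCondition P := by
  intro R c
  refine ⟨Ideal.span (Set.range fun j => Z j R c), fun R' φ => ?_⟩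
  rw [hP]
  simp only [hZ]
  refine Iff.trans ?_ (Ideal.span_le (s := Set.range fun j => Z j R c)
    (I := RingHom.ker φ.hom)).symm
  exact (Set.range_subset_iff (s := (RingHom.ker φ.hom : Set R))).symm

/-- The vanishing of a natural multilinear function of words on the words of given lengths is a
closed condition. -/
theorem IsClosedCondition.of_words [FiniteDimensional k E] (Q : ℕ → Prop)
    {P : ∀ R : CommAlgCat.{u} k, Ops R (R ⊗[k] E) → Prop}
    (Z : ∀ R : CommAlgCat.{u} k, Ops R (R ⊗[k] E) → List (R ⊗[k] E) → R ⊗[k] E)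
    (hm : ∀ (R : CommAlgCat.{u} k) c, IsMultilin (R := (R : Type u)) (Z R c))
    (hZ : ∀ (R R' : CommAlgCat.{u} k) (φ : R ⟶ R') (c : Ops R (R ⊗[k] E)) (w : List (R ⊗[k] E)),
      Z R' (c.map φ.hom) (w.map (coeffMap E φ.hom)) = coeffMap E φ.hom (Z R c w))
    (hP : ∀ R c, P R c ↔ ∀ w, Q w.length → Z R c w = 0) : IsClosedCondition P := by
  let b := Module.finBasis k E
  refine .of_scalars (J := {x : List E // Q x.length} × _)
    (fun j R c => (b.baseChange R).repr (Z R c (pureWord R j.1.1)) j.2)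
    (fun j R R' φ c => ?_) fun R c => ?_
  · rw [← repr_coeffMap, ← hZ]
    congr 3
    simp [pureWord]
  · rw [hP]
    constructor
    · intro h j
      rw [h _ (by simpa [pureWord] using j.1.2)]; simp
    · intro h w hw
      refine eq_zero_of_pureWord (hm R c) w.length (fun x hx => ?_) w rfl
      refine (b.baseChange R).repr.injective (Finsupp.ext fun j => ?_)
      rw [h ⟨⟨x, by rwa [hx]⟩, j⟩]; simp

/-- In each arity the cochains over `k` form a subspace, cut out by the linear forms that vanish on
it. These forms, extended to coefficients in `R`, are the equations. -/
theorem IsClosedCondition.cochain [FiniteDimensional k E] (𝒜 : ℤ → Submodule k E)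
    [GradedAlgebra 𝒜] {V : Type*} (e : V → E) (d : ℤ) (q : ℕ) :
    IsClosedCondition fun (R : CommAlgCat.{u} k) (c : Ops R (R ⊗[k] E)) =>
      IsCochain (fun i => (𝒜 i).baseChange R) (fun v => (1 : R) ⊗ₜ[k] e v) d q c := by
  classical
  let b := Module.finBasis k E
  refine .of_scalars (J := Σ p, (cochainSubmodule 𝒜 e d q p).dualAnnihilator)
    (fun j R c => ∑ t : (Fin j.1 → _) × _,
      c.coord b ⟨j.1, t⟩ * algebraMap k R (j.2.1 (elementary b t.1 t.2)))
    (fun j R R' φ c => ?_) fun R c => ?_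
  · simp only [Ops.coord_map, map_sum, map_mul, AlgHom.commutes]
  · have h1 : ∀ (p : ℕ) (ξ : Module.Dual k (MultilinearMap k (fun _ : Fin p => E) E))
        (l : R →ₗ[k] k), ξ (c.slice l p) = l (∑ t : (Fin p → _) × _,
          c.coord b ⟨p, t⟩ * algebraMap k R (ξ (elementary b t.1 t.2))) := by
      intro p ξ l
      rw [Ops.slice_eq_sum b, map_sum, map_sum]
      refine Finset.sum_congr rfl fun t _ => ?_
      rw [map_smul, mul_comm (c.coord b ⟨p, t⟩), ← Algebra.smul_def, map_smul, smul_eq_mul,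
        smul_eq_mul, mul_comm]
    constructor
    · rintro h ⟨p, ξ, hξ⟩
      refine (Module.forall_dual_apply_eq_zero_iff k _).1 fun l => ?_
      rw [← h1 p ξ l]
      exact (Submodule.mem_dualAnnihilator ξ).1 hξ _ ((h.slice l).single p)
    · intro h
      refine .of_slice fun l => isCochain_of_single fun p => ?_
      refine (Subspace.forall_mem_dualAnnihilator_apply_eq_zero_iff
        (cochainSubmodule 𝒜 e d q p) _).1 fun ξ hξ => ?_
      rw [h1, h ⟨p, ξ, hξ⟩, map_zero]

end OpsFunctor

section Schemes

variable {k : Type u} [Field k] {E : Type u} [Ring E] [Algebra k E]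
  (𝒜 : ℤ → Submodule k E) [GradedAlgebra 𝒜] {V : Type*} (e : V → E)

theorem idOp_map {R R' : Type*} [CommRing R] [Algebra k R] [CommRing R'] [Algebra k R']
    (φ : R →ₐ[k] R') (w : List (R ⊗[k] E)) :
    idOp (w.map (coeffMap E φ)) = coeffMap E φ (idOp w) := by
  match w with
  | [] => simp [idOp]
  | [_] => rfl
  | _ :: _ :: _ => simp [idOp]

theorem prodOp_map {R R' : Type*} [CommRing R] [Algebra k R] [CommRing R'] [Algebra k R']
    (φ : R →ₐ[k] R') (w : List (R ⊗[k] E)) :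
    prodOp (fun i => (𝒜 i).baseChange R') (w.map (coeffMap E φ)) =
      coeffMap E φ (prodOp (fun i => (𝒜 i).baseChange R) w) := by
  match w with
  | [] => simp [prodOp]
  | [_] => simp [prodOp]
  | [a, b] => simp [prodOp, koszul_coeffMap]
  | _ :: _ :: _ :: _ => simp [prodOp]

variable [FiniteDimensional k E]

theorem isClosedCondition_truncated (Q : ℕ → Prop) :
    IsClosedCondition fun (R : CommAlgCat.{u} k) (c : Ops R (R ⊗[k] E)) => ∀ p, Q p → c p = 0 := by
  refine .of_words Q (fun (R : CommAlgCat.{u} k) (c : Ops R (R ⊗[k] E)) => c.ev) (fun R c => c.isMultilin)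
    (fun R R' φ c w => Ops.ev_map φ.hom c w) fun R c => ⟨fun h w hw => ?_, fun h p hp => ?_⟩
  · rw [Ops.ev, h _ hw]; rfl
  · ext a
    rw [← Ops.ev_ofFn]
    exact h _ (by simpa using hp)

theorem isClosedCondition_gauge (n : ℕ∞) : IsClosedCondition
    fun (R : CommAlgCat.{u} k) (c : Ops R (R ⊗[k] E)) =>
    (∀ w : List (R ⊗[k] E), w.length ≤ 1 → c.ev w = idOp w) ∧
    IsCochain (fun i => (𝒜 i).baseChange R) (fun v => (1 : R) ⊗ₜ[k] e v) 1 2 c ∧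
    ∀ p : ℕ, 2 ≤ p ∧ n ≤ p → c p = 0 := by
  refine .and ?_ (.and (.cochain 𝒜 e 1 2) (isClosedCondition_truncated _))
  refine .of_words (· ≤ 1) (fun (R : CommAlgCat.{u} k) (c : Ops R (R ⊗[k] E)) w => c.ev w - idOp w)
    (fun R c => c.isMultilin.sub idOp_isMultilin) (fun R R' φ c w => ?_) fun R c => ?_
  · rw [Ops.ev_map, idOp_map, map_sub]
  · simp only [sub_eq_zero]

theorem isClosedCondition_an (n : ℕ∞) : IsClosedCondition
    fun (R : CommAlgCat.{u} k) (c : Ops R (R ⊗[k] E)) =>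
    (∀ w : List (R ⊗[k] E), w.length ≤ 2 → c.ev w = prodOp (fun i => (𝒜 i).baseChange R) w) ∧
    IsCochain (fun i => (𝒜 i).baseChange R) (fun v => (1 : R) ⊗ₜ[k] e v) 2 3 c ∧
    (∀ p : ℕ, 3 ≤ p ∧ n < p → c p = 0) ∧
    ∀ w : List (R ⊗[k] E), (w.length : ℕ∞) ≤ n →
      insertSum (koszul fun i => (𝒜 i).baseChange R) c.ev c.ev w = 0 := by
  refine .and ?_ (.and (.cochain 𝒜 e 2 3) (.and (isClosedCondition_truncated _) ?_))
  · refine .of_words (· ≤ 2) (fun (R : CommAlgCat.{u} k) (c : Ops R (R ⊗[k] E)) w => c.ev w - prodOp (fun i => (𝒜 i).baseChange R) w)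
      (fun R c => c.isMultilin.sub (prodOp_isMultilin _)) (fun R R' φ c w => ?_) fun R c => ?_
    · rw [Ops.ev_map, prodOp_map, map_sub]
    · simp only [sub_eq_zero]
  · refine .of_words (fun p => (p : ℕ∞) ≤ n)
      (fun (R : CommAlgCat.{u} k) (c : Ops R (R ⊗[k] E)) w => insertSum (koszul fun i => (𝒜 i).baseChange R) c.ev c.ev w)
      (fun R c => insertSum_isMultilin c.isMultilin c.isMultilin) (fun R R' φ c w => ?_)
      fun R c => Iff.rfl
    exact insertSum_map (coeffMap E φ.hom : R ⊗[k] E →+ R' ⊗[k] E) (koszul_coeffMap 𝒜 φ.hom)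
      (Ops.ev_map φ.hom c) (Ops.ev_map φ.hom c) w

/-- The inclusion of the gauge group into the functor of operations. -/
def gaugeInclusion (n : ℕ∞) : gaugeGroup 𝒜 e n ⟶ opsFunctor E where
  app R := ↾fun f => gaugeOps 𝒜 e (R := R) f
  naturality _ _ _ := rfl

/-- The inclusion of the scheme of `A_n`-structures into the functor of operations. -/
def anInclusion (n : ℕ∞) : anScheme 𝒜 e n ⟶ opsFunctor E where
  app R := ↾fun f => anOps 𝒜 e (R := R) f
  naturality _ _ _ := rfl

theorem gaugeGroup_isCorepresentable (n : ℕ∞) : (gaugeGroup 𝒜 e n).IsCorepresentable := by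
  refine isCorepresentable_of_closed (gaugeInclusion 𝒜 e n) (fun R f g h => Gauge.ext h)
    (opsFunctor_isCorepresentable E) fun R c => ?_
  obtain ⟨I, hI⟩ := isClosedCondition_gauge 𝒜 e n R c
  refine ⟨I, fun R' φ => Iff.trans ⟨?_, ?_⟩ (hI R' φ)⟩
  · rintro ⟨f, hf⟩
    have hf : f.op = c.map φ.hom := hf
    rw [← hf]
    exact ⟨f.low, f.cochain, fun p hp => f.truncated p hp.1 hp.2⟩
  · rintro ⟨h1, h2, h3⟩
    exact ⟨⟨c.map φ.hom, h1, h2, fun p hp hn => h3 p ⟨hp, hn⟩⟩, rfl⟩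

theorem anScheme_isCorepresentable (n : ℕ∞) : (anScheme 𝒜 e n).IsCorepresentable := by
  refine isCorepresentable_of_closed (anInclusion 𝒜 e n) (fun R f g h => AnStructure.ext h)
    (opsFunctor_isCorepresentable E) fun R c => ?_
  obtain ⟨I, hI⟩ := isClosedCondition_an 𝒜 e n R c
  refine ⟨I, fun R' φ => Iff.trans ⟨?_, ?_⟩ (hI R' φ)⟩
  · rintro ⟨f, hf⟩
    have hf : f.op = c.map φ.hom := hf
    rw [← hf]
    exact ⟨f.low, f.cochain, fun p hp => f.truncated p hp.1 hp.2, f.identity⟩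
  · rintro ⟨h1, h2, h3, h4⟩
    exact ⟨⟨c.map φ.hom, h1, h2, fun p hp hn => h3 p ⟨hp, hn⟩, h4⟩, rfl⟩

end Schemes

end AInf

namespace AInf

/-! ### Normal forms of `A_n`-structures -/

section NormalFormStructures

variable {R A : Type*} [CommRing R] [Ring A] [Algebra R A] {𝒜 : ℤ → Submodule R A}
  [GradedAlgebra 𝒜] {V : Type*} {e : V → A}

theorem gaugeAction_transforms (he : ∀ v, e v ∈ 𝒜 0) {n : ℕ∞} (f : Gauge 𝒜 e n)
    (m : AnStructure 𝒜 e n) :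
    WTransforms 𝒜 n f.op.ev m.op.ev ((gaugeAction he n).smul f m).op.ev :=
  (m.exists_smul he f).choose_spec

theorem gaugeAction_eq (he : ∀ v, e v ∈ 𝒜 0) {n : ℕ∞} {f : Gauge 𝒜 e n}
    {m m' : AnStructure 𝒜 e n} (H : WTransforms 𝒜 n f.op.ev m.op.ev m'.op.ev) :
    (gaugeAction he n).smul f m = m' :=
  AnStructure.eq_of_transforms he (gaugeAction_transforms he f m) H

theorem Gauge.isGaugeOps {n : ℕ∞} (f : Gauge 𝒜 e n) : IsGaugeOps 𝒜 e f.op := ⟨f.low, f.cochain⟩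

@[simp] theorem hochschildOps_zero : hochschildOps 𝒜 (0 : Ops R A) = 0 := by
  have := hochschildOps_add (𝒜 := 𝒜) (0 : Ops R A) 0
  simpa using this

theorem Gauge.higher_ev_zero {n : ℕ∞} (f : Gauge 𝒜 e n) {w : List A}
    (h : n ≤ (w.length : ℕ∞)) : f.op.higher.ev w = 0 := by
  rcases Nat.lt_or_ge w.length 2 with h2 | h2
  · rw [Ops.ev, Ops.higher_low _ h2]; rfl
  · rw [higher_ev h2, Ops.ev, f.truncated _ h2 h]; rfl

namespace Splitting

variable (S : Splitting 𝒜 e)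

/-- The differential raises the arity by one and the splitting lowers it by one, so reducedness is a
condition in each arity separately and survives truncation. -/
theorem Reduced.of_ev_eq {n : ℕ∞} {f : Ops R A} (hf : S.Reduced f) {g : Gauge 𝒜 e n}
    (h : ∀ w : List A, (w.length : ℕ∞) < n → g.op.ev w = f.ev w) : S.Reduced g.op := by
  refine Ops.ext_ev fun w => ?_
  rcases Nat.lt_or_ge w.length 2 with h2 | h2
  · rw [S.toHom_low h2, Ops.ev, Ops.higher_low _ h2]; rfl
  by_cases hn : (w.length : ℕ∞) < n
  · rw [higher_ev h2, h w hn]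
    refine S.toHom_hochschild_ev h2 (fun v hv => ?_) hf
    rw [higher_ev (by omega), h v (by rwa [hv])]
  · have hw := not_lt.1 hn
    rw [g.higher_ev_zero hw, Ops.ev, S.localized _ _ 0, map_zero]
    · rfl
    · rw [hochschildOps_local (c' := 0), hochschildOps_zero]
      rw [Ops.higher_of_le _ h2, g.truncated _ h2 hw]; rfl

theorem toHom_eq_zero_of_ev_eq {n : ℕ∞} {c : Ops R A} (hc : S.toHom c = 0)
    {m : AnStructure 𝒜 e n} (h : ∀ w : List A, (w.length : ℕ∞) ≤ n → m.op.ev w = c.ev w) :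
    S.toHom m.op = 0 := by
  refine Ops.ext_ev fun w => ?_
  rcases Nat.lt_or_ge w.length 2 with h2 | h2
  · rw [S.toHom_low h2]; rfl
  by_cases hn : ((w.length + 1 : ℕ) : ℕ∞) ≤ n
  · rw [S.toHom_ev_congr (c' := c), hc]
    exact fun v hv => h v (by rwa [hv])
  · rw [Ops.ev, S.localized _ _ 0, map_zero]
    · rfl
    · rw [m.truncated _ (by omega) (not_le.1 hn)]; rfl

theorem reduced_one (n : ℕ∞) : S.Reduced (1 : Gauge 𝒜 e n).op := by
  have h : (1 : Gauge 𝒜 e n).op.higher = 0 := Ops.ext_ev fun w => by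
    by_cases hn : (w.length : ℕ∞) < n
    · rcases Nat.lt_or_ge w.length 2 with h2 | h2
      · rw [Ops.ev, Ops.higher_low _ h2]; rfl
      · rw [higher_ev h2, Gauge.one_ev hn, idOp_eq_zero (by omega)]; rfl
    · rw [Gauge.higher_ev_zero _ (not_lt.1 hn)]; rfl
  rw [Reduced, h, hochschildOps_zero, map_zero]

variable (he : ∀ v, e v ∈ 𝒜 0) {n : ℕ∞}
include he

/-- The normalizer is constructed in all arities, although `m` need not satisfy the identities above
arity `n`; then everything is truncated. -/
theorem exists_normalForm (m : AnStructure 𝒜 e n) :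
    ∃ (f : Gauge 𝒜 e n) (m' : AnStructure 𝒜 e n), S.Reduced f.op ∧
      WTransforms 𝒜 n f.op.ev m.op.ev m'.op.ev ∧ S.toHom m'.op = 0 := by
  obtain ⟨f, m', hf, hr, hm', H, h0⟩ := S.exists_normalizer he (m.isAnWord he)
  have hid : WIdentity 𝒜 n m'.ev :=
    m.wIdentity.transforms hf.isGaugeWord (m.isAnWord he) hm' fun w _ => H w le_top
  refine ⟨.ofWord n f.ev hf.isGaugeWord, .ofWord n m'.ev hm' hid,
    hr.of_ev_eq S fun w hw => Gauge.ofWord_ev _ hw, ?_,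
    S.toHom_eq_zero_of_ev_eq h0 fun w hw => AnStructure.ofWord_ev _ _ hw⟩
  refine WTransforms.congr hf.isGaugeWord (Gauge.isGaugeWord _) (m.isAnWord he)
    (AnStructure.isAnWord he _) (fun w hw => (Gauge.ofWord_ev _ hw).symm) ?_
  exact WTransforms.congr_right (fun w hw => (AnStructure.ofWord_ev hm' hid hw).symm)
    fun w _ => H w le_top

/-- The reduced gauge transformation to the normal form. -/
noncomputable def normalizer (m : AnStructure 𝒜 e n) : Gauge 𝒜 e n :=
  (S.exists_normalForm he m).choose

/-- The normal form of an `A_n`-structure. -/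
noncomputable def normalForm (m : AnStructure 𝒜 e n) : AnStructure 𝒜 e n :=
  (S.exists_normalForm he m).choose_spec.choose

theorem normalizer_reduced (m : AnStructure 𝒜 e n) : S.Reduced (S.normalizer he m).op :=
  (S.exists_normalForm he m).choose_spec.choose_spec.1

theorem normalizer_transforms (m : AnStructure 𝒜 e n) :
    WTransforms 𝒜 n (S.normalizer he m).op.ev m.op.ev (S.normalForm he m).op.ev :=
  (S.exists_normalForm he m).choose_spec.choose_spec.2.1

theorem normalForm_normal (m : AnStructure 𝒜 e n) : S.toHom (S.normalForm he m).op = 0 :=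
  (S.exists_normalForm he m).choose_spec.choose_spec.2.2

/-- Uniqueness removes the arbitrariness of the choice. It is what makes the normalizer a morphism
of functors and trivial on normal structures. -/
theorem normalizer_unique {f : Gauge 𝒜 e n} {m m' : AnStructure 𝒜 e n} (hr : S.Reduced f.op)
    (H : WTransforms 𝒜 n f.op.ev m.op.ev m'.op.ev) (h : S.toHom m'.op = 0) :
    S.normalizer he m = f :=
  Gauge.ext_ev (S.reduced_unique he (Gauge.isGaugeOps _) f.isGaugeOps (S.normalizer_reduced he m) hr
    (m.isAnWord he) (AnStructure.isAnWord he _) (m'.isAnWord he) (S.normalizer_transforms he m) H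
    (S.normalForm_normal he m) h)

theorem normalForm_unique {f : Gauge 𝒜 e n} {m m' : AnStructure 𝒜 e n} (hr : S.Reduced f.op)
    (H : WTransforms 𝒜 n f.op.ev m.op.ev m'.op.ev) (h : S.toHom m'.op = 0) :
    S.normalForm he m = m' := by
  have h1 := S.normalizer_transforms he m
  rw [S.normalizer_unique he hr H h] at h1
  exact AnStructure.eq_of_transforms he h1 H

omit S in
theorem one_transforms (m : AnStructure 𝒜 e n) :
    WTransforms 𝒜 n (1 : Gauge 𝒜 e n).op.ev m.op.ev m.op.ev :=
  (WTransforms.refl n (m.isAnWord he)).congr isGaugeWord_idOp (Gauge.isGaugeWord _)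
    (m.isAnWord he) (m.isAnWord he) fun _ hw => (Gauge.one_ev hw).symm

theorem normalizer_of_normal {m : AnStructure 𝒜 e n} (h : S.toHom m.op = 0) :
    S.normalizer he m = 1 :=
  S.normalizer_unique he (S.reduced_one n) (one_transforms he m) h

theorem normalForm_of_normal {m : AnStructure 𝒜 e n} (h : S.toHom m.op = 0) :
    S.normalForm he m = m :=
  S.normalForm_unique he (S.reduced_one n) (one_transforms he m) h

/-- The two normal forms lie in one orbit, so `orbit_unique` identifies them. The vanishing of
`HH^1` enters the construction of the nice section only here. -/
theorem normalForm_eq_of_transforms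
    (hHH : ∀ i : ℕ, 1 ≤ i → ((i + 3 : ℕ) : ℕ∞) ≤ n → HH1Vanishes 𝒜 e i)
    {f : Gauge 𝒜 e n} {m m' : AnStructure 𝒜 e n}
    (H : WTransforms 𝒜 n f.op.ev m.op.ev m'.op.ev) :
    S.normalForm he m = S.normalForm he m' := by
  let _ := gaugeAction (e := e) he n
  have h1 : f • m = m' := gaugeAction_eq he H
  have h2 : S.normalizer he m • m = S.normalForm he m :=
    gaugeAction_eq he (S.normalizer_transforms he m)
  have h3 : S.normalizer he m' • m' = S.normalForm he m' :=
    gaugeAction_eq he (S.normalizer_transforms he m')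
  have h4 : (S.normalizer he m' * f * (S.normalizer he m)⁻¹) • S.normalForm he m =
      S.normalForm he m' := by
    rw [← h2, ← h3, ← h1, mul_smul, inv_smul_smul, mul_smul]
  have h5 : WTransforms 𝒜 n (S.normalizer he m' * f * (S.normalizer he m)⁻¹).op.ev
      (S.normalForm he m).op.ev
      ((S.normalizer he m' * f * (S.normalizer he m)⁻¹) • S.normalForm he m).op.ev :=
    gaugeAction_transforms he _ _
  rw [h4] at h5
  exact AnStructure.ext_ev (S.orbit_unique he hHH (Gauge.isGaugeWord _) (AnStructure.isAnWord he _)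
    (AnStructure.isAnWord he _) (AnStructure.wIdentity _) h5 (S.normalForm_normal he m)
    (S.normalForm_normal he m'))

omit he in
theorem toHom_trunc {n' : ℕ∞} (h : n ≤ n') {m : AnStructure 𝒜 e n'} (hm : S.toHom m.op = 0) :
    S.toHom (m.trunc h).op = 0 :=
  S.toHom_eq_zero_of_ev_eq hm fun _ hw => Ops.discard_ev _ _ fun h' => absurd h'.2 (not_lt.2 hw)

end Splitting

theorem AnStructure.trunc_ev {n n' : ℕ∞} (h : n ≤ n') (m : AnStructure 𝒜 e n') {w : List A}
    (hw : (w.length : ℕ∞) ≤ n) : (m.trunc h).op.ev w = m.op.ev w :=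
  Ops.discard_ev _ _ fun h' => absurd h'.2 (not_lt.2 hw)

/-- Compatible families of `A_n`-structures come from an `A_∞`-structure. -/
theorem AnStructure.exists_glue (he : ∀ v, e v ∈ 𝒜 0)
    (y : ∀ n : ℕ, AnStructure 𝒜 e ((n + 3 : ℕ) : ℕ∞))
    (hy : ∀ (n n' : ℕ) (h : ((n + 3 : ℕ) : ℕ∞) ≤ ((n' + 3 : ℕ) : ℕ∞)), (y n').trunc h = y n) :
    ∃ m : AnStructure 𝒜 e ⊤, ∀ n, m.trunc le_top = y n := by
  have h1 : ∀ (n n' : ℕ) (w : List A), w.length ≤ n + 3 → n ≤ n' →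
      (y n').op.ev w = (y n).op.ev w := fun n n' w hw h => by
    rw [← hy n n' (Nat.cast_le.2 (by omega)), AnStructure.trunc_ev _ _ (Nat.cast_le.2 hw)]
  have h2 : ∀ (n : ℕ) (w : List A), w.length ≤ n + 3 →
      (y w.length).op.ev w = (y n).op.ev w := fun n w hw => by
    rcases le_total n w.length with h | h
    · exact h1 n _ w hw h
    · exact (h1 _ n w (by omega) h).symm
  -- The value on `w` is taken from stage `w.length`, whose structure reaches up to arity `w.length
  -- + 3`.
  have hm : IsAnWord 𝒜 e fun w => (y w.length).op.ev w := .of_local fun N =>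
    ⟨(y N).op.ev, (y N).isAnWord he, fun w hw => h2 N w (by omega)⟩
  have hid : WIdentity 𝒜 ⊤ fun w => (y w.length).op.ev w := fun w _ => by
    rw [← (y w.length).wIdentity w (Nat.cast_le.2 (by omega))]
    exact sandwich_congr (fun v hv => h2 _ v (by omega)) (fun v _ hv => h2 _ v (by omega))
      fun _ _ _ => rfl
  refine ⟨.ofWord ⊤ _ hm hid, fun n => AnStructure.ext_ev fun w hw => ?_⟩
  rw [← h2 n w (Nat.cast_le.1 hw), AnStructure.trunc_ev _ _ hw,
    AnStructure.ofWord_ev hm hid (w := w) le_top]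

end NormalFormStructures

/-! ### Naturality of normal forms in the base ring -/

section NormalFormMap

variable {k : Type u} [Field k] {E : Type u} [Ring E] [Algebra k E] (𝒜 : ℤ → Submodule k E)
  [GradedAlgebra 𝒜] {V : Type*} (e : V → E)
  {R R' : Type u} [CommRing R] [Algebra k R] [CommRing R'] [Algebra k R']

theorem hochschildOps_map (φ : R →ₐ[k] R') (c : Ops R (R ⊗[k] E)) :
    hochschildOps (fun i => (𝒜 i).baseChange R') (c.map φ) =
      (hochschildOps (fun i => (𝒜 i).baseChange R) c).map φ := by
  refine Ops.ext_ev fun w => sub_eq_zero.1 (eq_zero_of_coeffMap φ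
    ((Ops.isMultilin _).sub (Ops.isMultilin _)) w.length (fun w _ => ?_) w rfl)
  rw [Ops.ev_map, hochschildOps_ev, hochschildOps_ev, hochschild, hochschild, map_sub,
    sub_eq_zero]
  congr 1
  · exact insertSum_map (coeffMap E φ : R ⊗[k] E →+ R' ⊗[k] E) (fun _ => rfl)
      (prodOp_map 𝒜 φ) (Ops.ev_map φ c) w
  · exact insertSum_map (coeffMap E φ : R ⊗[k] E →+ R' ⊗[k] E) (koszul_coeffMap 𝒜 φ)
      (Ops.ev_map φ c) (prodOp_map 𝒜 φ) w

theorem Ops.map_zero (φ : R →ₐ[k] R') : (0 : Ops R (R ⊗[k] E)).map φ = 0 := by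
  refine Ops.ext_ev fun w => eq_zero_of_coeffMap φ (Ops.isMultilin _) w.length
    (fun w _ => ?_) w rfl
  rw [Ops.ev_map, Ops.ev_zero, _root_.map_zero]

variable {𝒜 e}
variable (S : Splitting (fun i => (𝒜 i).baseChange R) (fun v => (1 : R) ⊗ₜ[k] e v))
  (S' : Splitting (fun i => (𝒜 i).baseChange R') (fun v => (1 : R') ⊗ₜ[k] e v))
  (φ : R →ₐ[k] R')
  (hS : ∀ c : Ops R (R ⊗[k] E), S'.toHom (c.map φ) = (S.toHom c).map φ)
include hS

theorem Splitting.Reduced.map {f : Ops R (R ⊗[k] E)} (hf : S.Reduced f) :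
    S'.Reduced (f.map φ) := by
  have h : (f.map φ).higher = f.higher.map φ := (Ops.discard_map φ _ f).symm
  rw [Reduced, h, hochschildOps_map, hS, hf]

variable (he : ∀ v, (1 : R) ⊗ₜ[k] e v ∈ (𝒜 0).baseChange R)
  (he' : ∀ v, (1 : R') ⊗ₜ[k] e v ∈ (𝒜 0).baseChange R') {n : ℕ∞}
  (m : AnStructure (fun i => (𝒜 i).baseChange R) (fun v => (1 : R) ⊗ₜ[k] e v) n)

theorem Splitting.toHom_map_eq_zero {c : Ops R (R ⊗[k] E)} (h : S.toHom c = 0) :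
    S'.toHom (c.map φ) = 0 := by
  rw [hS, h, Ops.map_zero]

/-- The base change of the normalizer is reduced and leads to a normal structure, so it is the
normalizer of the base change. -/
theorem Splitting.normalizer_map :
    S'.normalizer he' (m.map 𝒜 e φ) = (S.normalizer he m).map 𝒜 e φ :=
  S'.normalizer_unique he' (Reduced.map S S' φ hS (S.normalizer_reduced he m))
    (m' := (S.normalForm he m).map 𝒜 e φ)
    (transforms_iff.1 ((transforms_iff.2 (S.normalizer_transforms he m)).map 𝒜 φ))
    (toHom_map_eq_zero S S' φ hS (S.normalForm_normal he m))

theorem Splitting.normalForm_map :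
    S'.normalForm he' (m.map 𝒜 e φ) = (S.normalForm he m).map 𝒜 e φ :=
  S'.normalForm_unique he' (f := (S.normalizer he m).map 𝒜 e φ)
    (Reduced.map S S' φ hS (S.normalizer_reduced he m))
    (transforms_iff.1 ((transforms_iff.2 (S.normalizer_transforms he m)).map 𝒜 φ))
    (toHom_map_eq_zero S S' φ hS (S.normalForm_normal he m))

end NormalFormMap

end AInf

namespace AInf

/-! ### The moduli functors -/

section GaugeHom

variable {k : Type u} [Field k] {E : Type u} [Ring E] [Algebra k E] (𝒜 : ℤ → Submodule k E)
  [GradedAlgebra 𝒜] {V : Type*} (e : V → E)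
  {R R' : Type u} [CommRing R] [Algebra k R] [CommRing R'] [Algebra k R']

theorem Gauge.map_mul (φ : R →ₐ[k] R') {n : ℕ∞} (f g : GaugePoints 𝒜 e n R) :
    (f * g).map 𝒜 e φ = f.map 𝒜 e φ * g.map 𝒜 e φ := by
  refine Gauge.ext_ev fun w hw => ?_
  rw [Gauge.mul_ev _ _ hw, ← sub_eq_zero]
  refine eq_zero_of_coeffMap φ ((Ops.isMultilin _).sub (blockSum_isMultilin
    (Ops.isMultilin _) (Ops.isMultilin _))) w.length (fun w' hw' => ?_) w rfl
  rw [sub_eq_zero]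
  refine (Ops.ev_map φ (f * g).op w').trans ?_
  rw [Gauge.mul_ev _ _ (by rwa [hw'])]
  exact (blockSum_map (coeffMap E φ : R ⊗[k] E →+ R' ⊗[k] E) (Ops.ev_map φ f.op)
    (Ops.ev_map φ g.op) w').symm

theorem Gauge.map_inv (φ : R →ₐ[k] R') {n : ℕ∞} (f : GaugePoints 𝒜 e n R) :
    f⁻¹.map 𝒜 e φ = (f.map 𝒜 e φ)⁻¹ :=
  _root_.map_inv (MonoidHom.mk' (fun f : GaugePoints 𝒜 e n R => f.map 𝒜 e φ)
    (Gauge.map_mul 𝒜 e φ)) f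

variable {𝒜 e}

theorem one_tmul_mem (he : ∀ v, e v ∈ 𝒜 0) (R : Type*) [CommRing R] [Algebra k R] (v : V) :
    (1 : R) ⊗ₜ[k] e v ∈ (𝒜 0).baseChange R :=
  Submodule.tmul_mem_baseChange_of_mem _ (he v)

end GaugeHom

section Moduli

variable {k : Type u} [Field k] {E : Type u} [Ring E] [Algebra k E]
  {𝒜 : ℤ → Submodule k E} [GradedAlgebra 𝒜] {V : Type*} {e : V → E}
  (S : ∀ (R : Type u) [CommRing R] [Algebra k R],
    Splitting (fun i => (𝒜 i).baseChange R) (fun v => (1 : R) ⊗ₜ[k] e v))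
  (hS : ∀ (R R' : Type u) [CommRing R] [Algebra k R] [CommRing R'] [Algebra k R'] (φ : R →ₐ[k] R')
    (c : Ops R (R ⊗[k] E)), (S R').toHom (c.map φ) = ((S R).toHom c).map φ)

/-- The subfunctor of `A_n`-structures in normal form. -/
def normalSubfunctor (n : ℕ∞) : Subfunctor (anScheme 𝒜 e n) where
  obj R := {m | (S R).toHom (anOps 𝒜 e m) = 0}
  map {R R'} φ _ hm := Splitting.toHom_map_eq_zero (S R) (S R') φ.hom (hS R R' φ.hom) hm

include hS in
theorem isClosedCondition_normal [FiniteDimensional k E] : IsClosedCondition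
    fun (R : CommAlgCat.{u} k) (c : Ops R (R ⊗[k] E)) => (S R).toHom c = 0 := by
  refine .of_words (fun _ => True)
    (fun (R : CommAlgCat.{u} k) (c : Ops R (R ⊗[k] E)) => ((S R).toHom c).ev)
    (fun R c => Ops.isMultilin _) (fun R R' φ c w => ?_) fun R c => ⟨fun h w _ => ?_, fun h => ?_⟩
  · rw [hS, Ops.ev_map]
  · rw [h]; rfl
  · exact Ops.ext_ev fun w => h w trivial

theorem isClosedSubscheme_normal [FiniteDimensional k E] (n : ℕ∞) :
    IsClosedSubscheme (normalSubfunctor S hS n) :=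
  fun R x => isClosedCondition_normal S hS R (anOps 𝒜 e x)

theorem normalSubfunctor_isCorepresentable [FiniteDimensional k E] (n : ℕ∞) :
    (normalSubfunctor S hS n).toFunctor.IsCorepresentable := by
  refine isCorepresentable_of_closed (normalSubfunctor S hS n).ι
    (fun R => Subtype.val_injective) (anScheme_isCorepresentable 𝒜 e n) fun R x => ?_
  obtain ⟨I, hI⟩ := isClosedSubscheme_normal S hS n R x
  refine ⟨I, fun R' φ => Iff.trans ⟨?_, fun h => ⟨⟨_, h⟩, rfl⟩⟩ (hI R' φ)⟩
  rintro ⟨y, hy⟩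
  exact (congrArg (· ∈ (normalSubfunctor S hS n).obj R') hy).mp y.2

variable (he : ∀ v, e v ∈ 𝒜 0)

/-- The projection to normal forms. -/
noncomputable def normalProjection (n : ℕ∞) :
    anScheme 𝒜 e n ⟶ (normalSubfunctor S hS n).toFunctor where
  app R := ↾fun m => ⟨(S R).normalForm (one_tmul_mem he R) m,
    (S R).normalForm_normal (one_tmul_mem he R) m⟩
  naturality R R' φ := by
    ext m
    exact Subtype.ext ((S R).normalForm_map (S R') φ.hom (hS R R' φ.hom) (one_tmul_mem he R)
      (one_tmul_mem he R') m)

/-- The gauge transformation from the normal form. -/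
noncomputable def normalGauge (n : ℕ∞) : anScheme 𝒜 e n ⟶ gaugeGroup 𝒜 e n where
  app R := ↾fun m => Inv.inv (α := GaugePoints 𝒜 e n R) ((S R).normalizer (one_tmul_mem he R) m)
  naturality R R' φ := by
    ext m
    have h := (S R).normalizer_map (S R') φ.hom (hS R R' φ.hom) (one_tmul_mem he R)
      (one_tmul_mem he R') m
    exact (congrArg (Inv.inv (α := GaugePoints 𝒜 e n R')) h).trans (Gauge.map_inv 𝒜 e φ.hom _).symm

noncomputable instance (n : ℕ∞) (R : CommAlgCat.{u} k) : Group ((gaugeGroup 𝒜 e n).obj R) :=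
  inferInstanceAs (Group (GaugePoints 𝒜 e n R))

/-- The action of gauge transformations on points. -/
@[reducible] noncomputable def pointsAction (n : ℕ∞) (R : CommAlgCat.{u} k) :
    MulAction ((gaugeGroup 𝒜 e n).obj R) ((anScheme 𝒜 e n).obj R) :=
  gaugeAction (one_tmul_mem he R) n

/-- With the normalizer `g` of `x`, take `ρ(x) = g⁻¹` and `π(x) = g * x`. Invariance of `π` requires
the vanishing of `HH^1` over every `R`, which follows from that over `k`. -/
theorem isNiceSection_normal [FiniteDimensional k E] (n : ℕ∞)
    (hHH : ∀ i : ℕ, 1 ≤ i → ((i + 3 : ℕ) : ℕ∞) ≤ n → HH1Vanishes 𝒜 e i) :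
    let _ := pointsAction (n := n) he
    IsNiceSection (gaugeGroup 𝒜 e n) (anScheme 𝒜 e n) (normalSubfunctor S hS n) := by
  intro _
  refine ⟨isClosedSubscheme_normal S hS n, normalGauge S hS he n, normalProjection S hS he n,
    fun R g x => ?_, fun R x hx => ?_, fun R x => ?_⟩
  · exact Subtype.ext ((S R).normalForm_eq_of_transforms (one_tmul_mem he R)
      (fun i hi h => (hHH i hi h).baseChange R)
      (gaugeAction_transforms (one_tmul_mem he R) g x)).symm
  · have h := (S R).normalizer_of_normal (one_tmul_mem he R) hx
    exact (congrArg (Inv.inv (α := GaugePoints 𝒜 e n R)) h).trans inv_one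
  · let g : (gaugeGroup 𝒜 e n).obj R := (S R).normalizer (one_tmul_mem he R) x
    have h : g • x = (S R).normalForm (one_tmul_mem he R) x :=
      gaugeAction_eq _ ((S R).normalizer_transforms (one_tmul_mem he R) x)
    exact inv_smul_eq_iff.2 h.symm

section Classes

variable {n : ℕ∞} (hHH : ∀ i : ℕ, 1 ≤ i → ((i + 3 : ℕ) : ℕ∞) ≤ n → HH1Vanishes 𝒜 e i)
  {R : Type u} [CommRing R] [Algebra k R]

include hHH in
/-- The normal form of a gauge equivalence class. -/
noncomputable def classNormalForm [FiniteDimensional k E] :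
    Quot (GaugeEquivalent 𝒜 e (n := n) (R := R)) → AnPoints 𝒜 e n R :=
  Quot.lift ((S R).normalForm (one_tmul_mem he R)) fun _ _ ⟨_, H⟩ =>
    (S R).normalForm_eq_of_transforms (one_tmul_mem he R)
      (fun i hi h => (hHH i hi h).baseChange R) (transforms_iff.1 H)

variable [FiniteDimensional k E]

theorem mk_classNormalForm (x : Quot (GaugeEquivalent 𝒜 e (n := n) (R := R))) :
    Quot.mk _ (classNormalForm S he hHH x) = x := by
  induction x using Quot.ind with | _ m =>
  exact (Quot.sound ⟨_, transforms_iff.2 ((S R).normalizer_transforms (one_tmul_mem he R) m)⟩).symm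

theorem classNormalForm_normal (x : Quot (GaugeEquivalent 𝒜 e (n := n) (R := R))) :
    (S R).toHom (classNormalForm S he hHH x).op = 0 := by
  induction x using Quot.ind with | _ m =>
  exact (S R).normalForm_normal (one_tmul_mem he R) m

theorem classNormalForm_mk {m : AnPoints 𝒜 e n R} (hm : (S R).toHom m.op = 0) :
    classNormalForm S he hHH (Quot.mk _ m) = m :=
  (S R).normalForm_of_normal (one_tmul_mem he R) hm

end Classes

variable [FiniteDimensional k E]

/-- Over each `R` the inverse sends a class to its normal form, which is well defined by the
vanishing of `HH^1`. -/
theorem isIso_normal_toModuli (n : ℕ∞)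
    (hHH : ∀ i : ℕ, 1 ≤ i → ((i + 3 : ℕ) : ℕ∞) ≤ n → HH1Vanishes 𝒜 e i)
    (he : ∀ v, e v ∈ 𝒜 0) :
    IsIso ((normalSubfunctor S hS n).ι ≫ toModuli 𝒜 e n) := by
  rw [NatTrans.isIso_iff_isIso_app]
  intro R
  rw [isIso_iff_bijective]
  refine ⟨fun x y h => Subtype.ext ?_, fun x => ?_⟩
  · have h1 : Quot.mk (GaugeEquivalent 𝒜 e (n := n) (R := R)) x.1 = Quot.mk _ y.1 := h
    have h2 := congrArg (classNormalForm S he hHH) h1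
    exact (classNormalForm_mk S he hHH x.2).symm.trans
      (h2.trans (classNormalForm_mk S he hHH y.2))
  · exact ⟨⟨classNormalForm S he hHH x, classNormalForm_normal S he hHH x⟩,
      mk_classNormalForm S he hHH x⟩

theorem moduli_isCorepresentable (n : ℕ∞)
    (hHH : ∀ i : ℕ, 1 ≤ i → ((i + 3 : ℕ) : ℕ∞) ≤ n → HH1Vanishes 𝒜 e i)
    (he : ∀ v, e v ∈ 𝒜 0) : (moduli 𝒜 e n).IsCorepresentable := by
  obtain ⟨S, hS⟩ := exists_splitting 𝒜 e
  have := isIso_normal_toModuli S hS n hHH he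
  have := normalSubfunctor_isCorepresentable S hS n
  exact corepresentable_of_natIso _
    (asIso ((normalSubfunctor S hS n).ι ≫ toModuli 𝒜 e n))

/-- The cone of moduli functors over the finite stages. -/
noncomputable def moduliCone (𝒜 : ℤ → Submodule k E) [GradedAlgebra 𝒜] (e : V → E) :
    Limits.Cone (finiteStage.op ⋙ moduliTower 𝒜 e) where
  pt := moduli 𝒜 e ⊤
  π :=
    { app := fun n => (moduliTower 𝒜 e).map (homOfLE (le_top (a := finiteStage.obj n.unop))).op
      naturality := fun n n' h => by
        refine (Category.id_comp _).trans (Eq.trans ?_ ((moduliTower 𝒜 e).map_comp _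
          (finiteStage.op.map h)))
        exact congrArg (moduliTower 𝒜 e).map (Quiver.Hom.unop_inj (Subsingleton.elim _ _)) }

/-- A compatible family of classes need not obviously lift to compatible structures. Normal forms
provide the lift: the truncation of a normal structure is normal, and a class contains only one of
these, so the representatives are strictly compatible and glue. -/
theorem moduliCone_isLimit (hHH : ∀ i : ℕ, 1 ≤ i → HH1Vanishes 𝒜 e i) (he : ∀ v, e v ∈ 𝒜 0) :
    Nonempty (Limits.IsLimit (moduliCone 𝒜 e)) := by
  obtain ⟨S, hS⟩ := exists_splitting 𝒜 e
  have hn : ∀ n : ℕ∞, ∀ i : ℕ, 1 ≤ i → ((i + 3 : ℕ) : ℕ∞) ≤ n → HH1Vanishes 𝒜 e i :=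
    fun n i hi _ => hHH i hi
  refine ⟨Limits.evaluationJointlyReflectsLimits _ fun R => Nonempty.some ?_⟩
  rw [Limits.Types.isLimit_iff]
  intro s hs
  let y : ∀ n : ℕ, AnPoints 𝒜 e ((n + 3 : ℕ) : ℕ∞) R := fun n =>
    classNormalForm S he (hn _) (s (op n))
  have hy0 : ∀ n, (S R).toHom (y n).op = 0 := fun n => classNormalForm_normal S he (hn _) _
  have hy1 : ∀ n, Quot.mk _ (y n) = s (op n) := fun n => mk_classNormalForm S he (hn _) _
  have huniq : ∀ {n : ℕ∞} {m m' : AnPoints 𝒜 e n R}, (S R).toHom m.op = 0 →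
      (S R).toHom m'.op = 0 → Quot.mk (GaugeEquivalent 𝒜 e) m = Quot.mk _ m' → m = m' :=
    fun {n m m'} h h' H => by
      have h2 := congrArg (classNormalForm S he (hn n)) H
      rwa [classNormalForm_mk S he (hn n) h, classNormalForm_mk S he (hn n) h'] at h2
  have hy : ∀ (n n' : ℕ) (h : ((n + 3 : ℕ) : ℕ∞) ≤ ((n' + 3 : ℕ) : ℕ∞)),
      (y n').trunc h = y n := fun n n' h => by
    refine huniq ((S R).toHom_trunc h (hy0 n')) (hy0 n) ?_
    refine Eq.trans ?_ (hy1 n).symm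
    have h1 : n ≤ n' := by have := Nat.cast_le.1 h; omega
    refine Eq.trans ?_ (hs (homOfLE h1).op)
    rw [← hy1 n']
    rfl
  obtain ⟨m, hm⟩ := AnStructure.exists_glue (one_tmul_mem he R) y hy
  -- For uniqueness, a normal `A_∞`-structure with the given classes has the prescribed normal
  -- truncations, and these determine it.
  have hglue : ∀ m' : AnPoints 𝒜 e ⊤ R, (S R).toHom m'.op = 0 →
      (∀ n : ℕ, Quot.mk _ (m'.trunc (n := ((n + 3 : ℕ) : ℕ∞)) le_top) = s (op n)) → m' = m := by
    refine fun m' h0 h => AnStructure.ext_ev fun w _ => ?_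
    have h1 : m'.trunc (n := ((w.length + 3 : ℕ) : ℕ∞)) le_top = m.trunc le_top := by
      rw [hm w.length]
      exact huniq ((S R).toHom_trunc _ h0) (hy0 _) ((h _).trans (hy1 _).symm)
    have h2 : (w.length : ℕ∞) ≤ ((w.length + 3 : ℕ) : ℕ∞) := Nat.cast_le.2 (by omega)
    rw [← AnStructure.trunc_ev le_top m' h2, h1, AnStructure.trunc_ev le_top m h2]
  refine ⟨Quot.mk _ m, fun n => ?_, fun x hx => ?_⟩
  · refine Eq.trans ?_ (hy1 n.unop)
    rw [← hm]
    rfl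
  · have hx' := mk_classNormalForm S he (hn ⊤) x
    refine hx'.symm.trans (congrArg (Quot.mk _) (hglue _ (classNormalForm_normal S he (hn ⊤) x)
      fun n => Eq.trans ?_ (hx (op n))))
    exact congrArg (((evaluation _ _).obj R).mapCone (moduliCone 𝒜 e) |>.π.app (op n)) hx'

end Moduli

end AInf

/-! ### The main theorem -/

open AInf

theorem mainTheorem4 {k : Type u} [Field k] {E : Type u} [Ring E] [Algebra k E]
    [FiniteDimensional k E] (𝒜 : ℤ → Submodule k E) [GradedAlgebra 𝒜]
    {V : Type*} (e : V → E) (he : OrthogonalIdempotents e) (he_deg : ∀ v, e v ∈ 𝒜 0) :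
    -- the gauge transformations form affine group schemes acting on the affine schemes
    -- of minimal `A_n`-structures
    (∀ n : ℕ∞, (gaugeGroup 𝒜 e n).IsCorepresentable ∧ (anScheme 𝒜 e n).IsCorepresentable) ∧
    ∃ (_ : ∀ (n : ℕ∞) (R : CommAlgCat.{u} k), Group ((gaugeGroup 𝒜 e n).obj R))
      (_ : ∀ (n : ℕ∞) (R : CommAlgCat.{u} k),
        MulAction ((gaugeGroup 𝒜 e n).obj R) ((anScheme 𝒜 e n).obj R)),
      -- the group law is the composition of coalgebra automorphisms
      (∀ (n : ℕ∞) (R : CommAlgCat.{u} k) (f g : (gaugeGroup 𝒜 e n).obj R) (w : List (R ⊗[k] E)),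
        (w.length : ℕ∞) < n →
          (gaugeOps 𝒜 e (f * g)).ev w = blockSum (gaugeOps 𝒜 e f).ev (gaugeOps 𝒜 e g).ev w) ∧
      -- the action is conjugation of coderivations by coalgebra automorphisms
      (∀ (n : ℕ∞) (R : CommAlgCat.{u} k) (f : (gaugeGroup 𝒜 e n).obj R)
        (m : (anScheme 𝒜 e n).obj R),
          Transforms (fun i => (𝒜 i).baseChange R) n
            (gaugeOps 𝒜 e f) (anOps 𝒜 e m) (anOps 𝒜 e (f • m))) ∧
      -- nice sections, and representability of the functor of gauge classes of `A_n`-structures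
      (∀ n : ℕ, 3 ≤ n → (∀ i : ℕ, 1 ≤ i → i + 3 ≤ n → HH1Vanishes 𝒜 e i) →
        ∃ S : Subfunctor (anScheme 𝒜 e n),
          IsNiceSection (gaugeGroup 𝒜 e n) (anScheme 𝒜 e n) S ∧
          S.toFunctor.IsCorepresentable ∧ IsIso (S.ι ≫ toModuli 𝒜 e n)) ∧
      -- representability of the functor of gauge classes of `A_∞`-structures by the inverse limit
      ((∀ i : ℕ, 1 ≤ i → HH1Vanishes 𝒜 e i) →
        (∃ (B : ℕ ⥤ CommAlgCat.{u} k)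
          (_ : B.op ⋙ coyoneda ≅ finiteStage.op ⋙ moduliTower 𝒜 e)
          (c : Limits.Cocone B), Nonempty (Limits.IsColimit c)) ∧
        ∀ (B : ℕ ⥤ CommAlgCat.{u} k)
          (α : B.op ⋙ coyoneda ≅ finiteStage.op ⋙ moduliTower 𝒜 e)
          (c : Limits.Cocone B), Limits.IsColimit c →
          ∃ β : coyoneda.obj (op c.pt) ≅ moduli 𝒜 e ⊤, ∀ n : ℕ,
            coyoneda.map (c.ι.app n).op ≫ α.hom.app (op n) =
              β.hom ≫ (moduliTower 𝒜 e).map (homOfLE (le_top (a := finiteStage.obj n))).op) := by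
  refine ⟨fun n => ⟨gaugeGroup_isCorepresentable 𝒜 e n, anScheme_isCorepresentable 𝒜 e n⟩,
    fun n R => inferInstance, fun n R => pointsAction he_deg n R, fun n R f g w hw =>
      Gauge.mul_ev _ _ hw, fun n R f m => transforms_iff.2 (gaugeAction_transforms _ f m),
    fun n _ hHH => ?_, fun hHH => ⟨?_, fun B α c hc => ?_⟩⟩
  · obtain ⟨S, hS⟩ := exists_splitting 𝒜 e
    have hn : ∀ i : ℕ, 1 ≤ i → ((i + 3 : ℕ) : ℕ∞) ≤ n → HH1Vanishes 𝒜 e i :=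
      fun i hi h => hHH i hi (Nat.cast_le.1 h)
    exact ⟨normalSubfunctor S hS n, isNiceSection_normal S hS he_deg n hn,
      normalSubfunctor_isCorepresentable S hS n, isIso_normal_toModuli S hS n hn he_deg⟩
  · have h : ∀ j, (coyoneda (C := CommAlgCat.{u} k)).essImage
        ((finiteStage.op ⋙ moduliTower 𝒜 e).obj j) := fun j =>
      ⟨_, ⟨@Functor.coreprW _ _ _ (moduli_isCorepresentable (finiteStage.obj j.unop)
        (fun i hi _ => hHH i hi) he_deg)⟩⟩
    -- As the embedding `coyoneda` is fully faithful, choosing representing algebras stage by stage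
    -- also provides the transition maps between them.
    let B := (Functor.essImage.liftFunctor (finiteStage.op ⋙ moduliTower 𝒜 e) coyoneda h).unop
    exact ⟨B, Functor.essImage.liftFunctorCompIso _ _ h, Limits.colimit.cocone B,
      ⟨Limits.colimit.isColimit B⟩⟩
  · obtain ⟨hlim⟩ := moduliCone_isLimit hHH he_deg
    -- The embedding turns the colimit of algebras into a limit of functors. It is compared with the
    -- limit cone of the moduli functors along `α`.
    refine ⟨(Limits.isLimitOfPreserves coyoneda hc.op).conePointsIsoOfNatIso hlim α, fun n => ?_⟩
    exact ((Limits.isLimitOfPreserves coyoneda hc.op).conePointsIsoOfNatIso_hom_comp hlim α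
      (op n)).symm
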